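/- **Setting.** All algebras are complex and unital, $\otimes=\otimes_{\mathbb C}$. Let $G\subseteq GL_m(\mathbb C)$ be a compact group and let $\mathcal A$ be the commutative Hopf $*$-algebra of polynomial functions on $G$ (the $*$-algebra generated by the matrix entries of $g$ and $g^{-1}$), with coproduct $\phi(a)=\sum a^{(1)}\otimes a^{(2)}$, counit $\epsilon$ and antipode $\kappa$. Let $u$ be a real unitary representation of $G$ in $\mathbb C^n$ with discrete kernel and matrix elements $u_{ij}\in\mathcal A$, viewed as the coaction $e_i\mapsto\sum_j e_j\otimes u_{ji}$. Let $P$ be a quantum principal $G$-bundle, given by a $*$-algebra $\mathcal B$ and a $*$-homomorphism $F:\mathcal B\to\mathcal B\otimes\mathcal A$ which is a coaction of $\mathcal A$ and is free: each $1\otimes a$, $a\in\mathcal A$, has the form $\sum_k(q_k\otimes 1)F(b_k)$ with $q_k,b_k\in\mathcal B$. Let $\mathcal V=\{f\in\mathcal B: F(f)=f\otimes1\}$ be the algebra of the base. Let $\tau=(\partial_1,\dots,\partial_n)$ be an integrable frame structure on $P$ relative to $u$. That is, $\partial_i:\mathcal V\to\mathcal B$ are hermitian derivations with $F\partial_i(f)=\sum_j\partial_j(f)\otimes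 u_{ji}$; there are finitely many $b_{i\alpha}\in\mathcal B$, $v_{i\alpha}\in\mathcal V$ with $\sum_\alpha b_{i\alpha}\partial_j(v_{i\alpha})=\delta_{ij}1$; and there exist hermitian derivations $X_i:\mathcal B\to\mathcal B$ with $FX_j=\sum_k(X_k\otimes u_{kj})F$, $X_i|_{\mathcal V}=\partial_i$ and $X_i\partial_j=X_j\partial_i$ on $\mathcal V$. *Horizontal forms and preconnections.* Let $\mathrm{hor}_P=\mathcal B\otimes\Lambda\mathbb C^n$, a graded $*$-algebra in which $\theta_i=1\otimes e_i$ is hermitian of degree one (graded $*$-algebra: $(xy)^*=(-1)^{\partial x\,\partial y}y^*x^*$). Let $F^\wedge:\mathrm{hor}_P\to\mathrm{hor}_P\otimes\mathcal A$ be the product of $F$ and the coaction induced by $u$ on $\Lambda\mathbb C^n$; for $\varphi\in\mathrm{hor}_P$ write $F^\wedge(\varphi)=\sum_k\varphi_k\otimes c_k$. Let $\Omega_M=\{w: F^\wedge(w)=w\otimes1\}$ and let $d_M$ be the restriction to $\Omega_M$ of the antiderivation $\nabla$ given by $\nabla(b)=\sum_kX_k(b)\theta_k$, $\nabla(\theta_i)=0$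 (this restriction does not depend on the choice of $X$). A *preconnection* is a hermitian antiderivation $D$ of $\mathrm{hor}_P$ of degree one with $F^\wedge D=(D\otimes\mathrm{id})F^\wedge$ and $D|_{\Omega_M}=d_M$. For a preconnection $D$ and a difference $E$ of two preconnections let $\varrho_D^\star,\chi_E^\star:\mathcal A\to\mathrm{hor}_P$ be the unique linear maps such that, for all (homogeneous, in the second case) $\varphi$, $$D^2(\varphi)=-\sum_k\varphi_k\,\varrho_D^\star(c_k),\qquad E(\varphi)=-(-1)^{\partial\varphi}\sum_k\varphi_k\,\chi_E^\star(c_k).$$ *The calculus on $G$.* Let $\mathcal R\subseteq\ker\epsilon$ be the ideal of $\mathcal A$ of all elements of $\ker\epsilon$ annihilated by every $\varrho_D^\star$ and every $\chi_E^\star$. Put $\Psi_{inv}=\ker\epsilon/\mathcal R$, let $\pi:\mathcal A\to\Psi_{inv}$, $\pi(a)=[a-\epsilon(a)1]$, and let $\varrho_D:\Psi_{inv}\to\mathrm{hor}_P$ be the map with $\varrho_D\pi=\varrho_D^\star$. Let $\Psi_{inv}^\wedge$ be the left-invariant part of the universal differential envelope $\Psi^\wedge$ of the corresponding first-order calculus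 $\Psi$: the quotient of the tensor algebra of $\Psi_{inv}$ by the ideal generated by the elements $\sum\pi(r^{(1)})\otimes\pi(r^{(2)})$, $r\in\mathcal R$. It carries the differential with $d\pi(a)=-\sum\pi(a^{(1)})\pi(a^{(2)})$, the right $\mathcal A$-module structure $\circ$ with $[b]\circ a=[ba]$ for $b\in\ker\epsilon$, $1\circ a=\epsilon(a)1$ and $(\vartheta\eta)\circ a=\sum(\vartheta\circ a^{(1)})(\eta\circ a^{(2)})$, and the graded $*$-structure with $\pi(a)^*=-\pi(\kappa(a)^*)$. *The algebra $\Omega_P$.* Let $\Omega_P$ be the graded-differential $*$-algebra associated to $\mathrm{hor}_P$, $\Psi^\wedge$ and the preconnections. In the representation given by a preconnection $D$ it is the graded vector space $\mathrm{hor}_P\otimes\Psi_{inv}^\wedge$ with $$(\psi\otimes\vartheta)(\varphi\otimes\eta)=\sum_k(-1)^{\partial\vartheta\,\partial\varphi}\psi\varphi_k\otimes(\vartheta\circ c_k)\eta,\qquad(\varphi\otimes\vartheta)^*=\sum_k\varphi_k^*\otimes(\vartheta^*\circ c_k^*),$$ and with the differential $\partial_D$ determined by the graded Leibniz rule and $$\partial_D(\varphi)=D(\varphi)+(-1)^{\partial\varphi}\sum_k\varphi_k\,\pi(c_k)\quad(\varphi\in\mathrm{hor}_P),\qquad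 \partial_D(\vartheta)=\varrho_D(\vartheta)+d(\vartheta)\quad(\vartheta\in\Psi_{inv}).$$ **Lemma.** As a differential algebra, $\Omega_P$ is generated by $\mathcal B=\Omega_P^0$. That is, for every preconnection $D$, the map $b\mapsto (b\otimes 1)\otimes1$ is an injective $*$-homomorphism of $\mathcal B$ onto the degree-zero part of $\Omega_P=(\mathrm{hor}_P\otimes\Psi_{inv}^\wedge,\partial_D)$, and the smallest subalgebra of $\Omega_P$ which contains the image of $\mathcal B$ and is stable under $\partial_D$ is $\Omega_P$ itself. -/

import Mathlib

open scoped TensorProduct MatrixGroups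

noncomputable section

namespace FramedBundle

/-- Polynomial functions on a group `G` of complex matrices: the `*`-algebra of functions on `G`
generated by the matrix entries of `g` and of `g⁻¹`. -/
def polyFun {m : ℕ} (G : Subgroup (GL (Fin m) ℂ)) : StarSubalgebra ℂ (G → ℂ) :=
  StarAlgebra.adjoin ℂ {f | ∃ i j : Fin m,
    f = (fun g : G => (g : GL (Fin m) ℂ).val i j) ∨
    f = (fun g : G => ((g⁻¹ : G) : GL (Fin m) ℂ).val i j)}

/-- The commutative `*`-algebra `𝒜` of polynomial functions on `G`. -/
def Pol {m : ℕ} (G : Subgroup (GL (Fin m) ℂ)) : Type := ↥(polyFun G)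

section Hopf

variable {m : ℕ} {G : Subgroup (GL (Fin m) ℂ)}

instance : CommRing (Pol G) :=
  { (inferInstanceAs (Ring ↥(polyFun G)) : Ring (Pol G)) with
    mul_comm := fun a b => Subtype.ext (mul_comm (a.1 : G → ℂ) b.1) }

instance : Algebra ℂ (Pol G) := inferInstanceAs (Algebra ℂ ↥(polyFun G))

instance : StarRing (Pol G) := inferInstanceAs (StarRing ↥(polyFun G))

instance : StarModule ℂ (Pol G) := inferInstanceAs (StarModule ℂ ↥(polyFun G))

/-- Evaluation of a polynomial function at a point of the group. -/
def evalAt (g : G) : Pol G →ₐ[ℂ] ℂ where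
  toFun f := f.1 g
  map_one' := rfl
  map_mul' _ _ := rfl
  map_zero' := rfl
  map_add' _ _ := rfl
  commutes' _ := rfl

theorem evalAt_star (g : G) (a : Pol G) : evalAt g (star a) = star (evalAt g a) := rfl

theorem pol_ext {a b : Pol G} (h : ∀ g, evalAt g a = evalAt g b) : a = b :=
  Subtype.ext (funext h)

/-- `id ⊗ ev_g`. -/
def slice (W : Type*) [AddCommGroup W] [Module ℂ W] (g : G) : W ⊗[ℂ] Pol G →ₗ[ℂ] W :=
  (TensorProduct.rid ℂ W).toLinearMap ∘ₗ LinearMap.lTensor W (evalAt g).toLinearMap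

@[simp] theorem slice_tmul {W : Type*} [AddCommGroup W] [Module ℂ W] (g : G) (w : W) (a : Pol G) :
    slice W g (w ⊗ₜ a) = evalAt g a • w := by simp [slice]

theorem slice_ext {W : Type*} [AddCommGroup W] [Module ℂ W] {s t : W ⊗[ℂ] Pol G}
    (h : ∀ g, slice W g s = slice W g t) : s = t := by
  classical
  let b := Module.Basis.ofVectorSpace ℂ W
  have key : ∀ (x : W ⊗[ℂ] Pol G) (g : G) i,
      evalAt g (TensorProduct.equivFinsuppOfBasisLeft b x i) = b.repr (slice W g x) i := by
    intro x g i
    induction x with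
    | zero => simp
    | tmul w a => simp [mul_comm]
    | add x y hx hy => simp [hx, hy]
  apply (TensorProduct.equivFinsuppOfBasisLeft b).injective
  ext1 i
  apply pol_ext
  intro g
  rw [key, key, h]

/-- `ev_g ⊗ ev_h`. -/
def eval2 (g h : G) : Pol G ⊗[ℂ] Pol G →ₐ[ℂ] ℂ :=
  Algebra.TensorProduct.lift (evalAt g) (evalAt h) (fun _ _ => mul_comm _ _)

@[simp] theorem eval2_tmul (g h : G) (a b : Pol G) :
    eval2 g h (a ⊗ₜ b) = evalAt g a * evalAt h b :=
  Algebra.TensorProduct.lift_tmul _ _ _ _ _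

theorem eval2_eq (g h : G) (t : Pol G ⊗[ℂ] Pol G) :
    eval2 g h t = evalAt g (slice (Pol G) h t) := by
  induction t with
  | zero => simp
  | tmul a b => simp [mul_comm]
  | add x y hx hy => simp [hx, hy]

theorem eval2_ext {s t : Pol G ⊗[ℂ] Pol G} (h : ∀ g k, eval2 g k s = eval2 g k t) : s = t := by
  apply slice_ext
  intro k
  apply pol_ext
  intro g
  rw [← eval2_eq, ← eval2_eq, h]

theorem eval2_star (g h : G) (t : Pol G ⊗[ℂ] Pol G) :
    eval2 g h (star t) = star (eval2 g h t) := by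
  induction t with
  | zero => simp
  | tmul a b => simp [evalAt_star]
  | add x y hx hy => simp [hx, hy]

theorem exists_comul (f : G → ℂ) (hf : f ∈ polyFun G) :
    ∃ t : Pol G ⊗[ℂ] Pol G, ∀ g h, eval2 g h t = f (g * h) := by
  induction hf using StarAlgebra.adjoin_induction with
  | mem f hf =>
    obtain ⟨i, j, rfl | rfl⟩ := hf
    · let c : Fin m → Fin m → Pol G := fun i j =>
        ⟨fun g : G => (g : GL (Fin m) ℂ).val i j,
          StarAlgebra.subset_adjoin ℂ _ ⟨i, j, Or.inl rfl⟩⟩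
      have hc : ∀ i j g, evalAt g (c i j) = (g : GL (Fin m) ℂ).val i j := fun _ _ _ => rfl
      refine ⟨∑ k, c i k ⊗ₜ c k j, fun g h => ?_⟩
      simp [hc, Matrix.mul_apply]
    · let c : Fin m → Fin m → Pol G := fun i j =>
        ⟨fun g : G => ((g⁻¹ : G) : GL (Fin m) ℂ).val i j,
          StarAlgebra.subset_adjoin ℂ _ ⟨i, j, Or.inr rfl⟩⟩
      have hc : ∀ i j g, evalAt g (c i j) = ((g⁻¹ : G) : GL (Fin m) ℂ).val i j :=
        fun _ _ _ => rfl
      refine ⟨∑ k, c k j ⊗ₜ c i k, fun g h => ?_⟩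
      simp only [map_sum, eval2_tmul, hc, mul_inv_rev, Subgroup.coe_mul, Units.val_mul,
        Matrix.mul_apply]
      exact Finset.sum_congr rfl fun _ _ => mul_comm _ _
  | algebraMap r => exact ⟨algebraMap ℂ _ r, fun g h => by simp⟩
  | add f f' _ _ h h' =>
    obtain ⟨t, ht⟩ := h
    obtain ⟨t', ht'⟩ := h'
    exact ⟨t + t', fun g h => by simp [ht, ht']⟩
  | mul f f' _ _ h h' =>
    obtain ⟨t, ht⟩ := h
    obtain ⟨t', ht'⟩ := h'
    exact ⟨t * t', fun g h => by simp [ht, ht']⟩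
  | star f _ h =>
    obtain ⟨t, ht⟩ := h
    exact ⟨star t, fun g h => by simp [eval2_star, ht]⟩

theorem exists_antipode (f : G → ℂ) (hf : f ∈ polyFun G) :
    (fun g => f g⁻¹) ∈ polyFun G := by
  induction hf using StarAlgebra.adjoin_induction with
  | mem f hf =>
    obtain ⟨i, j, rfl | rfl⟩ := hf
    · exact StarAlgebra.subset_adjoin ℂ _ ⟨i, j, Or.inr rfl⟩
    · exact StarAlgebra.subset_adjoin ℂ _ ⟨i, j, Or.inl (by simp)⟩
  | algebraMap r => exact (polyFun G).algebraMap_mem r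
  | add f f' _ _ h h' => exact add_mem h h'
  | mul f f' _ _ h h' => exact mul_mem h h'
  | star f _ h => exact star_mem h

/-- The coproduct `φ`, dual to the multiplication of `G`. -/
def comulHom : Pol G →ₐ[ℂ] Pol G ⊗[ℂ] Pol G :=
  have h : ∀ (a : Pol G) (g k : G),
      eval2 g k (exists_comul a.1 a.2).choose = evalAt (g * k) a :=
    fun a => (exists_comul a.1 a.2).choose_spec
  { toFun := fun a => (exists_comul a.1 a.2).choose
    map_one' := eval2_ext fun g k => by rw [h]; simp
    map_mul' := fun a b => eval2_ext fun g k => by simp only [h, map_mul]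
    map_zero' := eval2_ext fun g k => by rw [h]; simp
    map_add' := fun a b => eval2_ext fun g k => by simp only [h, map_add]
    commutes' := fun r => eval2_ext fun g k => by simp only [h, AlgHom.commutes] }

@[simp] theorem eval2_comulHom (g h : G) (a : Pol G) :
    eval2 g h (comulHom a) = evalAt (g * h) a :=
  (exists_comul a.1 a.2).choose_spec g h

/-- `ev_g ⊗ ev_h ⊗ ev_k`. -/
def eval3 (g h k : G) : Pol G ⊗[ℂ] (Pol G ⊗[ℂ] Pol G) →ₐ[ℂ] ℂ :=
  Algebra.TensorProduct.lift (evalAt g) (eval2 h k) (fun _ _ => mul_comm _ _)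

@[simp] theorem eval3_tmul (g h k : G) (a : Pol G) (t : Pol G ⊗[ℂ] Pol G) :
    eval3 g h k (a ⊗ₜ t) = evalAt g a * eval2 h k t :=
  Algebra.TensorProduct.lift_tmul _ _ _ _ _

theorem eval3_ext {s t : Pol G ⊗[ℂ] (Pol G ⊗[ℂ] Pol G)}
    (h : ∀ g k l, eval3 g k l s = eval3 g k l t) : s = t := by
  have key : ∀ g k l (t : Pol G ⊗[ℂ] (Pol G ⊗[ℂ] Pol G)), eval3 g k l t =
      eval2 g k (slice (Pol G ⊗[ℂ] Pol G) l ((TensorProduct.assoc ℂ _ _ _).symm t)) := by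
    intro g k l t
    induction t with
    | zero => simp
    | add x y hx hy => simp [hx, hy]
    | tmul a t =>
      induction t with
      | zero => simp
      | add x y hx hy => simp only [TensorProduct.tmul_add, map_add, hx, hy]
      | tmul b c => simp; ring
  apply (TensorProduct.assoc ℂ _ _ _).symm.injective
  apply slice_ext; intro l
  apply eval2_ext; intro g k
  rw [← key, ← key, h]

instance : Bialgebra ℂ (Pol G) :=
  Bialgebra.ofAlgHom comulHom (evalAt 1)
    (by
      apply AlgHom.ext; intro a
      apply eval3_ext; intro g h k
      have h1 : ∀ t : Pol G ⊗[ℂ] Pol G, eval3 g h k (Algebra.TensorProduct.assoc ℂ ℂ ℂ _ _ _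
          (Algebra.TensorProduct.map comulHom (AlgHom.id ℂ _) t)) = eval2 (g * h) k t := by
        intro t
        induction t with
        | zero => simp
        | add x y hx hy => simp only [map_add, hx, hy]
        | tmul a b =>
          rw [Algebra.TensorProduct.map_tmul, eval2_tmul, ← eval2_comulHom, AlgHom.id_apply]
          generalize comulHom a = s
          induction s with
          | zero => simp
          | add x y hx hy => simp only [TensorProduct.add_tmul, map_add, hx, hy, add_mul]
          | tmul c d => simp; ring
      have h2 : ∀ t : Pol G ⊗[ℂ] Pol G, eval3 g h k
          (Algebra.TensorProduct.map (AlgHom.id ℂ _) comulHom t) = eval2 g (h * k) t := by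
        intro t
        induction t with
        | zero => simp
        | add x y hx hy => simp only [map_add, hx, hy]
        | tmul a b => simp
      refine (h1 _).trans (Eq.trans ?_ (h2 _).symm)
      exact (eval2_comulHom _ _ a).trans
        ((congrArg (fun x => evalAt x a) (mul_assoc g h k)).trans (eval2_comulHom _ _ a).symm))
    (by
      apply AlgHom.ext; intro a
      apply (Algebra.TensorProduct.lid ℂ (Pol G)).injective
      apply pol_ext; intro g
      have h1 : ∀ t : Pol G ⊗[ℂ] Pol G, evalAt g (Algebra.TensorProduct.lid ℂ (Pol G)
          (Algebra.TensorProduct.map (evalAt 1) (AlgHom.id ℂ _) t)) = eval2 1 g t := by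
        intro t
        induction t with
        | zero => simp
        | add x y hx hy => simp only [map_add, hx, hy]
        | tmul a b => simp
      refine (h1 _).trans ?_
      exact (eval2_comulHom _ _ a).trans ((congrArg (fun x => evalAt x a) (one_mul g)).trans
        (congrArg (evalAt g) ((Algebra.TensorProduct.lid ℂ (Pol G)).apply_symm_apply a).symm)))
    (by
      apply AlgHom.ext; intro a
      apply (Algebra.TensorProduct.rid ℂ ℂ (Pol G)).injective
      apply pol_ext; intro g
      have h1 : ∀ t : Pol G ⊗[ℂ] Pol G, evalAt g (Algebra.TensorProduct.rid ℂ ℂ (Pol G)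
          (Algebra.TensorProduct.map (AlgHom.id ℂ _) (evalAt 1) t)) = eval2 g 1 t := by
        intro t
        induction t with
        | zero => simp
        | add x y hx hy => simp only [map_add, hx, hy]
        | tmul a b => simp [mul_comm]
      refine (h1 _).trans ?_
      exact (eval2_comulHom _ _ a).trans ((congrArg (fun x => evalAt x a) (mul_one g)).trans
        (congrArg (evalAt g) ((Algebra.TensorProduct.rid ℂ ℂ (Pol G)).apply_symm_apply a).symm)))


@[simp] theorem eval2_comul (g h : G) (a : Pol G) :
    eval2 g h (Coalgebra.comul (R := ℂ) a) = evalAt (g * h) a := eval2_comulHom g h a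

theorem counit_eq (a : Pol G) : Coalgebra.counit (R := ℂ) a = evalAt 1 a := rfl

/-- The antipode `κ`, dual to the inversion of `G`. -/
def antipodeHom : Pol G →ₐ[ℂ] Pol G where
  toFun f := ⟨fun g => f.1 g⁻¹, exists_antipode f.1 f.2⟩
  map_one' := rfl
  map_mul' _ _ := rfl
  map_zero' := rfl
  map_add' _ _ := rfl
  commutes' _ := rfl

@[simp] theorem evalAt_antipodeHom (g : G) (a : Pol G) :
    evalAt g (antipodeHom a) = evalAt g⁻¹ a := rfl

instance : HopfAlgebra ℂ (Pol G) where
  antipode := antipodeHom.toLinearMap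
  mul_antipode_rTensor_comul := by
    ext1 a
    apply pol_ext; intro g
    have h1 : ∀ t : Pol G ⊗[ℂ] Pol G, evalAt g (LinearMap.mul' ℂ (Pol G)
        (antipodeHom.toLinearMap.rTensor (Pol G) t)) = eval2 g⁻¹ g t := by
      intro t
      induction t with
      | zero => simp
      | add x y hx hy => simp only [map_add, hx, hy]
      | tmul a b => simp
    simp [h1, counit_eq]
  mul_antipode_lTensor_comul := by
    ext1 a
    apply pol_ext; intro g
    have h1 : ∀ t : Pol G ⊗[ℂ] Pol G, evalAt g (LinearMap.mul' ℂ (Pol G)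
        (antipodeHom.toLinearMap.lTensor (Pol G) t)) = eval2 g g⁻¹ t := by
      intro t
      induction t with
      | zero => simp
      | add x y hx hy => simp only [map_add, hx, hy]
      | tmul a b => simp
    simp [h1, counit_eq]

end Hopf

section Bundle

set_option linter.unusedSectionVars false

variable {m n : ℕ} {G : Subgroup (GL (Fin m) ℂ)} {B : Type*} [Ring B] [Algebra ℂ B] [StarRing B]
  [StarModule ℂ B]

/-- A quantum principal `G`-bundle with total algebra `ℬ`: the dualized right action is a
`*`-homomorphism `F : ℬ → ℬ ⊗ 𝒜` which is a comodule structure, and the action is free, in the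
sense that every `1 ⊗ a` has the form `∑ qₖ F(bₖ)`. -/
structure QuantumPrincipalBundle (G : Subgroup (GL (Fin m) ℂ)) (B : Type*) [Ring B] [Algebra ℂ B]
    [StarRing B] [StarModule ℂ B] where
  F : B →ₐ[ℂ] B ⊗[ℂ] Pol G
  map_star : ∀ b, F (star b) = star (F b)
  coassoc : ∀ b, TensorProduct.assoc ℂ B (Pol G) (Pol G) (F.toLinearMap.rTensor (Pol G) (F b)) =
    (Coalgebra.comul (R := ℂ) (A := Pol G)).lTensor B (F b)
  counit : ∀ b, TensorProduct.rid ℂ B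
    ((Coalgebra.counit (R := ℂ) (A := Pol G)).lTensor B (F b)) = b
  free : ∀ a : Pol G, ∃ (N : ℕ) (q b : Fin N → B), ∑ k, (q k ⊗ₜ[ℂ] (1 : Pol G)) * F (b k) = 1 ⊗ₜ a

/-- The `*`-algebra `𝒱` of the base quantum space, identified with its image in `ℬ`, which is the
fixed point algebra of the action. -/
def QuantumPrincipalBundle.base (P : QuantumPrincipalBundle G B) : StarSubalgebra ℂ B where
  toSubalgebra := AlgHom.equalizer P.F Algebra.TensorProduct.includeLeft
  star_mem' {b} hb := by
    have hb' : P.F b = b ⊗ₜ 1 := hb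
    change P.F (star b) = star b ⊗ₜ 1
    rw [P.map_star, hb', TensorProduct.star_tmul, star_one]

theorem QuantumPrincipalBundle.mem_base (P : QuantumPrincipalBundle G B) {b : B} :
    b ∈ P.base ↔ P.F b = b ⊗ₜ 1 := Iff.rfl

/-- A real unitary representation of `G` in `ℂⁿ` with discrete kernel, given by its matrix elements
`u i j`; it coacts by `u(eᵢ) = ∑ⱼ eⱼ ⊗ u j i`. -/
structure RealUnitaryRep (G : Subgroup (GL (Fin m) ℂ)) (n : ℕ) where
  mat : Matrix (Fin n) (Fin n) (Pol G)
  comul_mat : ∀ i j, Coalgebra.comul (R := ℂ) (mat i j) = ∑ k, mat i k ⊗ₜ[ℂ] mat k j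
  counit_mat : ∀ i j, Coalgebra.counit (R := ℂ) (mat i j) = if i = j then 1 else 0
  real : ∀ i j, star (mat i j) = mat i j
  unitary : mat * mat.conjTranspose = 1
  discrete_ker : DiscreteTopology {g : G // ∀ i j, evalAt g (mat i j) = if i = j then 1 else 0}

/-- A frame structure on `P` relative to `u`. -/
structure FrameStructure (P : QuantumPrincipalBundle G B) (u : RealUnitaryRep G n) where
  d : Fin n → P.base →ₗ[ℂ] B
  leibniz : ∀ i f g, d i (f * g) = d i f * g + f * d i g
  hermitian : ∀ i f, d i (star f) = star (d i f)
  covariant : ∀ i f, P.F (d i f) = ∑ j, d j f ⊗ₜ u.mat j i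
  complete : ∃ (N : ℕ) (b : Fin n → Fin N → B) (v : Fin n → Fin N → P.base),
    ∀ i j, ∑ α, b i α * d j (v i α) = if i = j then 1 else 0

/-- A system `(X₁, …, Xₙ)` of hermitian derivations of `ℬ` extending a frame structure as in the
definition of integrability. -/
structure FrameExtension {P : QuantumPrincipalBundle G B} {u : RealUnitaryRep G n}
    (τ : FrameStructure P u) where
  X : Fin n → B →ₗ[ℂ] B
  leibniz : ∀ i b c, X i (b * c) = X i b * c + b * X i c
  hermitian : ∀ i b, X i (star b) = star (X i b)
  covariant : ∀ j b, P.F (X j b) =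
    ∑ k, TensorProduct.map (X k) (LinearMap.mulRight ℂ (u.mat k j)) (P.F b)
  restrict : ∀ i (f : P.base), X i f = τ.d i f
  integrable : ∀ i j (f : P.base), X i (τ.d j f) - X j (τ.d i f) = 0

/-- An integrable frame structure: a frame structure which has a frame extension. -/
structure IntegrableFrameStructure (P : QuantumPrincipalBundle G B) (u : RealUnitaryRep G n)
    extends FrameStructure P u where
  integrable : Nonempty (FrameExtension toFrameStructure)

/-- The external algebra `ℂₙ^∧`. -/
abbrev Ext (n : ℕ) : Type := ExteriorAlgebra ℂ (Fin n → ℂ)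

/-- The algebra of horizontal forms `hor_P = ℬ ⊗ ℂₙ^∧`. -/
abbrev Hor (B : Type*) [Ring B] [Algebra ℂ B] (n : ℕ) : Type _ := B ⊗[ℂ] Ext n

/-- `θᵢ = 1 ⊗ eᵢ`. -/
def theta (B : Type*) [Ring B] [Algebra ℂ B] (i : Fin n) : Hor B n :=
  1 ⊗ₜ ExteriorAlgebra.ι ℂ (Pi.single i 1)

/-- The degree `p` part of `hor_P`. -/
def horDeg (B : Type*) [Ring B] [Algebra ℂ B] (n p : ℕ) : Submodule ℂ (Hor B n) :=
  LinearMap.range (TensorProduct.map (LinearMap.id : B →ₗ[ℂ] B) (⋀[ℂ]^p (Fin n → ℂ)).subtype)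

/-- The grading automorphism `φ ↦ (-1)^{∂φ} φ` of `hor_P`. -/
def horParity (B : Type*) [Ring B] [Algebra ℂ B] (n : ℕ) : Hor B n →ₐ[ℂ] Hor B n :=
  Algebra.TensorProduct.map (AlgHom.id ℂ B) CliffordAlgebra.involute

theorem horParity_of_mem {p : ℕ} {φ : Hor B n} (h : φ ∈ horDeg B n p) :
    horParity B n φ = (-1 : ℂ) ^ p • φ := by
  obtain ⟨x, rfl⟩ := h
  induction x with
  | zero => simp
  | add x y hx hy => simp only [map_add, hx, hy, smul_add]
  | tmul b ω =>
    obtain ⟨ω, hω⟩ := ω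
    simp only [TensorProduct.map_tmul, horParity, Algebra.TensorProduct.map_tmul, LinearMap.id_coe,
      id_eq, AlgHom.id_apply, Submodule.subtype_apply]
    rw [← TensorProduct.tmul_smul]
    congr 1
    induction hω using Submodule.pow_induction_on_left' with
    | algebraMap r => simp
    | add x y i _ _ hx hy => simp only [map_add, hx, hy, smul_add]
    | mem_mul v hv i x _ hx =>
      obtain ⟨v, rfl⟩ := hv
      rw [map_mul, hx, CliffordAlgebra.involute_ι, pow_succ]
      simp

/-- A complex algebra with the complex conjugate scalar multiplication. -/
def ConjAlg (W : Type*) : Type _ := W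

instance {W : Type*} [Ring W] : Ring (ConjAlg W) := inferInstanceAs (Ring W)

/-- The identity map to the conjugate algebra. -/
def ConjAlg.of (W : Type*) [Ring W] : W ≃+* ConjAlg W := RingEquiv.refl W

instance {W : Type*} [Ring W] [Algebra ℂ W] : Algebra ℂ (ConjAlg W) :=
  RingHom.toAlgebra' (((ConjAlg.of W).toRingHom.comp (algebraMap ℂ W)).comp (starRingEnd ℂ))
    (fun _ x => Algebra.commutes (R := ℂ) (A := W) _ x)

theorem ConjAlg.of_smul {W : Type*} [Ring W] [Algebra ℂ W] (c : ℂ) (x : W) :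
    ConjAlg.of W (star c • x) = c • ConjAlg.of W x := by
  rw [Algebra.smul_def, Algebra.smul_def, map_mul]
  rfl

theorem ConjAlg.of_symm_smul {W : Type*} [Ring W] [Algebra ℂ W] (c : ℂ) (x : ConjAlg W) :
    (ConjAlg.of W).symm (c • x) = star c • (ConjAlg.of W).symm x := by
  rw [RingEquiv.symm_apply_eq, ConjAlg.of_smul, RingEquiv.apply_symm_apply]

/-- The `*`-structure of `ℂₙ^∧` as a linear map to the conjugate algebra. In the graded convention
`(ωη)^* = (-1)^{∂ω∂η} η^* ω^* = ω^* η^*`, so it is multiplicative; it fixes the basis vectors. -/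
def extStarHom (n : ℕ) : Ext n →ₐ[ℂ] ConjAlg (Ext n) :=
  ExteriorAlgebra.lift ℂ
    ⟨{ toFun := fun v => ConjAlg.of _ (ExteriorAlgebra.ι ℂ (star v))
       map_add' := fun v w => by simp only [star_add, map_add]
       map_smul' := fun c v => by
        simp only [star_smul, map_smul, ConjAlg.of_smul, RingHom.id_apply] },
     fun v => by
      change ConjAlg.of (Ext n) _ * ConjAlg.of (Ext n) _ = 0
      rw [← map_mul, ExteriorAlgebra.ι_sq_zero, map_zero]⟩

/-- The `*`-structure of `ℂₙ^∧`. -/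
def extStar (n : ℕ) : Ext n →ₗ⋆[ℂ] Ext n where
  toFun ω := (ConjAlg.of (Ext n)).symm (extStarHom n ω)
  map_add' x y := by simp only [map_add]
  map_smul' c x := by rw [map_smul, ConjAlg.of_symm_smul]; rfl

/-- The `*`-structure of `hor_P`. -/
def horStar (B : Type*) [Ring B] [Algebra ℂ B] [StarRing B] [StarModule ℂ B] (n : ℕ) :
    Hor B n →ₗ⋆[ℂ] Hor B n :=
  TensorProduct.map (starLinearEquiv ℂ : B ≃ₗ⋆[ℂ] B).toLinearMap (extStar n)

theorem slice_mul {W : Type*} [Ring W] [Algebra ℂ W] (g : G) (s t : W ⊗[ℂ] Pol G) :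
    slice W g (s * t) = slice W g s * slice W g t := by
  induction s with
  | zero => simp
  | add x y hx hy => simp only [map_add, add_mul, hx, hy]
  | tmul w a =>
    induction t with
    | zero => simp
    | add x y hx hy => simp only [map_add, mul_add, hx, hy]
    | tmul w' a' =>
      simp only [Algebra.TensorProduct.tmul_mul_tmul, slice_tmul, map_mul]
      rw [smul_mul_smul_comm]

/-- The coaction `u : ℂⁿ → ℂⁿ ⊗ 𝒜`. -/
def RealUnitaryRep.coact (u : RealUnitaryRep G n) : (Fin n → ℂ) →ₗ[ℂ] (Fin n → ℂ) ⊗[ℂ] Pol G :=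
  Fintype.linearCombination ℂ (fun i => ∑ j, (Pi.single j 1 : Fin n → ℂ) ⊗ₜ u.mat j i)

/-- The coaction `u^∧ : ℂₙ^∧ → ℂₙ^∧ ⊗ 𝒜` induced by `u`. -/
def RealUnitaryRep.coactExt (u : RealUnitaryRep G n) : Ext n →ₐ[ℂ] Ext n ⊗[ℂ] Pol G :=
  ExteriorAlgebra.lift ℂ ⟨(ExteriorAlgebra.ι ℂ).rTensor (Pol G) ∘ₗ u.coact, fun v => by
    apply slice_ext
    intro g
    rw [slice_mul, LinearMap.comp_apply]
    have h : ∀ t : (Fin n → ℂ) ⊗[ℂ] Pol G,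
        slice (Ext n) g ((ExteriorAlgebra.ι ℂ).rTensor (Pol G) t) =
          ExteriorAlgebra.ι ℂ (slice _ g t) := by
      intro t
      induction t with
      | zero => simp
      | add x y hx hy => simp only [map_add, hx, hy]
      | tmul w a => simp
    rw [h, ExteriorAlgebra.ι_sq_zero, map_zero]⟩

/-- The action `F^∧ : hor_P → hor_P ⊗ 𝒜`, the product of the actions `F` and `u^∧`:
`F^∧(b ⊗ ω) = ∑ (bₖ ⊗ ωₗ) ⊗ cₖ dₗ`. -/
def coactHor (P : QuantumPrincipalBundle G B) (u : RealUnitaryRep G n) :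
    Hor B n →ₐ[ℂ] Hor B n ⊗[ℂ] Pol G :=
  ((Algebra.TensorProduct.map (AlgHom.id ℂ (Hor B n)) (Algebra.TensorProduct.lmul' ℂ)).comp
    (Algebra.TensorProduct.tensorTensorTensorComm ℂ ℂ ℂ ℂ B (Pol G) (Ext n) (Pol G)).toAlgHom).comp
      (Algebra.TensorProduct.map P.F u.coactExt)

/-- The antiderivation `∇` attached to `(X₁, …, Xₙ)`: `∇(b ω) = ∑ₖ Xₖ(b) θₖ ω`. -/
def FrameExtension.nabla {P : QuantumPrincipalBundle G B} {u : RealUnitaryRep G n}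
    {τ : FrameStructure P u} (X : FrameExtension τ) : Hor B n →ₗ[ℂ] Hor B n :=
  ∑ k, TensorProduct.map (X.X k)
    (LinearMap.mulLeft ℂ (ExteriorAlgebra.ι ℂ (Pi.single k 1 : Fin n → ℂ)))

/-- The algebra `Ω_M` of `F^∧`-invariant horizontal forms. -/
def baseForms (P : QuantumPrincipalBundle G B) (u : RealUnitaryRep G n) :
    Subalgebra ℂ (Hor B n) :=
  AlgHom.equalizer (coactHor P u) Algebra.TensorProduct.includeLeft

theorem mem_baseForms {P : QuantumPrincipalBundle G B} {u : RealUnitaryRep G n} {w : Hor B n} :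
    w ∈ baseForms P u ↔ coactHor P u w = w ⊗ₜ 1 := Iff.rfl

/-- A preconnection: a hermitian first-order antiderivation of `hor_P` which intertwines `F^∧` and
restricts on `Ω_M` to `d_M`, the common restriction of the antiderivations `∇`. -/
structure Preconnection {P : QuantumPrincipalBundle G B} {u : RealUnitaryRep G n}
    (τ : FrameStructure P u) where
  D : Hor B n →ₗ[ℂ] Hor B n
  degree : ∀ p, ∀ φ ∈ horDeg B n p, D φ ∈ horDeg B n (p + 1)
  leibniz : ∀ p, ∀ φ ∈ horDeg B n p, ∀ ψ, D (φ * ψ) = D φ * ψ + (-1 : ℂ) ^ p • (φ * D ψ)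
  hermitian : ∀ φ, D (horStar B n φ) = horStar B n (D φ)
  covariant : ∀ φ, coactHor P u (D φ) = D.rTensor (Pol G) (coactHor P u φ)
  restrict : ∀ X : FrameExtension τ, ∀ w ∈ baseForms P u, D w = X.nabla w

/-- For a linear map `ρ : 𝒜 → hor_P`, the map `∑ φₖ ⊗ cₖ ↦ ∑ φₖ ρ(cₖ)`. -/
def contract (ρ : Pol G →ₗ[ℂ] Hor B n) : Hor B n ⊗[ℂ] Pol G →ₗ[ℂ] Hor B n :=
  LinearMap.mul' ℂ (Hor B n) ∘ₗ ρ.lTensor (Hor B n)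

end Bundle

section Action

set_option linter.unusedSectionVars false

variable {m n : ℕ} {G : Subgroup (GL (Fin m) ℂ)} {B : Type*} [Ring B] [Algebra ℂ B] [StarRing B]
  [StarModule ℂ B]

/-- `id ⊗ ev_g ⊗ ev_h`. -/
def slice2 (W : Type*) [AddCommGroup W] [Module ℂ W] (g h : G) :
    W ⊗[ℂ] (Pol G ⊗[ℂ] Pol G) →ₗ[ℂ] W :=
  (TensorProduct.rid ℂ W).toLinearMap ∘ₗ LinearMap.lTensor W (eval2 g h).toLinearMap

@[simp] theorem slice2_tmul {W : Type*} [AddCommGroup W] [Module ℂ W] (g h : G) (w : W)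
    (t : Pol G ⊗[ℂ] Pol G) : slice2 W g h (w ⊗ₜ t) = eval2 g h t • w := by simp [slice2]

theorem slice2_ext {W : Type*} [AddCommGroup W] [Module ℂ W] {s t : W ⊗[ℂ] (Pol G ⊗[ℂ] Pol G)}
    (h : ∀ g k, slice2 W g k s = slice2 W g k t) : s = t := by
  have key : ∀ g k (t : W ⊗[ℂ] (Pol G ⊗[ℂ] Pol G)), slice2 W g k t =
      slice W g (slice (W ⊗[ℂ] Pol G) k ((TensorProduct.assoc ℂ _ _ _).symm t)) := by
    intro g k t
    induction t with
    | zero => simp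
    | add x y hx hy => simp only [map_add, hx, hy]
    | tmul a t =>
      induction t with
      | zero => simp
      | add x y hx hy => simp only [TensorProduct.tmul_add, map_add, hx, hy]
      | tmul b c => simp [smul_smul, mul_comm]
  apply (TensorProduct.assoc ℂ _ _ _).symm.injective
  apply slice_ext; intro k
  apply slice_ext; intro g
  rw [← key, ← key, h]

theorem slice2_assoc_rTensor {V W : Type*} [AddCommGroup V] [Module ℂ V] [AddCommGroup W]
    [Module ℂ W] (g h : G) (f : V →ₗ[ℂ] W ⊗[ℂ] Pol G) (t : V ⊗[ℂ] Pol G) :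
    slice2 W g h (TensorProduct.assoc ℂ _ _ _ (f.rTensor (Pol G) t)) =
      slice W g (f (slice V h t)) := by
  induction t with
  | zero => simp
  | add x y hx hy => simp only [map_add, hx, hy]
  | tmul v a =>
    rw [LinearMap.rTensor_tmul, slice_tmul, map_smul, map_smul]
    generalize f v = s
    induction s with
    | zero => simp
    | add x y hx hy => simp only [TensorProduct.add_tmul, map_add, hx, hy, smul_add]
    | tmul w b => simp [smul_smul, mul_comm]

theorem slice2_comul {W : Type*} [AddCommGroup W] [Module ℂ W] (g h : G) (t : W ⊗[ℂ] Pol G) :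
    slice2 W g h ((Coalgebra.comul (R := ℂ) (A := Pol G)).lTensor W t) = slice W (g * h) t := by
  induction t with
  | zero => simp
  | add x y hx hy => simp only [map_add, hx, hy]
  | tmul v a => simp

theorem slice_rTensor {V W : Type*} [AddCommGroup V] [Module ℂ V] [AddCommGroup W]
    [Module ℂ W] (g : G) (f : V →ₗ[ℂ] W) (t : V ⊗[ℂ] Pol G) :
    slice W g (f.rTensor (Pol G) t) = f (slice V g t) := by
  induction t with
  | zero => simp
  | add x y hx hy => simp only [map_add, hx, hy]
  | tmul v a => simp

variable (P : QuantumPrincipalBundle G B) (u : RealUnitaryRep G n)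

/-- The action of a group element on `ℬ`. -/
def actB (g : G) : B →ₗ[ℂ] B := slice B g ∘ₗ P.F.toLinearMap

theorem actB_actB (g h : G) (b : B) : actB P g (actB P h b) = actB P (g * h) b := by
  have := congrArg (slice2 B g h) (P.coassoc b)
  rw [slice2_assoc_rTensor, slice2_comul] at this
  exact this

theorem actB_one (b : B) : actB P 1 b = b := P.counit b

/-- The matrix `u(g)`. -/
def RealUnitaryRep.at (g : G) : Matrix (Fin n) (Fin n) ℂ := u.mat.map (evalAt g)

theorem RealUnitaryRep.at_mul (g h : G) : u.at (g * h) = u.at g * u.at h := by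
  ext i j
  have := congrArg (eval2 g h) (u.comul_mat i j)
  rw [eval2_comul, map_sum] at this
  simpa [RealUnitaryRep.at, Matrix.mul_apply] using this

theorem RealUnitaryRep.at_one : u.at (1 : G) = 1 := by
  ext i j
  rw [Matrix.one_apply]
  exact u.counit_mat i j

theorem slice_coact (g : G) (v : Fin n → ℂ) : slice _ g (u.coact v) = (u.at g).mulVec v := by
  ext j
  simp [RealUnitaryRep.coact, Fintype.linearCombination_apply, RealUnitaryRep.at, Matrix.mulVec,
    dotProduct, Pi.single_apply, mul_comm]

/-- The action of a group element on `ℂₙ^∧`. -/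
def actE (g : G) : Ext n →ₗ[ℂ] Ext n := slice (Ext n) g ∘ₗ u.coactExt.toLinearMap

theorem actE_mul (g : G) (x y : Ext n) : actE u g (x * y) = actE u g x * actE u g y := by
  simp [actE, slice_mul]

theorem actE_algebraMap (g : G) (r : ℂ) :
    actE u g (algebraMap ℂ (Ext n) r) = algebraMap ℂ (Ext n) r := by
  simp [actE, Algebra.TensorProduct.algebraMap_apply]

theorem actE_ι (g : G) (v : Fin n → ℂ) :
    actE u g (ExteriorAlgebra.ι ℂ v) = ExteriorAlgebra.ι ℂ ((u.at g).mulVec v) := by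
  rw [← slice_coact, actE, LinearMap.comp_apply, AlgHom.toLinearMap_apply,
    RealUnitaryRep.coactExt, ExteriorAlgebra.lift_ι_apply, LinearMap.comp_apply, slice_rTensor]

theorem actE_actE (g h : G) (x : Ext n) : actE u g (actE u h x) = actE u (g * h) x := by
  induction x using ExteriorAlgebra.induction with
  | algebraMap r => simp only [actE_algebraMap]
  | ι v => simp only [actE_ι, u.at_mul, Matrix.mulVec_mulVec]
  | mul x y hx hy => simp only [actE_mul, hx, hy]
  | add x y hx hy => simp only [map_add, hx, hy]

theorem actE_one (x : Ext n) : actE u (1 : G) x = x := by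
  induction x using ExteriorAlgebra.induction with
  | algebraMap r => simp only [actE_algebraMap]
  | ι v => simp only [actE_ι, u.at_one, Matrix.one_mulVec]
  | mul x y hx hy => simp only [actE_mul, hx, hy]
  | add x y hx hy => simp only [map_add, hx, hy]

/-- The action of a group element on `hor_P`. -/
def act (g : G) : Hor B n →ₗ[ℂ] Hor B n := slice (Hor B n) g ∘ₗ (coactHor P u).toLinearMap

theorem slice_coactHor (g : G) (x : Hor B n) : slice _ g (coactHor P u x) = act P u g x := rfl

theorem act_mul (g : G) (x y : Hor B n) : act P u g (x * y) = act P u g x * act P u g y := by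
  simp only [act, LinearMap.comp_apply, AlgHom.toLinearMap_apply, map_mul, slice_mul]

theorem act_tmul (g : G) (b : B) (ω : Ext n) :
    act P u g (b ⊗ₜ ω) = actB P g b ⊗ₜ actE u g ω := by
  have key : ∀ (s : B ⊗[ℂ] Pol G) (t : Ext n ⊗[ℂ] Pol G), slice (Hor B n) g
      ((Algebra.TensorProduct.map (AlgHom.id ℂ (Hor B n)) (Algebra.TensorProduct.lmul' ℂ))
        (Algebra.TensorProduct.tensorTensorTensorComm ℂ ℂ ℂ ℂ B (Pol G) (Ext n) (Pol G)
          (s ⊗ₜ t))) = slice B g s ⊗ₜ slice (Ext n) g t := by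
    intro s t
    induction s with
    | zero => simp
    | add x y hx hy => simp only [TensorProduct.add_tmul, map_add, hx, hy]
    | tmul b a =>
      induction t with
      | zero => simp
      | add x y hx hy => simp only [TensorProduct.tmul_add, map_add, hx, hy]
      | tmul ω c =>
        simp [TensorProduct.smul_tmul', TensorProduct.tmul_smul, smul_smul, mul_comm]
  exact key _ _

theorem act_act (g h : G) (x : Hor B n) : act P u g (act P u h x) = act P u (g * h) x := by
  induction x using TensorProduct.induction_on with
  | zero => simp
  | add x y hx hy => simp only [map_add, hx, hy]
  | tmul b ω => simp only [act_tmul, actB_actB, actE_actE]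

theorem act_one (x : Hor B n) : act P u (1 : G) x = x := by
  induction x using TensorProduct.induction_on with
  | zero => simp
  | add x y hx hy => simp only [map_add, hx, hy]
  | tmul b ω => simp only [act_tmul, actB_one, actE_one]

theorem coactHor_coassoc (x : Hor B n) :
    TensorProduct.assoc ℂ _ _ _ ((coactHor P u).toLinearMap.rTensor (Pol G) (coactHor P u x)) =
      (Coalgebra.comul (R := ℂ) (A := Pol G)).lTensor _ (coactHor P u x) := by
  apply slice2_ext; intro g h
  rw [slice2_assoc_rTensor, slice2_comul, AlgHom.toLinearMap_apply, slice_coactHor,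
    slice_coactHor, slice_coactHor, act_act]

theorem mem_baseForms_iff {w : Hor B n} : w ∈ baseForms P u ↔ ∀ g, act P u g w = w := by
  rw [mem_baseForms]
  constructor
  · intro h g
    rw [← slice_coactHor, h]; simp
  · intro h
    apply slice_ext; intro g
    rw [slice_coactHor, h]; simp

theorem actB_mul (g : G) (b c : B) : actB P g (b * c) = actB P g b * actB P g c := by
  simp [actB, slice_mul]

theorem mem_base_iff {b : B} : b ∈ P.base ↔ ∀ g, actB P g b = b := by
  rw [P.mem_base]
  constructor
  · intro h g
    rw [actB, LinearMap.comp_apply, AlgHom.toLinearMap_apply, h]; simp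
  · intro h
    apply slice_ext; intro g
    refine (h g).trans ?_
    simp

end Action

section Haar

set_option linter.unusedSectionVars false

variable {m n : ℕ} {G : Subgroup (GL (Fin m) ℂ)} {B : Type*} [Ring B] [Algebra ℂ B] [StarRing B]
  [StarModule ℂ B]

theorem continuous_evalAt (a : Pol G) : Continuous fun g : G => evalAt g a := by
  obtain ⟨f, hf⟩ := a
  change Continuous f
  induction hf using StarAlgebra.adjoin_induction with
  | mem f hf =>
    have h1 : ∀ i j, Continuous fun g : G => (g : GL (Fin m) ℂ).val i j := fun i j =>
      ((Units.continuous_val.comp continuous_subtype_val).matrix_elem i j)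
    obtain ⟨i, j, rfl | rfl⟩ := hf
    · exact h1 i j
    · exact (h1 i j).comp continuous_inv
  | algebraMap r => exact continuous_const
  | add f f' _ _ h h' => exact h.add h'
  | mul f f' _ _ h h' => exact h.mul h'
  | star f _ h => exact continuous_star.comp h

/-- Left translation of polynomial functions. -/
def leftTranslate (g : G) : Pol G →ₗ[ℂ] Pol G :=
  (TensorProduct.lid ℂ (Pol G)).toLinearMap ∘ₗ (evalAt g).toLinearMap.rTensor (Pol G) ∘ₗ
    Coalgebra.comul

theorem evalAt_leftTranslate (g k : G) (a : Pol G) :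
    evalAt k (leftTranslate g a) = evalAt (g * k) a := by
  rw [← eval2_comul, leftTranslate, LinearMap.comp_apply, LinearMap.comp_apply]
  generalize Coalgebra.comul (R := ℂ) a = t
  induction t with
  | zero => simp
  | add x y hx hy => simp only [map_add, hx, hy]
  | tmul a b => simp

theorem exists_haar [CompactSpace G] :
    ∃ h : Pol G →ₗ[ℂ] ℂ, h 1 = 1 ∧ ∀ g a, h (leftTranslate g a) = h a := by
  let _ : MeasurableSpace G := borel G
  have _ : BorelSpace G := ⟨rfl⟩
  let μ : MeasureTheory.Measure G := MeasureTheory.Measure.haarMeasure ⊤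
  have hμ1 : μ Set.univ = 1 := MeasureTheory.Measure.haarMeasure_self
  have hμ : MeasureTheory.IsProbabilityMeasure μ := ⟨hμ1⟩
  have hint : ∀ a : Pol G, MeasureTheory.Integrable (fun g => evalAt g a) μ := fun a =>
    (continuous_evalAt a).integrable_of_hasCompactSupport (HasCompactSupport.of_compactSpace _)
  refine ⟨{ toFun := fun a => ∫ g, evalAt g a ∂μ, map_add' := ?_, map_smul' := ?_ }, ?_, ?_⟩
  · intro a b
    simp only [map_add]
    exact MeasureTheory.integral_add (hint a) (hint b)
  · intro c a
    simp only [map_smul]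
    exact MeasureTheory.integral_smul c _
  · change ∫ g, evalAt g (1 : Pol G) ∂μ = 1
    simp
  · intro g a
    change ∫ k, evalAt k (leftTranslate g a) ∂μ = ∫ k, evalAt k a ∂μ
    simp only [evalAt_leftTranslate]
    exact MeasureTheory.integral_mul_left_eq_self (μ := μ) (fun k => evalAt k a) g

end Haar

section Representability

set_option linter.unusedSectionVars false

variable {m n : ℕ} {G : Subgroup (GL (Fin m) ℂ)} {B : Type*} [Ring B] [Algebra ℂ B] [StarRing B]
  [StarModule ℂ B]

/-- The inclusion `ℬ ⊆ hor_P`. -/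
def inclB (B : Type*) [Ring B] [Algebra ℂ B] (n : ℕ) : B →ₐ[ℂ] Hor B n :=
  Algebra.TensorProduct.includeLeft

theorem inclB_apply (b : B) : inclB B n b = b ⊗ₜ 1 := rfl

/-- `id ⊗ h`. -/
def integ (h : Pol G →ₗ[ℂ] ℂ) (W : Type*) [AddCommGroup W] [Module ℂ W] :
    W ⊗[ℂ] Pol G →ₗ[ℂ] W :=
  (TensorProduct.rid ℂ W).toLinearMap ∘ₗ h.lTensor W

@[simp] theorem integ_tmul (h : Pol G →ₗ[ℂ] ℂ) {W : Type*} [AddCommGroup W] [Module ℂ W]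
    (w : W) (a : Pol G) : integ h W (w ⊗ₜ a) = h a • w := by simp [integ]

theorem integ_mul_right (h : Pol G →ₗ[ℂ] ℂ) {W : Type*} [Ring W] [Algebra ℂ W]
    (y : W ⊗[ℂ] Pol G) (w : W) : integ h W (y * (w ⊗ₜ 1)) = integ h W y * w := by
  induction y with
  | zero => simp
  | add x y hx hy => simp only [map_add, add_mul, hx, hy]
  | tmul v a => simp

theorem integ_mul_left (h : Pol G →ₗ[ℂ] ℂ) {W : Type*} [Ring W] [Algebra ℂ W]
    (y : W ⊗[ℂ] Pol G) (w : W) : integ h W ((w ⊗ₜ 1) * y) = w * integ h W y := by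
  induction y with
  | zero => simp
  | add x y hx hy => simp only [map_add, mul_add, hx, hy]
  | tmul v a => simp

variable (P : QuantumPrincipalBundle G B) (u : RealUnitaryRep G n)

theorem act_inclB (g : G) (b : B) : act P u g (inclB B n b) = inclB B n (actB P g b) := by
  rw [inclB_apply, act_tmul, inclB_apply]
  congr 1
  exact (map_one (algebraMap ℂ (Ext n)) ▸ actE_algebraMap u g 1 :)

theorem act_integ (h : Pol G →ₗ[ℂ] ℂ) (hh : ∀ g a, h (leftTranslate g a) = h a) (g : G)
    (φ : Hor B n) : act P u g (integ h _ (coactHor P u φ)) = integ h _ (coactHor P u φ) := by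
  have h1 : (act P u g).rTensor (Pol G) (coactHor P u φ) =
      (leftTranslate g).lTensor _ (coactHor P u φ) := by
    apply slice_ext; intro k
    rw [slice_rTensor, slice_coactHor, act_act, ← slice_coactHor]
    generalize coactHor P u φ = x
    induction x using TensorProduct.induction_on with
    | zero => simp
    | add x y hx hy => simp only [map_add, hx, hy]
    | tmul v a => simp [evalAt_leftTranslate]
  have h2 : ∀ x : Hor B n ⊗[ℂ] Pol G, integ h _ ((act P u g).rTensor (Pol G) x) =
      act P u g (integ h _ x) := by
    intro x
    induction x using TensorProduct.induction_on with
    | zero => simp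
    | add x y hx hy => simp only [map_add, hx, hy]
    | tmul v a => simp
  have h3 : ∀ x : Hor B n ⊗[ℂ] Pol G, integ h _ ((leftTranslate g).lTensor _ x) =
      integ h _ x := by
    intro x
    induction x using TensorProduct.induction_on with
    | zero => simp
    | add x y hx hy => simp only [map_add, hx, hy]
    | tmul v a => simp [hh]
  rw [← h2, h1, h3]

/-- The canonical map `q ⊗ b ↦ q F(b)`. -/
def canMap : B ⊗[ℂ] B →ₗ[ℂ] B ⊗[ℂ] Pol G :=
  LinearMap.mul' ℂ _ ∘ₗ TensorProduct.map
    (Algebra.TensorProduct.includeLeft : B →ₐ[ℂ] B ⊗[ℂ] Pol G).toLinearMap P.F.toLinearMap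

theorem canMap_tmul (q b : B) : canMap P (q ⊗ₜ b) = (q ⊗ₜ 1) * P.F b := rfl

theorem exists_translation : ∃ t : Pol G →ₗ[ℂ] B ⊗[ℂ] B, ∀ a, canMap P (t a) = 1 ⊗ₜ a := by
  have hs : Function.Surjective (canMap P) := by
    intro x
    induction x using TensorProduct.induction_on with
    | zero => exact ⟨0, map_zero _⟩
    | add x y hx hy =>
      obtain ⟨a, rfl⟩ := hx
      obtain ⟨b, rfl⟩ := hy
      exact ⟨a + b, map_add _ _ _⟩
    | tmul c a =>
      obtain ⟨N, q, b, hqb⟩ := P.free a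
      refine ⟨∑ k, (c * q k) ⊗ₜ b k, ?_⟩
      have : (c ⊗ₜ a : B ⊗[ℂ] Pol G) = (c ⊗ₜ 1) * (1 ⊗ₜ a) := by simp
      rw [this, ← hqb, Finset.mul_sum, map_sum]
      refine Finset.sum_congr rfl fun k _ => ?_
      rw [canMap_tmul, ← mul_assoc, Algebra.TensorProduct.tmul_mul_tmul, one_mul]
  obtain ⟨r, hr⟩ := (canMap P).exists_rightInverse_of_surjective (LinearMap.range_eq_top.2 hs)
  exact ⟨r ∘ₗ TensorProduct.mk ℂ B (Pol G) 1, fun a => LinearMap.congr_fun hr _⟩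

theorem coactHor_comp (s : Hor B n →ₗ[ℂ] Hor B n) (hs : ∀ g x, act P u g (s x) = s (act P u g x))
    (φ : Hor B n) : coactHor P u (s φ) = s.rTensor (Pol G) (coactHor P u φ) := by
  apply slice_ext; intro g
  rw [slice_rTensor, slice_coactHor, slice_coactHor, hs]

/-- Linear maps on `hor_P` which are (graded) linear over `Ω_M` are given by convolution with a
linear map on `𝒜`. -/
theorem exists_contract [CompactSpace G] (s : Hor B n →ₐ[ℂ] Hor B n)
    (hs : ∀ g x, act P u g (s x) = s (act P u g x)) (hsB : ∀ b, s (inclB B n b) = inclB B n b)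
    (Δ : Hor B n →ₗ[ℂ] Hor B n) (hΔ : ∀ w ∈ baseForms P u, ∀ ψ, Δ (w * ψ) = s w * Δ ψ) :
    ∃ χ : Pol G →ₗ[ℂ] Hor B n, ∀ φ, Δ φ = contract χ (coactHor P u (s φ)) := by
  obtain ⟨h, h1, hh⟩ := exists_haar (G := G)
  obtain ⟨t, ht⟩ := exists_translation P
  let ι : B →ₗ[ℂ] Hor B n := (inclB B n).toLinearMap
  let co : Hor B n →ₗ[ℂ] Hor B n ⊗[ℂ] Pol G := (coactHor P u).toLinearMap
  let inl : Hor B n →ₗ[ℂ] Hor B n ⊗[ℂ] Pol G :=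
    (Algebra.TensorProduct.includeLeft : Hor B n →ₐ[ℂ] Hor B n ⊗[ℂ] Pol G).toLinearMap
  let M : B ⊗[ℂ] B →ₗ[ℂ] Hor B n ⊗[ℂ] Pol G :=
    LinearMap.mul' ℂ _ ∘ₗ TensorProduct.map (co ∘ₗ ι) (inl ∘ₗ ι)
  have hM : ∀ g z, slice _ g (M z) = ι (actB P g (slice _ g⁻¹ (canMap P z))) := by
    intro g z
    induction z using TensorProduct.induction_on with
    | zero => simp
    | add x y hx hy => simp only [map_add, hx, hy]
    | tmul p r =>
      change slice _ g (coactHor P u (inclB B n p) * (inclB B n r ⊗ₜ 1)) = _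
      rw [slice_mul, slice_coactHor, act_inclB, slice_tmul, map_one, one_smul, canMap_tmul,
        slice_mul, slice_tmul, map_one, one_smul, actB_mul]
      change _ = inclB B n (actB P g p * actB P g (actB P g⁻¹ r))
      rw [actB_actB, mul_inv_cancel, actB_one, map_mul]
  let Y : Hor B n ⊗[ℂ] Pol G →ₗ[ℂ] Hor B n ⊗[ℂ] Pol G :=
    LinearMap.mul' ℂ _ ∘ₗ TensorProduct.map co (M ∘ₗ t)
  have hY : ∀ g x, slice _ g (Y x) = act P u g (slice _ g⁻¹ x) := by
    intro g x
    induction x using TensorProduct.induction_on with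
    | zero => simp
    | add x y hx hy => simp only [map_add, hx, hy]
    | tmul φ a =>
      change slice _ g (coactHor P u φ * M (t a)) = _
      rw [slice_mul, slice_coactHor, hM, ht, slice_tmul, slice_tmul, map_smul, map_smul, map_smul]
      have : ι (actB P g 1) = 1 := by
        have : actB P g 1 = 1 := (mem_base_iff P).1 (one_mem P.base) g
        rw [this]; exact map_one (inclB B n)
      rw [this]; simp
  have hY' : ∀ φ, Y (coactHor P u φ) = φ ⊗ₜ 1 := by
    intro φ
    apply slice_ext; intro g
    rw [hY, slice_coactHor, act_act, mul_inv_cancel, act_one]; simp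
  let Φ : Pol G →ₗ[ℂ] (B ⊗[ℂ] B →ₗ[ℂ] Hor B n) :=
    { toFun := fun a => LinearMap.mul' ℂ _ ∘ₗ TensorProduct.map
        (integ h _ ∘ₗ LinearMap.mulLeft ℂ ((1 : Hor B n) ⊗ₜ a) ∘ₗ co ∘ₗ ι) (Δ ∘ₗ ι)
      map_add' := fun a a' => by
        ext p r
        simp [TensorProduct.tmul_add, add_mul]
      map_smul' := fun c a => by
        ext p r
        have e : ∀ z : Hor B n ⊗[ℂ] Pol G, (c • ((1 : Hor B n) ⊗ₜ[ℂ] a)) * z =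
            c • (((1 : Hor B n) ⊗ₜ[ℂ] a) * z) := fun z => smul_mul_assoc _ _ _
        simp [e] }
  have hΦ : ∀ a p r, Φ a (p ⊗ₜ r) =
      integ h _ ((1 ⊗ₜ a) * coactHor P u (inclB B n p)) * Δ (inclB B n r) := fun _ _ _ => rfl
  let χ₀ : Pol G ⊗[ℂ] Pol G →ₗ[ℂ] Hor B n := TensorProduct.lift (Φ.compl₂ t)
  have hK : ∀ (y : Hor B n ⊗[ℂ] Pol G) (p r : B),
      (LinearMap.mul' ℂ _ ∘ₗ TensorProduct.map s.toLinearMap (Φ.flip (p ⊗ₜ r))) y =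
      s (integ h _ (y * coactHor P u (inclB B n p))) * Δ (inclB B n r) := by
    intro y p r
    induction y using TensorProduct.induction_on with
    | zero => simp
    | add x y hx hy => simp only [map_add, hx, hy, add_mul]
    | tmul ψ a =>
      have e1 : (ψ ⊗ₜ[ℂ] a : Hor B n ⊗[ℂ] Pol G) = (ψ ⊗ₜ 1) * (1 ⊗ₜ a) := by simp
      have e2 : s (integ h _ ((1 ⊗ₜ[ℂ] a) * coactHor P u (inclB B n p))) =
          integ h _ ((1 ⊗ₜ[ℂ] a) * coactHor P u (inclB B n p)) := by
        have : ∀ x : B ⊗[ℂ] Pol G, ∃ b, integ h _ ((1 ⊗ₜ[ℂ] a) *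
            ((inclB B n).toLinearMap.rTensor (Pol G) x)) = inclB B n b := by
          intro x
          induction x using TensorProduct.induction_on with
          | zero => exact ⟨0, by simp⟩
          | add x y hx hy =>
            obtain ⟨b, hb⟩ := hx
            obtain ⟨c, hc⟩ := hy
            exact ⟨b + c, by rw [map_add, mul_add, map_add, hb, hc, map_add]⟩
          | tmul b c => exact ⟨h (a * c) • b, by simp⟩
        obtain ⟨b, hb⟩ := this (P.F p)
        have e3 : coactHor P u (inclB B n p) =
            (inclB B n).toLinearMap.rTensor (Pol G) (P.F p) := by
          apply slice_ext; intro g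
          rw [slice_coactHor, act_inclB, slice_rTensor]; rfl
        rw [e3, hb, hsB]
      change s ψ * Φ a (p ⊗ₜ r) = _
      rw [hΦ, e1, mul_assoc, integ_mul_left, map_mul s, e2, mul_assoc]
  refine ⟨χ₀ ∘ₗ Coalgebra.comul, fun φ => ?_⟩
  have hQ : ∀ x : Hor B n ⊗[ℂ] Pol G, contract (χ₀ ∘ₗ Coalgebra.comul) (s.toLinearMap.rTensor _ x) =
      (LinearMap.mul' ℂ _ ∘ₗ TensorProduct.map s.toLinearMap χ₀)
        ((Coalgebra.comul (R := ℂ) (A := Pol G)).lTensor _ x) := by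
    intro x
    induction x using TensorProduct.induction_on with
    | zero => simp
    | add x y hx hy => simp only [map_add, hx, hy]
    | tmul ψ a => rfl
  have hQ2 : ∀ x : Hor B n ⊗[ℂ] Pol G, (LinearMap.mul' ℂ _ ∘ₗ TensorProduct.map s.toLinearMap χ₀)
        (TensorProduct.assoc ℂ _ _ _ (co.rTensor (Pol G) x)) = Δ (integ h _ (Y x)) := by
    intro x
    induction x using TensorProduct.induction_on with
    | zero => simp
    | add x y hx hy => simp only [map_add, hx, hy]
    | tmul ψ c =>
      have e1 : ∀ y : Hor B n ⊗[ℂ] Pol G, (LinearMap.mul' ℂ _ ∘ₗ TensorProduct.map s.toLinearMap χ₀)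
          (TensorProduct.assoc ℂ _ _ _ (y ⊗ₜ c)) =
          (LinearMap.mul' ℂ _ ∘ₗ TensorProduct.map s.toLinearMap (Φ.flip (t c))) y := by
        intro y
        induction y using TensorProduct.induction_on with
        | zero => simp
        | add x y hx hy => simp only [map_add, TensorProduct.add_tmul, hx, hy]
        | tmul v a => rfl
      rw [LinearMap.rTensor_tmul, e1]
      change _ = Δ (integ h _ (coactHor P u ψ * M (t c)))
      generalize t c = z
      induction z using TensorProduct.induction_on with
      | zero => simp
      | add x y hx hy =>
        simp only [map_add, mul_add] at *
        rw [← hx, ← hy, TensorProduct.map_add_right]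
        simp [LinearMap.comp_apply]
      | tmul p r =>
        rw [hK]
        change s (integ h _ (coactHor P u ψ * _)) * _ =
          Δ (integ h _ (coactHor P u ψ * (coactHor P u (inclB B n p) * (inclB B n r ⊗ₜ 1))))
        rw [← mul_assoc, integ_mul_right, ← map_mul, hΔ]
        exact (mem_baseForms_iff P u).2 fun g => act_integ P u h hh g _
  rw [show coactHor P u (s φ) = _ from coactHor_comp P u s.toLinearMap hs φ, hQ,
    ← coactHor_coassoc, hQ2, hY', integ_tmul, h1, one_smul]

end Representability

section Curvature

set_option linter.unusedSectionVars false

variable {m n : ℕ} {G : Subgroup (GL (Fin m) ℂ)} {B : Type*} [Ring B] [Algebra ℂ B] [StarRing B]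
  [StarModule ℂ B]

theorem hor_homog_induction {motive : Hor B n → Prop}
    (homog : ∀ p, ∀ φ ∈ horDeg B n p, motive φ)
    (add : ∀ φ ψ, motive φ → motive ψ → motive (φ + ψ)) (φ : Hor B n) : motive φ := by
  induction φ using TensorProduct.induction_on with
  | zero => exact homog 0 0 (zero_mem _)
  | add x y hx hy => exact add _ _ hx hy
  | tmul b ω =>
    induction ω using DirectSum.Decomposition.inductionOn fun i : ℕ => ⋀[ℂ]^i (Fin n → ℂ) with
    | zero => rw [TensorProduct.tmul_zero]; exact homog 0 0 (zero_mem _)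
    | homogeneous x => exact homog _ _ ⟨b ⊗ₜ x, rfl⟩
    | add x y hx hy => rw [TensorProduct.tmul_add]; exact add _ _ hx hy

theorem horParity_horParity (φ : Hor B n) : horParity B n (horParity B n φ) = φ := by
  induction φ using TensorProduct.induction_on with
  | zero => simp
  | add x y hx hy => simp only [map_add, hx, hy]
  | tmul b ω => simp [horParity]

theorem horParity_inclB (b : B) : horParity B n (inclB B n b) = inclB B n b := by
  simp [horParity, inclB]

variable {P : QuantumPrincipalBundle G B} {u : RealUnitaryRep G n}

theorem actE_involute (g : G) (ω : Ext n) :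
    actE u g (CliffordAlgebra.involute ω) = CliffordAlgebra.involute (actE u g ω) := by
  induction ω using ExteriorAlgebra.induction with
  | algebraMap r => simp only [AlgHom.commutes, actE_algebraMap]
  | ι v =>
    rw [actE_ι, CliffordAlgebra.involute_ι, CliffordAlgebra.involute_ι, map_neg, actE_ι]
  | mul x y hx hy => simp only [map_mul, actE_mul, hx, hy]
  | add x y hx hy => simp only [map_add, hx, hy]

theorem act_horParity (g : G) (φ : Hor B n) :
    act P u g (horParity B n φ) = horParity B n (act P u g φ) := by
  induction φ using TensorProduct.induction_on with
  | zero => simp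
  | add x y hx hy => simp only [map_add, hx, hy]
  | tmul b ω =>
    simp only [horParity, Algebra.TensorProduct.map_tmul, act_tmul, AlgHom.id_apply, actE_involute]

theorem coactHor_inclB (b : B) :
    coactHor P u (inclB B n b) = (inclB B n).toLinearMap.rTensor (Pol G) (P.F b) := by
  apply slice_ext; intro g
  rw [slice_coactHor, act_inclB, slice_rTensor]; rfl

section

variable {τ : FrameStructure P u} (D : Preconnection τ)

theorem Preconnection.leibniz' (φ ψ : Hor B n) :
    D.D (φ * ψ) = D.D φ * ψ + horParity B n φ * D.D ψ := by
  induction φ using hor_homog_induction with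
  | homog p φ h => rw [D.leibniz p φ h, horParity_of_mem h, smul_mul_assoc]
  | add x y hx hy => simp only [add_mul, map_add, hx, hy]; abel

theorem Preconnection.parity (φ : Hor B n) :
    D.D (horParity B n φ) = - horParity B n (D.D φ) := by
  induction φ using hor_homog_induction with
  | homog p φ h =>
    rw [horParity_of_mem h, horParity_of_mem (D.degree p φ h), map_smul, pow_succ]
    simp
  | add x y hx hy => simp only [map_add, hx, hy, neg_add]

theorem Preconnection.act (g : G) (φ : Hor B n) :
    act P u g (D.D φ) = D.D (FramedBundle.act P u g φ) := by
  rw [← slice_coactHor, D.covariant, slice_rTensor, slice_coactHor]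

theorem Preconnection.sq_mul (φ ψ : Hor B n) :
    D.D (D.D (φ * ψ)) = D.D (D.D φ) * ψ + φ * D.D (D.D ψ) := by
  rw [D.leibniz', map_add, D.leibniz', D.leibniz', D.parity, horParity_horParity]
  noncomm_ring

theorem Preconnection.mem_baseForms {w : Hor B n} (hw : w ∈ baseForms P u) :
    D.D w ∈ baseForms P u := by
  rw [mem_baseForms_iff] at *
  intro g
  rw [D.act, hw]

theorem inclB_mem {v : B} (hv : v ∈ P.base) : inclB B n v ∈ baseForms P u := by
  rw [mem_baseForms_iff]
  intro g
  rw [act_inclB, (mem_base_iff P).1 hv]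

theorem nabla_tmul (X : FrameExtension τ) (b : B) (ω : Ext n) : X.nabla (b ⊗ₜ ω) =
    ∑ k, X.X k b ⊗ₜ (ExteriorAlgebra.ι ℂ (Pi.single k 1 : Fin n → ℂ) * ω) := by
  simp [FrameExtension.nabla]

theorem Preconnection.D_base (X : FrameExtension τ) (v : P.base) : D.D (inclB B n v) =
    ∑ k, τ.d k v ⊗ₜ ExteriorAlgebra.ι ℂ (Pi.single k 1 : Fin n → ℂ) := by
  rw [D.restrict X _ (inclB_mem v.2), inclB_apply, nabla_tmul]
  simp [X.restrict]

theorem Preconnection.sq_base (X : FrameExtension τ) (v : P.base) :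
    D.D (D.D (inclB B n v)) = 0 := by
  have h := D.D_base X v
  rw [D.restrict X _ (D.mem_baseForms (inclB_mem v.2)), h, map_sum]
  simp only [nabla_tmul]
  have hs : ∀ j k, X.X j (τ.d k v) = X.X k (τ.d j v) := fun j k =>
    sub_eq_zero.1 (X.integrable j k v)
  have ha : ∀ j k : Fin n, ExteriorAlgebra.ι ℂ (Pi.single j 1 : Fin n → ℂ) *
      ExteriorAlgebra.ι ℂ (Pi.single k 1) = - (ExteriorAlgebra.ι ℂ (Pi.single k 1 : Fin n → ℂ) *
      ExteriorAlgebra.ι ℂ (Pi.single j 1)) := fun j k =>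
    eq_neg_of_add_eq_zero_left (ExteriorAlgebra.ι_add_mul_swap _ _)
  have e : ∀ S : Hor B n, S = -S → S = 0 := by
    intro S hS
    have : (2 : ℂ) • S = 0 := by rw [two_smul]; nth_rewrite 2 [hS]; exact add_neg_cancel S
    simpa using this
  apply e
  nth_rewrite 1 [Finset.sum_comm]
  rw [← Finset.sum_neg_distrib]
  refine Finset.sum_congr rfl fun j _ => ?_
  rw [← Finset.sum_neg_distrib]
  refine Finset.sum_congr rfl fun k _ => ?_
  rw [hs j k, ha j k, TensorProduct.tmul_neg]

/-- The base forms on which `D²` vanishes. -/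
def Preconnection.flat : Subalgebra ℂ (Hor B n) where
  carrier := {w | w ∈ baseForms P u ∧ D.D (D.D w) = 0}
  mul_mem' {a b} ha hb := ⟨mul_mem ha.1 hb.1, by rw [D.sq_mul, ha.2, hb.2]; simp⟩
  add_mem' {a b} ha hb := ⟨add_mem ha.1 hb.1, by rw [map_add, map_add, ha.2, hb.2]; simp⟩
  algebraMap_mem' r := ⟨Subalgebra.algebraMap_mem _ r, by
    have h : D.D (D.D 1) = 0 := by
      have := D.sq_mul 1 1
      simpa using this
    rw [Algebra.algebraMap_eq_smul_one, map_smul, map_smul, h, smul_zero]⟩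

theorem theta_eq (b : B) (i : Fin n) :
    theta B i * inclB B n b = b ⊗ₜ ExteriorAlgebra.ι ℂ (Pi.single i 1 : Fin n → ℂ) := by
  simp [theta, inclB]

theorem tmul_theta (b : B) (i : Fin n) :
    inclB B n b * theta B i = b ⊗ₜ ExteriorAlgebra.ι ℂ (Pi.single i 1 : Fin n → ℂ) := by
  simp [theta, inclB]

/-- The special horizontal forms are combinations of differentials of functions on the base. -/
theorem Preconnection.theta_mem (X : FrameExtension τ) : ∀ i, ∃ (N : ℕ) (b : Fin N → B)
    (v : Fin N → P.base), theta B i = ∑ α, inclB B n (b α) * D.D (inclB B n (v α)) := by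
  obtain ⟨N, b, v, h⟩ := τ.complete
  intro i
  refine ⟨N, b i, v i, ?_⟩
  simp only [D.D_base X, Finset.mul_sum]
  rw [Finset.sum_comm]
  have : ∀ j, ∑ α, inclB B n (b i α) * (τ.d j (v i α) ⊗ₜ[ℂ]
      ExteriorAlgebra.ι ℂ (Pi.single j 1 : Fin n → ℂ)) = if i = j then theta B j else 0 := by
    intro j
    have e : ∀ α, inclB B n (b i α) * (τ.d j (v i α) ⊗ₜ[ℂ]
      ExteriorAlgebra.ι ℂ (Pi.single j 1 : Fin n → ℂ)) = (b i α * τ.d j (v i α)) ⊗ₜ[ℂ]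
      ExteriorAlgebra.ι ℂ (Pi.single j 1 : Fin n → ℂ) := by
      intro α; simp [inclB]
    simp only [e]
    rw [← TensorProduct.sum_tmul, h]
    split_ifs
    · rfl
    · simp
  simp [this]

/-- A property of horizontal forms which is stable under left multiplication by functions and by
the `θᵢ`. -/
theorem hor_induction (S : Submodule ℂ (Hor B n)) (h1 : 1 ∈ S)
    (hB : ∀ b, ∀ φ ∈ S, inclB B n b * φ ∈ S) (hθ : ∀ i, ∀ φ ∈ S, theta B i * φ ∈ S)
    (φ : Hor B n) : φ ∈ S := by
  have hω : ∀ ω : Ext n, (1 : B) ⊗ₜ ω ∈ S := by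
    intro ω
    induction ω using CliffordAlgebra.left_induction with
    | algebraMap r =>
      rw [Algebra.algebraMap_eq_smul_one, TensorProduct.tmul_smul]
      exact S.smul_mem _ h1
    | add x y hx hy => rw [TensorProduct.tmul_add]; exact add_mem hx hy
    | ι_mul x v hx =>
      have e : v = ∑ i, v i • (Pi.single i 1 : Fin n → ℂ) := by
        ext j; simp [Finset.sum_apply, Pi.single_apply]
      rw [e, map_sum, Finset.sum_mul, TensorProduct.tmul_sum]
      refine sum_mem fun i _ => ?_
      rw [map_smul, smul_mul_assoc, TensorProduct.tmul_smul]
      refine S.smul_mem _ ?_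
      have := hθ i _ hx
      rw [theta, Algebra.TensorProduct.tmul_mul_tmul, one_mul] at this
      exact this
  induction φ using TensorProduct.induction_on with
  | zero => exact zero_mem _
  | add x y hx hy => exact add_mem hx hy
  | tmul b ω =>
    have := hB b _ (hω ω)
    rwa [inclB_apply, Algebra.TensorProduct.tmul_mul_tmul, one_mul, mul_one] at this

theorem Preconnection.sq_baseForms [CompactSpace G] (X : FrameExtension τ) {w : Hor B n}
    (hw : w ∈ baseForms P u) : D.D (D.D w) = 0 := by
  obtain ⟨h, h1, hh⟩ := exists_haar (G := G)
  let S : Submodule ℂ (Hor B n) := Submodule.span ℂ {x | ∃ b, ∃ w ∈ D.flat, x = inclB B n b * w}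
  have hS : ∀ φ, φ ∈ S := by
    have hB : ∀ b, ∀ φ ∈ S, inclB B n b * φ ∈ S := by
      intro b φ hφ
      induction hφ using Submodule.span_induction with
      | mem x hx =>
        obtain ⟨c, w, hw, rfl⟩ := hx
        exact Submodule.subset_span ⟨b * c, w, hw, by rw [map_mul, mul_assoc]⟩
      | zero => simp
      | add x y _ _ hx hy => rw [mul_add]; exact add_mem hx hy
      | smul c x _ hx => rw [mul_smul_comm]; exact S.smul_mem _ hx
    apply hor_induction
    · exact Submodule.subset_span ⟨1, 1, one_mem _, by simp⟩
    · exact hB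
    · intro i φ hφ
      induction hφ using Submodule.span_induction with
      | mem x hx =>
        obtain ⟨c, w, hw, rfl⟩ := hx
        rw [← mul_assoc, theta_eq, ← tmul_theta, mul_assoc]
        apply hB
        obtain ⟨N, b, v, hi⟩ := D.theta_mem X i
        rw [hi, Finset.sum_mul]
        refine sum_mem fun α _ => ?_
        rw [mul_assoc]
        refine hB _ _ (Submodule.subset_span ⟨1, D.D (inclB B n (v α)) * w, ?_, by simp⟩)
        refine mul_mem ⟨D.mem_baseForms (inclB_mem (v α).2), ?_⟩ hw
        rw [D.sq_base X, map_zero]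
      | zero => simp
      | add x y _ _ hx hy => rw [mul_add]; exact add_mem hx hy
      | smul c x _ hx => rw [mul_smul_comm]; exact S.smul_mem _ hx
  have key : ∀ φ ∈ S, D.D (D.D (integ h _ (coactHor P u φ))) = 0 := by
    intro φ hφ
    induction hφ using Submodule.span_induction with
    | mem x hx =>
      obtain ⟨b, w, hw, rfl⟩ := hx
      rw [map_mul, FramedBundle.mem_baseForms.1 hw.1, integ_mul_right, D.sq_mul, hw.2, mul_zero,
        add_zero]
      have : ∃ c, integ h _ (coactHor P u (inclB B n b)) = inclB B n c ∧ c ∈ P.base := by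
        refine ⟨integ h _ (P.F b), ?_, ?_⟩
        · rw [coactHor_inclB]
          generalize P.F b = y
          induction y with
          | zero => simp
          | add x y hx hy => simp only [map_add, hx, hy]
          | tmul c a => simp
        · rw [mem_base_iff]
          intro g
          have h2 : (actB P g).rTensor (Pol G) (P.F b) = (leftTranslate g).lTensor _ (P.F b) := by
            apply slice_ext; intro k
            rw [slice_rTensor]
            refine (actB_actB P g k b).trans ?_
            rw [actB, LinearMap.comp_apply, AlgHom.toLinearMap_apply]
            generalize P.F b = x
            induction x with
            | zero => simp
            | add x y hx hy => simp only [map_add, hx, hy]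
            | tmul v a => simp [evalAt_leftTranslate]
          have h3 : ∀ x : B ⊗[ℂ] Pol G, integ h _ ((actB P g).rTensor (Pol G) x) =
              actB P g (integ h _ x) := by
            intro x
            induction x with
            | zero => simp
            | add x y hx hy => simp only [map_add, hx, hy]
            | tmul v a => simp
          have h4 : ∀ x : B ⊗[ℂ] Pol G, integ h _ ((leftTranslate g).lTensor _ x) =
              integ h _ x := by
            intro x
            induction x with
            | zero => simp
            | add x y hx hy => simp only [map_add, hx, hy]
            | tmul v a => simp [hh]
          rw [← h3, h2, h4]
      obtain ⟨c, hc, hc'⟩ := this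
      rw [hc, D.sq_base X ⟨c, hc'⟩, zero_mul]
    | zero => simp
    | add x y _ _ hx hy => simp only [map_add, hx, hy, add_zero]
    | smul c x _ hx => simp only [map_smul, hx, smul_zero]
  have := key w (hS w)
  rwa [FramedBundle.mem_baseForms.1 hw, integ_tmul, h1, one_smul] at this

end

variable {τ : IntegrableFrameStructure P u}

theorem exists_curvature [CompactSpace G] (D : Preconnection τ.toFrameStructure) :
    ∃ ρ : Pol G →ₗ[ℂ] Hor B n, ∀ φ, D.D (D.D φ) = - contract ρ (coactHor P u φ) := by
  obtain ⟨X⟩ := τ.integrable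
  obtain ⟨χ, hχ⟩ := exists_contract P u (AlgHom.id ℂ _) (fun _ _ => rfl) (fun _ => rfl)
    (D.D ∘ₗ D.D) (fun w hw ψ => by
      rw [LinearMap.comp_apply, D.sq_mul, D.sq_baseForms X hw, zero_mul, zero_add]; rfl)
  refine ⟨-χ, fun φ => (hχ φ).trans ?_⟩
  simp [contract]

theorem exists_displacement [CompactSpace G] (D D' : Preconnection τ.toFrameStructure) :
    ∃ χ : Pol G →ₗ[ℂ] Hor B n, ∀ p, ∀ φ ∈ horDeg B n p,
      (D'.D - D.D) φ = -(-1 : ℂ) ^ p • contract χ (coactHor P u φ) := by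
  obtain ⟨X⟩ := τ.integrable
  obtain ⟨χ, hχ⟩ := exists_contract P u (horParity B n) (fun _ _ => act_horParity _ _)
    horParity_inclB (D'.D - D.D) (fun w hw ψ => by
      simp only [LinearMap.sub_apply, D.leibniz', D'.leibniz', D.restrict X w hw,
        D'.restrict X w hw, mul_sub, add_sub_add_left_eq_sub])
  refine ⟨-χ, fun p φ hφ => (hχ φ).trans ?_⟩
  rw [horParity_of_mem hφ]
  simp [contract]

/-- The curvature `ϱ_D^⋆ : 𝒜 → hor_P` of a preconnection, characterized by
`D²(φ) = -∑ φₖ ϱ_D^⋆(cₖ)` where `F^∧(φ) = ∑ φₖ ⊗ cₖ`. -/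
def curvature [CompactSpace G] (D : Preconnection τ.toFrameStructure) : Pol G →ₗ[ℂ] Hor B n :=
  (exists_curvature D).choose

/-- The map `χ_E^⋆ : 𝒜 → hor_P` for the element `E = D' - D` of the vector space associated to
the affine space of preconnections, characterized by `E(φ) = -(-1)^{∂φ} ∑ φₖ χ_E^⋆(cₖ)`. -/
def displacement [CompactSpace G] (D D' : Preconnection τ.toFrameStructure) :
    Pol G →ₗ[ℂ] Hor B n :=
  (exists_displacement D D').choose

theorem curvature_spec [CompactSpace G] (D : Preconnection τ.toFrameStructure) (φ : Hor B n) :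
    D.D (D.D φ) = - contract (curvature D) (coactHor P u φ) :=
  (exists_curvature D).choose_spec φ

theorem displacement_spec [CompactSpace G] (D D' : Preconnection τ.toFrameStructure) (p : ℕ)
    (φ : Hor B n) (hφ : φ ∈ horDeg B n p) :
    (D'.D - D.D) φ = -(-1 : ℂ) ^ p • contract (displacement D D') (coactHor P u φ) :=
  (exists_displacement D D').choose_spec p φ hφ

theorem contract_mul_tmul_one (χ : Pol G →ₗ[ℂ] Hor B n) (x : Hor B n ⊗[ℂ] Pol G) (φ : Hor B n) :
    contract χ ((φ ⊗ₜ 1) * x) = φ * contract χ x := by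
  induction x using TensorProduct.induction_on with
  | zero => simp
  | add x y hx hy => simp only [map_add, mul_add, hx, hy]
  | tmul ψ a => simp [contract, mul_assoc]

theorem exists_free (a : Pol G) : ∃ (N : ℕ) (q b : Fin N → B),
    ∑ k, (inclB B n (q k) ⊗ₜ[ℂ] (1 : Pol G)) * coactHor P u (inclB B n (b k)) = 1 ⊗ₜ a := by
  obtain ⟨N, q, b, h⟩ := P.free a
  refine ⟨N, q, b, ?_⟩
  have := congrArg (Algebra.TensorProduct.map (inclB B n) (AlgHom.id ℂ (Pol G))) h
  rw [map_sum, Algebra.TensorProduct.map_tmul, map_one, AlgHom.id_apply] at this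
  rw [← this]
  refine Finset.sum_congr rfl fun k _ => ?_
  rw [map_mul, coactHor_inclB, Algebra.TensorProduct.map_tmul, map_one]
  rfl

theorem contract_ext {χ χ' : Pol G →ₗ[ℂ] Hor B n}
    (h : ∀ b, contract χ (coactHor P u (inclB B n b)) = contract χ' (coactHor P u (inclB B n b))) :
    χ = χ' := by
  ext1 a
  obtain ⟨N, q, b, hqb⟩ := exists_free (P := P) (u := u) a
  have e : ∀ χ : Pol G →ₗ[ℂ] Hor B n, χ a = ∑ k, inclB B n (q k) *
      contract χ (coactHor P u (inclB B n (b k))) := by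
    intro χ
    have : χ a = contract χ (1 ⊗ₜ a) := by simp [contract]
    rw [this, ← hqb, map_sum]
    exact Finset.sum_congr rfl fun k _ => contract_mul_tmul_one _ _ _
  rw [e χ, e χ']
  exact Finset.sum_congr rfl fun k _ => by rw [h]

/-- If `∑ φₖ χ(cₖ)` defines a derivation on `ℬ`, then `χ` is compatible with products. -/
theorem contract_mul (χ : Pol G →ₗ[ℂ] Hor B n) (φ : Hor B n)
    (h : ∀ b, contract χ (coactHor P u (inclB B n b) * coactHor P u φ) =
      contract χ (coactHor P u (inclB B n b)) * φ +
        inclB B n b * contract χ (coactHor P u φ)) (a : Pol G) :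
    contract χ ((1 ⊗ₜ a) * coactHor P u φ) =
      χ a * φ + Coalgebra.counit (R := ℂ) a • contract χ (coactHor P u φ) := by
  obtain ⟨N, q, b, hqb⟩ := exists_free (P := P) (u := u) a
  have e : χ a = ∑ k, inclB B n (q k) * contract χ (coactHor P u (inclB B n (b k))) := by
    have : χ a = contract χ (1 ⊗ₜ a) := by simp [contract]
    rw [this, ← hqb, map_sum]
    exact Finset.sum_congr rfl fun k _ => contract_mul_tmul_one _ _ _
  have e2 : ∑ k, inclB B n (q k) * inclB B n (b k) =
      Coalgebra.counit (R := ℂ) a • (1 : Hor B n) := by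
    have := congrArg (slice _ 1) hqb
    rw [map_sum, slice_tmul] at this
    rw [counit_eq, ← this]
    refine Finset.sum_congr rfl fun k _ => ?_
    rw [slice_mul, slice_coactHor, act_one, slice_tmul, map_one, one_smul]
  rw [← hqb, Finset.sum_mul, map_sum, e, Finset.sum_mul]
  have : Coalgebra.counit (R := ℂ) a • contract χ (coactHor P u φ) =
      (Coalgebra.counit (R := ℂ) a • (1 : Hor B n)) * contract χ (coactHor P u φ) := by simp
  rw [this, ← e2, Finset.sum_mul, ← Finset.sum_add_distrib]
  refine Finset.sum_congr rfl fun k _ => ?_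
  rw [mul_assoc, contract_mul_tmul_one, h, mul_add, mul_assoc, mul_assoc]

theorem mul_eq_zero_of (χ : Pol G →ₗ[ℂ] Hor B n)
    (h : ∀ b c, contract χ (coactHor P u (inclB B n b) * coactHor P u (inclB B n c)) =
      contract χ (coactHor P u (inclB B n b)) * inclB B n c +
        inclB B n b * contract χ (coactHor P u (inclB B n c)))
    {a : Pol G} (ha : Coalgebra.counit (R := ℂ) a = 0) (hχ : χ a = 0) (c : Pol G) :
    χ (c * a) = 0 := by
  have h1 := fun b => contract_mul χ (inclB B n b) (fun d => h d b) a
  simp only [ha, hχ, zero_mul, zero_smul, add_zero] at h1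
  obtain ⟨N, q, b, hqb⟩ := exists_free (P := P) (u := u) c
  have : χ (c * a) = contract χ ((1 ⊗ₜ a) * (1 ⊗ₜ c)) := by simp [contract, mul_comm]
  rw [this, ← hqb, Finset.mul_sum, map_sum]
  refine Finset.sum_eq_zero fun k _ => ?_
  have e : ((1 : Hor B n) ⊗ₜ[ℂ] a) * (inclB B n (q k) ⊗ₜ 1) = (inclB B n (q k) ⊗ₜ 1) * (1 ⊗ₜ a) := by
    simp
  rw [← mul_assoc, e, mul_assoc, contract_mul_tmul_one, h1, mul_zero]

theorem curvature_deriv [CompactSpace G] (D : Preconnection τ.toFrameStructure) (φ ψ : Hor B n) :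
    contract (curvature D) (coactHor P u φ * coactHor P u ψ) =
      contract (curvature D) (coactHor P u φ) * ψ +
        φ * contract (curvature D) (coactHor P u ψ) := by
  have h := D.sq_mul φ ψ
  simp only [curvature_spec, map_mul] at h
  rw [neg_mul, mul_neg, ← neg_add, neg_inj] at h
  exact h

theorem inclB_mem_horDeg (b : B) : inclB B n b ∈ horDeg B n 0 :=
  ⟨b ⊗ₜ ⟨1, by simp⟩, rfl⟩

theorem displacement_deriv [CompactSpace G] (D D' : Preconnection τ.toFrameStructure) (b c : B) :
    contract (displacement D D') (coactHor P u (inclB B n b) * coactHor P u (inclB B n c)) =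
      contract (displacement D D') (coactHor P u (inclB B n b)) * inclB B n c +
        inclB B n b * contract (displacement D D') (coactHor P u (inclB B n c)) := by
  have e : ∀ b, contract (displacement D D') (coactHor P u (inclB B n b)) =
      D.D (inclB B n b) - D'.D (inclB B n b) := by
    intro b
    have := displacement_spec D D' 0 _ (inclB_mem_horDeg b)
    rw [pow_zero, neg_smul, one_smul, LinearMap.sub_apply, eq_comm, neg_eq_iff_eq_neg,
      neg_sub] at this
    exact this
  rw [← map_mul, ← map_mul, e, e, e, map_mul, D.leibniz', D'.leibniz', horParity_inclB]
  noncomm_ring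

/-- The right ideal `ℛ ⊆ ker ε` of elements annihilated by all `ϱ_D^⋆` and `χ_E^⋆`. -/
def idealR [CompactSpace G] (τ : IntegrableFrameStructure P u) : Ideal (Pol G) where
  carrier := {a | Coalgebra.counit (R := ℂ) a = 0 ∧
    (∀ D : Preconnection τ.toFrameStructure, curvature D a = 0) ∧
    ∀ D D' : Preconnection τ.toFrameStructure, displacement D D' a = 0}
  zero_mem' := by simp
  add_mem' {a b} ha hb := by
    refine ⟨by rw [map_add, ha.1, hb.1, add_zero], fun D => ?_, fun D D' => ?_⟩
    · rw [map_add, ha.2.1, hb.2.1, add_zero]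
    · rw [map_add, ha.2.2, hb.2.2, add_zero]
  smul_mem' c a ha := by
    refine ⟨?_, fun D => ?_, fun D D' => ?_⟩
    · rw [smul_eq_mul, Bialgebra.counit_mul, ha.1, mul_zero]
    · exact mul_eq_zero_of _ (fun b c => curvature_deriv D _ _) ha.1 (ha.2.1 D) c
    · exact mul_eq_zero_of _ (fun b c => displacement_deriv D D' _ _) ha.1 (ha.2.2 D D') c

end Curvature

section Calculus

set_option linter.unusedSectionVars false

variable {m n : ℕ} {G : Subgroup (GL (Fin m) ℂ)} [CompactSpace G] {B : Type*} [Ring B]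
  [Algebra ℂ B] [StarRing B] [StarModule ℂ B] {P : QuantumPrincipalBundle G B}
  {u : RealUnitaryRep G n}

/-- The ideal `ker ε`. -/
abbrev kerCounit (G : Subgroup (GL (Fin m) ℂ)) : Ideal (Pol G) :=
  RingHom.ker (Bialgebra.counitAlgHom ℂ (Pol G))

/-- The ideal `ℛ` as a submodule of `ker ε`. -/
abbrev relKer (τ : IntegrableFrameStructure P u) : Submodule (Pol G) ↥(kerCounit G) :=
  Submodule.comap (Submodule.subtype (kerCounit G)) (idealR τ)

/-- The space `Ψ_inv = ker ε / ℛ` of left-invariant elements of the first-order calculus `Ψ`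
on `G` which is based on the ideal `ℛ`. The canonical right `𝒜`-module structure is
`ϑ ∘ a = a • ϑ` (the algebra `𝒜` is commutative). -/
def PsiInv (τ : IntegrableFrameStructure P u) : Type :=
  ↥(kerCounit G) ⧸ relKer τ

variable (τ : IntegrableFrameStructure P u)

instance : AddCommGroup (PsiInv τ) :=
  inferInstanceAs (AddCommGroup (↥(kerCounit G) ⧸ relKer τ))

instance : Module (Pol G) (PsiInv τ) :=
  inferInstanceAs (Module (Pol G) (↥(kerCounit G) ⧸ relKer τ))

instance : Module ℂ (PsiInv τ) :=
  inferInstanceAs (Module ℂ (↥(kerCounit G) ⧸ relKer τ))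

instance : IsScalarTower ℂ (Pol G) (PsiInv τ) :=
  inferInstanceAs (IsScalarTower ℂ (Pol G)
    (↥(kerCounit G) ⧸ relKer τ))

/-- The quotient map `ker ε → Ψ_inv`. -/
def PsiInv.mk : ↥(kerCounit G) →ₗ[Pol G] PsiInv τ :=
  (relKer τ).mkQ

/-- The projection `a ↦ a - ε(a) 1` onto `ker ε`. -/
def toKer (G : Subgroup (GL (Fin m) ℂ)) : Pol G →ₗ[ℂ] ↥(kerCounit G) where
  toFun a := ⟨a - algebraMap ℂ (Pol G) (Coalgebra.counit a), by simp [RingHom.mem_ker]⟩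
  map_add' a b := by ext1; simp; abel
  map_smul' c a := by ext1; simp [Algebra.smul_def, mul_sub]

/-- The canonical projection `π : 𝒜 → Ψ_inv`. -/
def PsiInv.π : Pol G →ₗ[ℂ] PsiInv τ := (PsiInv.mk τ).restrictScalars ℂ ∘ₗ toKer G

theorem PsiInv.mk_surjective : Function.Surjective (PsiInv.mk τ) := Submodule.mkQ_surjective _

theorem PsiInv.mk_eq_zero {a : ↥(kerCounit G)} (h : (a : Pol G) ∈ idealR τ) :
    PsiInv.mk τ a = 0 := (Submodule.Quotient.mk_eq_zero (relKer τ)).2 h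

theorem PsiInv.π_of_mem (a : ↥(kerCounit G)) : PsiInv.π τ a = PsiInv.mk τ a := by
  have h : Coalgebra.counit (R := ℂ) (a : Pol G) = 0 := a.2
  refine congrArg (PsiInv.mk τ) (Subtype.ext ?_)
  change (a : Pol G) - algebraMap ℂ (Pol G) (Coalgebra.counit (a : Pol G)) = a
  rw [h, map_zero, sub_zero]

theorem PsiInv.π_one : PsiInv.π τ 1 = 0 :=
  PsiInv.mk_eq_zero τ (by simp [toKer])

theorem PsiInv.π_eq_zero {r : Pol G} (h : r ∈ idealR τ) : PsiInv.π τ r = 0 :=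
  (PsiInv.π_of_mem τ ⟨r, h.1⟩).trans (PsiInv.mk_eq_zero τ h)

theorem PsiInv.smul_π (c a : Pol G) : c • PsiInv.π τ a =
    PsiInv.π τ (a * c) - Coalgebra.counit (R := ℂ) a • PsiInv.π τ c := by
  change c • PsiInv.mk τ (toKer G a) = PsiInv.mk τ _ - _ • PsiInv.mk τ _
  have h1 : ∀ (r : ℂ) (x : ↥(kerCounit G)), r • PsiInv.mk τ x = PsiInv.mk τ (r • x) :=
    fun r x => (((PsiInv.mk τ).restrictScalars ℂ).map_smul r x).symm
  rw [← map_smul, h1, ← map_sub]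
  congr 1
  ext1
  simp [toKer, Algebra.smul_def]
  ring

theorem PsiInv.π_surjective : Function.Surjective (PsiInv.π τ) := fun x => by
  obtain ⟨a, rfl⟩ := PsiInv.mk_surjective τ x
  exact ⟨a, PsiInv.π_of_mem τ a⟩

variable {τ} in
/-- Linear maps on `𝒜` which vanish on `ℛ` factor through `Ψ_inv`. -/
def PsiInv.lift {W : Type*} [AddCommGroup W] [Module ℂ W] (f : Pol G →ₗ[ℂ] W)
    (hf : ∀ r ∈ idealR τ, f r = 0) : PsiInv τ →ₗ[ℂ] W :=
  ((relKer τ).restrictScalars ℂ).liftQ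
      (f ∘ₗ (Submodule.subtype (kerCounit G)).restrictScalars ℂ) (fun _ ha => hf _ ha) ∘ₗ
    (Submodule.Quotient.restrictScalarsEquiv ℂ (relKer τ)).symm.toLinearMap

theorem PsiInv.lift_mk {W : Type*} [AddCommGroup W] [Module ℂ W] (f : Pol G →ₗ[ℂ] W)
    (hf : ∀ r ∈ idealR τ, f r = 0) (a : ↥(kerCounit G)) :
    PsiInv.lift f hf (PsiInv.mk τ a) = f a := rfl

theorem PsiInv.lift_π {W : Type*} [AddCommGroup W] [Module ℂ W] (f : Pol G →ₗ[ℂ] W)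
    (hf : ∀ r ∈ idealR τ, f r = 0) (h1 : f 1 = 0) (a : Pol G) :
    PsiInv.lift f hf (PsiInv.π τ a) = f a := by
  refine (PsiInv.lift_mk τ f hf _).trans ?_
  simp [toKer, Algebra.algebraMap_eq_smul_one, h1]

/-- For a linear map `f : 𝒜 → W` into an algebra, the map `a ↦ ∑ f(a⁽¹⁾) f(a⁽²⁾)`. -/
def convSq {W : Type*} [Ring W] [Algebra ℂ W] (f : Pol G →ₗ[ℂ] W) : Pol G →ₗ[ℂ] W :=
  LinearMap.mul' ℂ W ∘ₗ TensorProduct.map f f ∘ₗ Coalgebra.comul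

/-- The relations `∑ π(r⁽¹⁾) ⊗ π(r⁽²⁾) = 0`, for `r ∈ ℛ`, of the left-invariant part of the
universal differential envelope of `Ψ`. -/
inductive PsiRel : TensorAlgebra ℂ (PsiInv τ) → TensorAlgebra ℂ (PsiInv τ) → Prop
  | mk (r : Pol G) (hr : r ∈ idealR τ) :
    PsiRel (convSq (TensorAlgebra.ι ℂ ∘ₗ PsiInv.π τ) r) 0

/-- The algebra `Ψ_inv^∧` of left-invariant elements of the universal differential envelope `Ψ^∧`
of the first-order calculus `Ψ`: the quotient of the tensor algebra of `Ψ_inv` by the ideal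
generated by the elements `∑ π(r⁽¹⁾) ⊗ π(r⁽²⁾)` with `r ∈ ℛ`. -/
def PsiExt : Type := RingQuot (PsiRel τ)

instance : Ring (PsiExt τ) := inferInstanceAs (Ring (RingQuot (PsiRel τ)))

instance : Algebra ℂ (PsiExt τ) := inferInstanceAs (Algebra ℂ (RingQuot (PsiRel τ)))

/-- The inclusion `Ψ_inv → Ψ_inv^∧`. -/
def PsiExt.ι : PsiInv τ →ₗ[ℂ] PsiExt τ :=
  (RingQuot.mkAlgHom ℂ (PsiRel τ)).toLinearMap ∘ₗ TensorAlgebra.ι ℂ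

theorem convSq_comp {W W' : Type*} [Ring W] [Algebra ℂ W] [Ring W'] [Algebra ℂ W']
    (g : W →ₐ[ℂ] W') (f : Pol G →ₗ[ℂ] W) (a : Pol G) :
    convSq (g.toLinearMap ∘ₗ f) a = g (convSq f a) := by
  simp only [convSq, LinearMap.comp_apply]
  generalize Coalgebra.comul (R := ℂ) a = z
  induction z with
  | zero => simp
  | add x y hx hy => simp only [map_add, hx, hy]
  | tmul x y => simp

theorem PsiExt.rel {r : Pol G} (hr : r ∈ idealR τ) :
    convSq (PsiExt.ι τ ∘ₗ PsiInv.π τ) r = 0 := by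
  have h := RingQuot.mkAlgHom_rel ℂ (PsiRel.mk r hr)
  rw [map_zero] at h
  rw [← convSq_comp] at h
  exact h

variable {τ} in
/-- The universal property of `Ψ_inv^∧`. -/
def PsiExt.lift {W : Type*} [Ring W] [Algebra ℂ W] (f : PsiInv τ →ₗ[ℂ] W)
    (hf : ∀ r ∈ idealR τ, convSq (f ∘ₗ PsiInv.π τ) r = 0) : PsiExt τ →ₐ[ℂ] W :=
  RingQuot.liftAlgHom ℂ ⟨TensorAlgebra.lift ℂ f, by
    rintro _ _ ⟨r, hr⟩
    rw [map_zero, ← hf r hr, ← convSq_comp]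
    congr 2
    ext a
    exact TensorAlgebra.lift_ι_apply f _⟩

theorem PsiExt.lift_ι {W : Type*} [Ring W] [Algebra ℂ W] (f : PsiInv τ →ₗ[ℂ] W)
    (hf : ∀ r ∈ idealR τ, convSq (f ∘ₗ PsiInv.π τ) r = 0) (ϑ : PsiInv τ) :
    PsiExt.lift f hf (PsiExt.ι τ ϑ) = f ϑ := by
  have := RingQuot.liftAlgHom_mkAlgHom_apply ℂ (TensorAlgebra.lift ℂ f) (s := PsiRel τ) (by
    rintro _ _ ⟨r, hr⟩
    rw [map_zero, ← hf r hr, ← convSq_comp]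
    congr 2
    ext a
    exact TensorAlgebra.lift_ι_apply f _) (TensorAlgebra.ι ℂ ϑ)
  exact this.trans (TensorAlgebra.lift_ι_apply f ϑ)

theorem PsiExt.induction {motive : PsiExt τ → Prop}
    (algebraMap : ∀ r, motive (algebraMap ℂ (PsiExt τ) r))
    (ι : ∀ ϑ, motive (PsiExt.ι τ ϑ))
    (mul : ∀ x y, motive x → motive y → motive (x * y))
    (add : ∀ x y, motive x → motive y → motive (x + y)) (x : PsiExt τ) : motive x := by
  obtain ⟨y, rfl⟩ := RingQuot.mkAlgHom_surjective ℂ (PsiRel τ) x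
  induction y using TensorAlgebra.induction with
  | algebraMap r => rw [AlgHom.commutes]; exact algebraMap r
  | ι v => exact ι v
  | mul x y hx hy => rw [map_mul]; exact mul _ _ hx hy
  | add x y hx hy => rw [map_add]; exact add _ _ hx hy

/-- The map `a ⊗ c ↦ π(a) ∘ c`. -/
def actPi : Pol G ⊗[ℂ] Pol G →ₗ[ℂ] PsiExt τ :=
  PsiExt.ι τ ∘ₗ TensorProduct.lift
    (LinearMap.mk₂ ℂ (fun a c => c • PsiInv.π τ a)
      (fun a a' c => by rw [map_add, smul_add])
      (fun r a c => by rw [map_smul, smul_comm])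
      (fun a c c' => add_smul _ _ _)
      (fun r a c => smul_assoc _ _ _))

theorem actPi_tmul (a c : Pol G) : actPi τ (a ⊗ₜ c) = PsiExt.ι τ (c • PsiInv.π τ a) := rfl

/-- The map `(a ⊗ a') ⊗ (c ⊗ c') ↦ (π(a) ∘ c) (π(a') ∘ c')`. -/
def actPi2 : (Pol G ⊗[ℂ] Pol G) ⊗[ℂ] (Pol G ⊗[ℂ] Pol G) →ₗ[ℂ] PsiExt τ :=
  LinearMap.mul' ℂ _ ∘ₗ TensorProduct.map (actPi τ) (actPi τ) ∘ₗ
    (TensorProduct.tensorTensorTensorComm ℂ _ _ _ _).toLinearMap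

theorem actPi2_tmul (a a' c c' : Pol G) : actPi2 τ ((a ⊗ₜ a') ⊗ₜ (c ⊗ₜ c')) =
    PsiExt.ι τ (c • PsiInv.π τ a) * PsiExt.ι τ (c' • PsiInv.π τ a') := rfl

/-- The map `a ⊗ a' ↦ π(a) π(a')`. -/
def pi2 : Pol G ⊗[ℂ] Pol G →ₗ[ℂ] PsiExt τ :=
  LinearMap.mul' ℂ _ ∘ₗ TensorProduct.map (PsiExt.ι τ ∘ₗ PsiInv.π τ) (PsiExt.ι τ ∘ₗ PsiInv.π τ)

theorem pi2_tmul (a a' : Pol G) : pi2 τ (a ⊗ₜ a') =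
    PsiExt.ι τ (PsiInv.π τ a) * PsiExt.ι τ (PsiInv.π τ a') := rfl

theorem pi2_comul (a : Pol G) :
    pi2 τ (Coalgebra.comul (R := ℂ) a) = convSq (PsiExt.ι τ ∘ₗ PsiInv.π τ) a := rfl

theorem actPi2_eq (z w : Pol G ⊗[ℂ] Pol G) : actPi2 τ (z ⊗ₜ w) = pi2 τ (z * w) -
    pi2 τ ((1 ⊗ₜ slice _ 1 (TensorProduct.comm ℂ _ _ z)) * w) -
    pi2 τ ((slice _ 1 z ⊗ₜ 1) * w) + eval2 1 1 z • pi2 τ w := by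
  induction z with
  | zero => simp
  | add x y hx hy =>
    simp only [TensorProduct.add_tmul, TensorProduct.tmul_add, map_add, add_mul, hx, hy, add_smul]
    abel
  | tmul a a' =>
    induction w with
    | zero => simp
    | add x y hx hy =>
      simp only [TensorProduct.tmul_add, map_add, mul_add, hx, hy, smul_add]
      abel
    | tmul c c' =>
      simp only [actPi2_tmul, PsiInv.smul_π, TensorProduct.comm_tmul, slice_tmul, eval2_tmul,
        Algebra.TensorProduct.tmul_mul_tmul, pi2_tmul, one_mul, smul_mul_assoc, map_sub,
        map_smul, counit_eq, sub_mul, mul_sub, mul_smul_comm]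
      module

theorem slice_one_comul (a : Pol G) : slice _ 1 (Coalgebra.comul (R := ℂ) a) = a := by
  apply pol_ext; intro g
  rw [← eval2_eq, eval2_comul, mul_one]

theorem slice_one_comm_comul (a : Pol G) :
    slice _ 1 (TensorProduct.comm ℂ _ _ (Coalgebra.comul (R := ℂ) a)) = a := by
  apply pol_ext; intro g
  have : ∀ z : Pol G ⊗[ℂ] Pol G, evalAt g (slice _ 1 (TensorProduct.comm ℂ _ _ z)) =
      eval2 1 g z := by
    intro z
    induction z with
    | zero => simp
    | add x y hx hy => simp only [map_add, hx, hy]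
    | tmul x y => simp
  rw [this, eval2_comul, one_mul]

theorem actPi2_comul (a c : Pol G) :
    actPi2 τ (Coalgebra.comul (R := ℂ) a ⊗ₜ Coalgebra.comul (R := ℂ) c) =
      pi2 τ (Coalgebra.comul (R := ℂ) (a * c)) -
        pi2 τ ((1 ⊗ₜ a) * Coalgebra.comul (R := ℂ) c) -
        pi2 τ ((a ⊗ₜ 1) * Coalgebra.comul (R := ℂ) c) +
        Coalgebra.counit (R := ℂ) a • pi2 τ (Coalgebra.comul (R := ℂ) c) := by
  rw [actPi2_eq, slice_one_comul, slice_one_comm_comul, eval2_comul, mul_one, Bialgebra.comul_mul]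
  rfl

theorem actPi2_rel {r : Pol G} (hr : r ∈ idealR τ) (c : Pol G) :
    actPi2 τ (Coalgebra.comul (R := ℂ) r ⊗ₜ Coalgebra.comul (R := ℂ) c) = 0 := by
  have h1 : ∀ z : Pol G ⊗[ℂ] Pol G, pi2 τ ((1 ⊗ₜ r) * z) = 0 := by
    intro z
    induction z with
    | zero => simp
    | add x y hx hy => rw [mul_add, map_add, hx, hy, add_zero]
    | tmul x y =>
      rw [Algebra.TensorProduct.tmul_mul_tmul, pi2_tmul,
        PsiInv.π_eq_zero τ ((idealR τ).mul_mem_right y hr), map_zero, mul_zero]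
  have h2 : ∀ z : Pol G ⊗[ℂ] Pol G, pi2 τ ((r ⊗ₜ 1) * z) = 0 := by
    intro z
    induction z with
    | zero => simp
    | add x y hx hy => rw [mul_add, map_add, hx, hy, add_zero]
    | tmul x y =>
      rw [Algebra.TensorProduct.tmul_mul_tmul, pi2_tmul,
        PsiInv.π_eq_zero τ ((idealR τ).mul_mem_right x hr), map_zero, zero_mul]
  have h3 : Coalgebra.counit (R := ℂ) r = 0 := hr.1
  rw [actPi2_comul, h1, h2, h3, zero_smul, pi2_comul,
    PsiExt.rel τ ((idealR τ).mul_mem_right c hr)]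
  simp

end Calculus

section Product

set_option linter.unusedSectionVars false

variable {m n : ℕ} {G : Subgroup (GL (Fin m) ℂ)} [CompactSpace G] {B : Type*} [Ring B]
  [Algebra ℂ B] [StarRing B] [StarModule ℂ B] {P : QuantumPrincipalBundle G B}
  {u : RealUnitaryRep G n}

/-- The graded vector space `vh_P = hor_P ⊗ Ψ_inv^∧` underlying `Ω_P`. -/
def Omega (τ : IntegrableFrameStructure P u) : Type _ := Hor B n ⊗[ℂ] PsiExt τ

variable (τ : IntegrableFrameStructure P u)

instance : AddCommGroup (Omega τ) := inferInstanceAs (AddCommGroup (Hor B n ⊗[ℂ] PsiExt τ))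

instance : Module ℂ (Omega τ) := inferInstanceAs (Module ℂ (Hor B n ⊗[ℂ] PsiExt τ))

variable {τ}

/-- The elementary element `φ ⊗ η` of `vh_P`. -/
def Omega.tmul (φ : Hor B n) (η : PsiExt τ) : Omega τ := φ ⊗ₜ[ℂ] η

theorem Omega.induction_on {motive : Omega τ → Prop} (x : Omega τ) (zero : motive 0)
    (tmul : ∀ φ η, motive (Omega.tmul φ η)) (add : ∀ x y, motive x → motive y → motive (x + y)) :
    motive x := TensorProduct.induction_on x zero tmul add

theorem Omega.add_tmul (φ ψ : Hor B n) (η : PsiExt τ) :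
    Omega.tmul (φ + ψ) η = Omega.tmul φ η + Omega.tmul ψ η := TensorProduct.add_tmul _ _ _

theorem Omega.tmul_add (φ : Hor B n) (η ζ : PsiExt τ) :
    Omega.tmul φ (η + ζ) = Omega.tmul φ η + Omega.tmul φ ζ := TensorProduct.tmul_add _ _ _

theorem Omega.smul_tmul (c : ℂ) (φ : Hor B n) (η : PsiExt τ) :
    Omega.tmul (c • φ) η = c • Omega.tmul φ η := rfl

theorem Omega.tmul_smul (c : ℂ) (φ : Hor B n) (η : PsiExt τ) :
    Omega.tmul φ (c • η) = c • Omega.tmul φ η := TensorProduct.tmul_smul _ _ _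

/-- Linear maps out of `vh_P` from bilinear maps. -/
def Omega.lift {W : Type*} [AddCommGroup W] [Module ℂ W]
    (f : Hor B n →ₗ[ℂ] PsiExt τ →ₗ[ℂ] W) : Omega τ →ₗ[ℂ] W := TensorProduct.lift f

theorem Omega.hom_ext {W : Type*} [AddCommGroup W] [Module ℂ W] {f g : Omega τ →ₗ[ℂ] W}
    (h : ∀ φ η, f (Omega.tmul φ η) = g (Omega.tmul φ η)) : f = g := TensorProduct.ext' h

@[simp] theorem Omega.lift_tmul {W : Type*} [AddCommGroup W] [Module ℂ W]
    (f : Hor B n →ₗ[ℂ] PsiExt τ →ₗ[ℂ] W) (φ : Hor B n) (η : PsiExt τ) :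
    Omega.lift f (Omega.tmul φ η) = f φ η := rfl

/-- For a linear map `f : 𝒜 → Ψ_inv^∧`, the map `∑ φₖ ⊗ cₖ ↦ ∑ φₖ ⊗ f(cₖ)`. -/
def Omega.ofCoact : (Pol G →ₗ[ℂ] PsiExt τ) →ₗ[ℂ] Hor B n ⊗[ℂ] Pol G →ₗ[ℂ] Omega τ :=
  LinearMap.lTensorHom (Hor B n)

theorem Omega.ofCoact_tmul (f : Pol G →ₗ[ℂ] PsiExt τ) (φ : Hor B n) (c : Pol G) :
    Omega.ofCoact f (φ ⊗ₜ c) = Omega.tmul φ (f c) := rfl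

/-- For a linear map `f : 𝒜 ⊗ 𝒜 → Ψ_inv^∧`, the map `id ⊗ f`. -/
def Omega.ofCoact2 : (Pol G ⊗[ℂ] Pol G →ₗ[ℂ] PsiExt τ) →ₗ[ℂ]
    Hor B n ⊗[ℂ] (Pol G ⊗[ℂ] Pol G) →ₗ[ℂ] Omega τ :=
  LinearMap.lTensorHom (Hor B n)

theorem Omega.ofCoact2_tmul (f : Pol G ⊗[ℂ] Pol G →ₗ[ℂ] PsiExt τ) (φ : Hor B n)
    (c : Pol G ⊗[ℂ] Pol G) : Omega.ofCoact2 f (φ ⊗ₜ c) = Omega.tmul φ (f c) := rfl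

theorem Omega.ofCoact_comp (f : Pol G ⊗[ℂ] Pol G →ₗ[ℂ] PsiExt τ) (x : Hor B n ⊗[ℂ] Pol G) :
    Omega.ofCoact (f ∘ₗ Coalgebra.comul) x =
      Omega.ofCoact2 f (Coalgebra.comul.lTensor (Hor B n) x) :=
  LinearMap.lTensor_comp_apply _ _ _ _

/-- The map `c ↦ (ϑ ∘ c) η`, bilinear in `ϑ ∈ Ψ_inv` and `η ∈ Ψ_inv^∧`. -/
def PsiExt.actMul (τ : IntegrableFrameStructure P u) :
    PsiInv τ →ₗ[ℂ] PsiExt τ →ₗ[ℂ] Pol G →ₗ[ℂ] PsiExt τ :=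
  LinearMap.mk₂ ℂ (fun ϑ η =>
      (LinearMap.mulRight ℂ η ∘ₗ PsiExt.ι τ) ∘ₗ (LinearMap.toSpanSingleton (Pol G) _ ϑ).restrictScalars ℂ)
    (fun ϑ ϑ' η => by ext c; simp [smul_add, add_mul])
    (fun r ϑ η => by ext c; simp [smul_comm c r])
    (fun ϑ η η' => by ext c; simp [mul_add])
    (fun r ϑ η => by ext c; simp)

theorem PsiExt.actMul_apply (ϑ : PsiInv τ) (η : PsiExt τ) (c : Pol G) :
    PsiExt.actMul τ ϑ η c = PsiExt.ι τ (c • ϑ) * η := rfl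

/-- Left multiplication by `ϑ ∈ Ψ_inv` in `vh_P`:
`ϑ (φ ⊗ η) = (-1)^{∂φ} ∑ φₖ ⊗ (ϑ ∘ cₖ) η`. -/
def Omega.mulPsiInv (τ : IntegrableFrameStructure P u) : PsiInv τ →ₗ[ℂ] Module.End ℂ (Omega τ) where
  toFun ϑ := Omega.lift ((LinearMap.lcomp ℂ (Omega τ)
    ((coactHor P u).toLinearMap ∘ₗ (horParity B n).toLinearMap) ∘ₗ Omega.ofCoact ∘ₗ
      PsiExt.actMul τ ϑ).flip)
  map_add' ϑ ϑ' := Omega.hom_ext fun φ η => by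
    change Omega.ofCoact (PsiExt.actMul τ (ϑ + ϑ') η) _ =
      Omega.ofCoact (PsiExt.actMul τ ϑ η) _ + Omega.ofCoact (PsiExt.actMul τ ϑ' η) _
    rw [map_add, LinearMap.add_apply, map_add, LinearMap.add_apply]
  map_smul' r ϑ := Omega.hom_ext fun φ η => by
    change Omega.ofCoact (PsiExt.actMul τ (r • ϑ) η) _ =
      r • Omega.ofCoact (PsiExt.actMul τ ϑ η) _
    rw [map_smul, LinearMap.smul_apply, map_smul, LinearMap.smul_apply]

theorem Omega.mulPsiInv_tmul (ϑ : PsiInv τ) (φ : Hor B n) (η : PsiExt τ) :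
    Omega.mulPsiInv τ ϑ (Omega.tmul φ η) =
      Omega.ofCoact (PsiExt.actMul τ ϑ η) (coactHor P u (horParity B n φ)) := rfl

theorem coactHor_horParity (φ : Hor B n) : coactHor P u (horParity B n φ) =
    (horParity B n).toLinearMap.rTensor (Pol G) (coactHor P u φ) :=
  coactHor_comp P u (horParity B n).toLinearMap (fun g x => act_horParity g x) φ

theorem Omega.mulPsiInv_ofCoact (ϑ : PsiInv τ) (f : Pol G →ₗ[ℂ] PsiExt τ) (φ : Hor B n) :
    Omega.mulPsiInv τ ϑ (Omega.ofCoact f (coactHor P u (horParity B n φ))) =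
      Omega.ofCoact (LinearMap.mul' ℂ _ ∘ₗ TensorProduct.map (PsiExt.actMul τ ϑ 1) f ∘ₗ
        Coalgebra.comul) (coactHor P u φ) := by
  have h2 := coactHor_coassoc P u φ
  rw [← LinearMap.comp_assoc, Omega.ofCoact_comp, ← h2, coactHor_horParity]
  generalize coactHor P u φ = x
  induction x using TensorProduct.induction_on with
  | zero => simp
  | add x y hx hy => simp only [map_add, hx, hy]
  | tmul ψ c =>
    rw [LinearMap.rTensor_tmul, Omega.ofCoact_tmul, Omega.mulPsiInv_tmul, LinearMap.rTensor_tmul]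
    simp only [AlgHom.toLinearMap_apply, horParity_horParity]
    generalize coactHor P u ψ = y
    induction y using TensorProduct.induction_on with
    | zero => simp
    | add x y hx hy => simp only [map_add, TensorProduct.add_tmul, hx, hy]
    | tmul χ d =>
      rw [Omega.ofCoact_tmul]
      change _ = Omega.tmul χ (PsiExt.actMul τ ϑ 1 d * f c)
      rw [PsiExt.actMul_apply, PsiExt.actMul_apply, mul_one]

/-- Left multiplication by `Ψ_inv^∧` in `vh_P`. -/
def Omega.mulPsi (τ : IntegrableFrameStructure P u) : PsiExt τ →ₐ[ℂ] Module.End ℂ (Omega τ) :=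
  PsiExt.lift (Omega.mulPsiInv τ) fun r hr => by
    refine Omega.hom_ext fun φ η => ?_
    have key : ∀ z : Pol G ⊗[ℂ] Pol G,
        (LinearMap.mul' ℂ _ (TensorProduct.map (Omega.mulPsiInv τ ∘ₗ PsiInv.π τ)
          (Omega.mulPsiInv τ ∘ₗ PsiInv.π τ) z)) (Omega.tmul φ η) =
        Omega.ofCoact (LinearMap.mulRight ℂ η ∘ₗ actPi2 τ ∘ₗ TensorProduct.mk ℂ _ _ z ∘ₗ
          Coalgebra.comul) (coactHor P u φ) := by
      intro z
      induction z using TensorProduct.induction_on with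
      | zero => simp
      | add x y hx hy =>
        rw [map_add, map_add, LinearMap.add_apply, hx, hy, map_add, LinearMap.add_comp,
          LinearMap.comp_add, LinearMap.comp_add, map_add, LinearMap.add_apply]
      | tmul a a' =>
        rw [TensorProduct.map_tmul, LinearMap.mul'_apply, Module.End.mul_apply]
        refine (Omega.mulPsiInv_ofCoact _ _ _).trans ?_
        congr 2
        have : ∀ y : Pol G ⊗[ℂ] Pol G, LinearMap.mul' ℂ _ (TensorProduct.map
            (PsiExt.actMul τ (PsiInv.π τ a) 1) (PsiExt.actMul τ (PsiInv.π τ a') η) y) =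
            actPi2 τ ((a ⊗ₜ a') ⊗ₜ y) * η := by
          intro y
          induction y using TensorProduct.induction_on with
          | zero => simp
          | add x y hx hy => simp only [map_add, TensorProduct.tmul_add, hx, hy, add_mul]
          | tmul c c' =>
            simp only [TensorProduct.map_tmul, PsiExt.actMul_apply, actPi2_tmul,
              LinearMap.mul'_apply, mul_one, mul_assoc]
        ext c
        exact this _
    refine (key (Coalgebra.comul (R := ℂ) r)).trans ?_
    have : (LinearMap.mulRight ℂ η ∘ₗ actPi2 τ ∘ₗ
        TensorProduct.mk ℂ _ _ (Coalgebra.comul (R := ℂ) r) ∘ₗ Coalgebra.comul) = 0 := by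
      ext c
      simp [actPi2_rel τ hr]
    rw [this, map_zero]
    rfl

/-- Left multiplication by `hor_P` in `vh_P`. -/
def Omega.mulHor (τ : IntegrableFrameStructure P u) : Hor B n →ₐ[ℂ] Module.End ℂ (Omega τ) where
  toFun φ := (LinearMap.mulLeft ℂ φ).rTensor (PsiExt τ)
  map_one' := Omega.hom_ext fun φ η => congrArg (fun x => Omega.tmul x η) (one_mul φ)
  map_mul' a b := Omega.hom_ext fun φ η => congrArg (fun x => Omega.tmul x η) (mul_assoc a b φ)
  map_zero' := Omega.hom_ext fun φ η =>
    (congrArg (fun x => Omega.tmul x η) (zero_mul φ)).trans (TensorProduct.zero_tmul _ _)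
  map_add' a b := Omega.hom_ext fun φ η =>
    (congrArg (fun x => Omega.tmul x η) (add_mul a b φ)).trans (TensorProduct.add_tmul _ _ _)
  commutes' r := Omega.hom_ext fun φ η =>
    congrArg (fun x => Omega.tmul x η) (Algebra.smul_def r φ).symm

theorem Omega.mulHor_tmul (φ ψ : Hor B n) (η : PsiExt τ) :
    Omega.mulHor τ φ (Omega.tmul ψ η) = Omega.tmul (φ * ψ) η := rfl

theorem Omega.mulPsi_ι (ϑ : PsiInv τ) :
    Omega.mulPsi τ (PsiExt.ι τ ϑ) = Omega.mulPsiInv τ ϑ := PsiExt.lift_ι τ _ _ ϑ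

/-- The product of `vh_P` as a bilinear map: `(ψ ⊗ ϑ) x = ψ (ϑ x)`. Explicitly,
`(ψ ⊗ ϑ)(φ ⊗ η) = (-1)^{∂ϑ∂φ} ∑ ψ φₖ ⊗ (ϑ ∘ cₖ) η`, where `F^∧(φ) = ∑ φₖ ⊗ cₖ`. -/
def Omega.mulLin (τ : IntegrableFrameStructure P u) :
    Omega τ →ₗ[ℂ] Module.End ℂ (Omega τ) :=
  Omega.lift (LinearMap.compl₁₂ (LinearMap.mul ℂ (Module.End ℂ (Omega τ)))
    (Omega.mulHor τ).toLinearMap (Omega.mulPsi τ).toLinearMap)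

theorem Omega.mulLin_tmul (φ : Hor B n) (η : PsiExt τ) : Omega.mulLin τ (Omega.tmul φ η) =
    Omega.mulHor τ φ * Omega.mulPsi τ η := rfl

theorem Omega.mulLin_mulHor (φ : Hor B n) (x : Omega τ) :
    Omega.mulLin τ (Omega.mulHor τ φ x) = Omega.mulHor τ φ * Omega.mulLin τ x := by
  induction x using Omega.induction_on with
  | zero => simp
  | add x y hx hy => simp only [map_add, hx, hy, mul_add]
  | tmul ψ η => rw [Omega.mulHor_tmul, Omega.mulLin_tmul, Omega.mulLin_tmul, map_mul, mul_assoc]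

theorem Omega.mulPsiInv_mulHor (ϑ : PsiInv τ) (φ : Hor B n) :
    Omega.mulPsiInv τ ϑ * Omega.mulHor τ φ = LinearMap.mul' ℂ _ (TensorProduct.map
      (Omega.mulHor τ).toLinearMap
      (Omega.mulPsiInv τ ∘ₗ (LinearMap.toSpanSingleton (Pol G) _ ϑ).restrictScalars ℂ)
      (coactHor P u (horParity B n φ))) := by
  refine Omega.hom_ext fun ψ η => ?_
  rw [Module.End.mul_apply]
  rw [Omega.mulHor_tmul, Omega.mulPsiInv_tmul, map_mul, map_mul]
  generalize coactHor P u (horParity B n φ) = x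
  induction x using TensorProduct.induction_on with
  | zero => simp
  | add x y hx hy => simp only [map_add, add_mul, LinearMap.add_apply, hx, hy]
  | tmul χ c =>
    change _ = Omega.mulHor τ χ (Omega.mulPsiInv τ (c • ϑ) (Omega.tmul ψ η))
    rw [Omega.mulPsiInv_tmul]
    generalize coactHor P u (horParity B n ψ) = y
    induction y using TensorProduct.induction_on with
    | zero => simp
    | add x y hx hy => simp only [map_add, mul_add, hx, hy]
    | tmul κ d =>
      rw [Algebra.TensorProduct.tmul_mul_tmul, Omega.ofCoact_tmul, Omega.ofCoact_tmul,
        Omega.mulHor_tmul, PsiExt.actMul_apply, PsiExt.actMul_apply, smul_smul, mul_comm d c]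

theorem Omega.mulLin_mulPsiInv (ϑ : PsiInv τ) (x : Omega τ) :
    Omega.mulLin τ (Omega.mulPsiInv τ ϑ x) = Omega.mulPsiInv τ ϑ * Omega.mulLin τ x := by
  induction x using Omega.induction_on with
  | zero => simp
  | add x y hx hy => simp only [map_add, hx, hy, mul_add]
  | tmul φ η =>
    rw [Omega.mulPsiInv_tmul, Omega.mulLin_tmul, ← mul_assoc, Omega.mulPsiInv_mulHor]
    generalize coactHor P u (horParity B n φ) = x
    induction x using TensorProduct.induction_on with
    | zero => simp
    | add x y hx hy => simp only [map_add, add_mul, hx, hy]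
    | tmul χ c =>
      rw [Omega.ofCoact_tmul, Omega.mulLin_tmul, PsiExt.actMul_apply, map_mul, Omega.mulPsi_ι,
        ← mul_assoc]
      rfl

theorem Omega.mulLin_mulPsi (ζ : PsiExt τ) (x : Omega τ) :
    Omega.mulLin τ (Omega.mulPsi τ ζ x) = Omega.mulPsi τ ζ * Omega.mulLin τ x := by
  induction ζ using PsiExt.induction generalizing x with
  | algebraMap r =>
    rw [AlgHom.commutes, Module.algebraMap_end_apply, map_smul, Algebra.smul_def]
  | ι ϑ => rw [Omega.mulPsi_ι, Omega.mulLin_mulPsiInv]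
  | mul a b ha hb => rw [map_mul, Module.End.mul_apply, ha, hb, mul_assoc]
  | add a b ha hb => rw [map_add, LinearMap.add_apply, map_add, ha, hb, add_mul]

theorem Omega.mulLin_mulLin (x y : Omega τ) :
    Omega.mulLin τ (Omega.mulLin τ x y) = Omega.mulLin τ x * Omega.mulLin τ y := by
  induction x using Omega.induction_on with
  | zero => simp
  | add x x' hx hx' => simp only [map_add, LinearMap.add_apply, hx, hx', add_mul]
  | tmul φ η =>
    rw [Omega.mulLin_tmul, Module.End.mul_apply, Omega.mulLin_mulHor, Omega.mulLin_mulPsi,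
      mul_assoc]

theorem Omega.mulPsi_one_tmul (η ζ : PsiExt τ) :
    Omega.mulPsi τ η (Omega.tmul 1 ζ) = Omega.tmul 1 (η * ζ) := by
  induction η using PsiExt.induction generalizing ζ with
  | algebraMap r =>
    rw [AlgHom.commutes, Module.algebraMap_end_apply, ← Algebra.smul_def, Omega.tmul_smul]
  | ι ϑ =>
    rw [Omega.mulPsi_ι, Omega.mulPsiInv_tmul, map_one, map_one, Algebra.TensorProduct.one_def,
      Omega.ofCoact_tmul, PsiExt.actMul_apply, one_smul]
  | mul a b ha hb => rw [map_mul, Module.End.mul_apply, hb, ha, mul_assoc]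
  | add a b ha hb => rw [map_add, LinearMap.add_apply, ha, hb, add_mul, Omega.tmul_add]

instance : One (Omega τ) := ⟨Omega.tmul 1 1⟩

instance : Mul (Omega τ) := ⟨fun x y => Omega.mulLin τ x y⟩

theorem Omega.mul_def (x y : Omega τ) : x * y = Omega.mulLin τ x y := rfl

theorem Omega.one_def : (1 : Omega τ) = Omega.tmul 1 1 := rfl

instance : Ring (Omega τ) :=
  { (inferInstance : AddCommGroup (Omega τ)), (inferInstance : One (Omega τ)),
    (inferInstance : Mul (Omega τ)) with
    mul_assoc := fun x y z => by
      rw [Omega.mul_def, Omega.mul_def, Omega.mul_def, Omega.mul_def, Omega.mulLin_mulLin]; rfl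
    one_mul := fun x => by
      rw [Omega.mul_def, Omega.one_def, Omega.mulLin_tmul, map_one, map_one]; rfl
    mul_one := fun x => by
      rw [Omega.mul_def, Omega.one_def]
      induction x using Omega.induction_on with
      | zero => simp
      | add x y hx hy => rw [map_add, LinearMap.add_apply, hx, hy]
      | tmul φ η =>
        rw [Omega.mulLin_tmul, Module.End.mul_apply, Omega.mulPsi_one_tmul, Omega.mulHor_tmul,
          mul_one, mul_one]
    left_distrib := fun x y z => map_add (Omega.mulLin τ x) y z
    right_distrib := fun x y z => by
      rw [Omega.mul_def, Omega.mul_def, Omega.mul_def, map_add, LinearMap.add_apply]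
    zero_mul := fun x => by rw [Omega.mul_def, map_zero, LinearMap.zero_apply]
    mul_zero := fun x => by rw [Omega.mul_def, map_zero]
    zsmul := fun k x => k • x
    zsmul_zero' := zero_zsmul
    zsmul_succ' := fun k x => by rw [natCast_zsmul, natCast_zsmul, succ_nsmul]
    zsmul_neg' := fun k x => by rw [negSucc_zsmul, natCast_zsmul] }

instance : Algebra ℂ (Omega τ) :=
  Algebra.ofModule
    (fun r x y => by
      rw [Omega.mul_def, Omega.mul_def, map_smul, LinearMap.smul_apply])
    (fun r x y => by rw [Omega.mul_def, Omega.mul_def, map_smul])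

/-- The inclusion `hor_P ⊆ Ω_P`. -/
def Omega.ofHor (τ : IntegrableFrameStructure P u) : Hor B n →ₐ[ℂ] Omega τ :=
  AlgHom.ofLinearMap
    ({ toFun := fun φ => Omega.tmul φ 1
       map_add' := fun _ _ => Omega.add_tmul _ _ _
       map_smul' := fun _ _ => Omega.smul_tmul _ _ _ } : Hor B n →ₗ[ℂ] Omega τ)
    rfl
    (fun φ ψ => by
      change Omega.tmul (φ * ψ) 1 = Omega.mulLin τ (Omega.tmul φ 1) (Omega.tmul ψ 1)
      rw [Omega.mulLin_tmul, map_one, mul_one, Omega.mulHor_tmul])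

/-- The inclusion `Ψ_inv^∧ ⊆ Ω_P`. -/
def Omega.ofPsi (τ : IntegrableFrameStructure P u) : PsiExt τ →ₐ[ℂ] Omega τ :=
  AlgHom.ofLinearMap
    ({ toFun := fun η => Omega.tmul 1 η
       map_add' := fun _ _ => Omega.tmul_add _ _ _
       map_smul' := fun _ _ => Omega.tmul_smul _ _ _ } : PsiExt τ →ₗ[ℂ] Omega τ)
    rfl
    (fun η ζ => by
      change Omega.tmul 1 (η * ζ) = Omega.mulLin τ (Omega.tmul 1 η) (Omega.tmul 1 ζ)
      rw [Omega.mulLin_tmul, map_one, one_mul, Omega.mulPsi_one_tmul])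

/-- The inclusion `ℬ ⊆ Ω_P`. -/
def Omega.ofB (τ : IntegrableFrameStructure P u) : B →ₐ[ℂ] Omega τ :=
  (Omega.ofHor τ).comp (inclB B n)

theorem Omega.ofHor_mul_ofPsi (φ : Hor B n) (η : PsiExt τ) :
    Omega.ofHor τ φ * Omega.ofPsi τ η = Omega.tmul φ η := by
  change Omega.mulLin τ (Omega.tmul φ 1) (Omega.tmul 1 η) = _
  rw [Omega.mulLin_tmul, map_one, mul_one, Omega.mulHor_tmul, mul_one]

end Product

section Covariance

set_option linter.unusedSectionVars false

variable {m n : ℕ} {G : Subgroup (GL (Fin m) ℂ)} [CompactSpace G] {B : Type*} [Ring B]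
  [Algebra ℂ B] [StarRing B] [StarModule ℂ B] {P : QuantumPrincipalBundle G B}
  {u : RealUnitaryRep G n} {τ : IntegrableFrameStructure P u}

theorem Preconnection.D_one {τ : FrameStructure P u} (D : Preconnection τ) : D.D 1 = 0 := by
  have := D.leibniz' 1 1
  simpa using this

theorem curvature_one (D : Preconnection τ.toFrameStructure) : curvature D 1 = 0 := by
  have := curvature_spec D 1
  rw [D.D_one, map_zero, map_one, Algebra.TensorProduct.one_def] at this
  simpa [contract] using this

/-- Right translation of polynomial functions, `a ↦ a( · g)`. -/
def rightTranslate (g : G) : Pol G →ₗ[ℂ] Pol G := slice (Pol G) g ∘ₗ Coalgebra.comul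

theorem evalAt_rightTranslate (g k : G) (a : Pol G) :
    evalAt k (rightTranslate g a) = evalAt (k * g) a := by
  rw [← eval2_comul, eval2_eq]
  rfl

/-- Conjugation of polynomial functions, `a ↦ a(g⁻¹ · g)`. -/
def conjTranslate (g : G) : Pol G →ₗ[ℂ] Pol G := leftTranslate g⁻¹ ∘ₗ rightTranslate g

theorem evalAt_conjTranslate (g k : G) (a : Pol G) :
    evalAt k (conjTranslate g a) = evalAt (g⁻¹ * k * g) a := by
  rw [conjTranslate, LinearMap.comp_apply, evalAt_leftTranslate, evalAt_rightTranslate]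

theorem coactHor_act (g : G) (φ : Hor B n) : coactHor P u (act P u g φ) =
    TensorProduct.map (act P u g) (conjTranslate g) (coactHor P u φ) := by
  apply slice_ext; intro k
  have : ∀ x : Hor B n ⊗[ℂ] Pol G, slice _ k (TensorProduct.map (act P u g) (conjTranslate g) x) =
      act P u g (slice _ (g⁻¹ * k * g) x) := by
    intro x
    induction x using TensorProduct.induction_on with
    | zero => simp
    | add x y hx hy => simp only [map_add, hx, hy]
    | tmul v a => simp [evalAt_conjTranslate]
  rw [this, slice_coactHor, slice_coactHor, act_act, act_act]
  congr 1
  group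

/-- Covariance of the curvature. -/
theorem act_curvature (D : Preconnection τ.toFrameStructure) (g : G) (a : Pol G) :
    act P u g (curvature D a) = curvature D (conjTranslate g a) := by
  have h : curvature D = act P u g⁻¹ ∘ₗ curvature D ∘ₗ conjTranslate g := by
    apply contract_ext (P := P) (u := u)
    intro b
    have h1 : ∀ x : Hor B n ⊗[ℂ] Pol G,
        contract (act P u g⁻¹ ∘ₗ curvature D ∘ₗ conjTranslate g) x = act P u g⁻¹
          (contract (curvature D) (TensorProduct.map (act P u g) (conjTranslate g) x)) := by
      intro x
      induction x using TensorProduct.induction_on with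
      | zero => simp
      | add x y hx hy => simp only [map_add, hx, hy]
      | tmul v a => simp [contract, act_mul, act_act, act_one]
    rw [h1, ← coactHor_act]
    have e := curvature_spec D (inclB B n b)
    have e' := curvature_spec D (act P u g (inclB B n b))
    rw [eq_comm, neg_eq_iff_eq_neg] at e e'
    rw [e, e', ← D.act, ← D.act, map_neg, act_act, inv_mul_cancel, act_one]
  have h2 := LinearMap.congr_fun h a
  rw [LinearMap.comp_apply, LinearMap.comp_apply] at h2
  rw [h2, act_act, mul_inv_cancel, act_one]

theorem contract_comp_inclB (χ : Pol G →ₗ[ℂ] Hor B n) (f : Hor B n →ₗ[ℂ] Hor B n)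
    (hf : ∀ b ψ, f (inclB B n b * ψ) = inclB B n b * f ψ) (b : B) :
    contract (f ∘ₗ χ) (coactHor P u (inclB B n b)) =
      f (contract χ (coactHor P u (inclB B n b))) := by
  rw [coactHor_inclB]
  generalize P.F b = x
  induction x using TensorProduct.induction_on with
  | zero => simp
  | add x y hx hy => simp only [map_add, hx, hy]
  | tmul v a => simp [contract, hf]

theorem horParity_curvature (D : Preconnection τ.toFrameStructure) (a : Pol G) :
    horParity B n (curvature D a) = curvature D a := by
  have h : (horParity B n).toLinearMap ∘ₗ curvature D = curvature D := by
    apply contract_ext (P := P) (u := u)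
    intro b
    rw [contract_comp_inclB _ _ (fun b ψ => by simp [horParity_inclB])]
    have e := curvature_spec D (inclB B n b)
    rw [eq_comm, neg_eq_iff_eq_neg] at e
    have hp : ∀ x, horParity B n (D.D x) = - D.D (horParity B n x) := fun x => by
      rw [D.parity, neg_neg]
    rw [e, AlgHom.toLinearMap_apply, map_neg, hp, hp, horParity_inclB, map_neg, neg_neg]
  exact LinearMap.congr_fun h a

/-- The Bianchi identity. -/
theorem D_curvature (D : Preconnection τ.toFrameStructure) (a : Pol G) :
    D.D (curvature D a) = 0 := by
  have h : D.D ∘ₗ curvature D = 0 := by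
    apply contract_ext (P := P) (u := u)
    intro b
    have h1 : ∀ x : B ⊗[ℂ] Pol G, D.D (contract (curvature D)
        ((inclB B n).toLinearMap.rTensor (Pol G) x)) =
        contract (curvature D) (D.D.rTensor (Pol G) ((inclB B n).toLinearMap.rTensor (Pol G) x)) +
        contract (D.D ∘ₗ curvature D) ((inclB B n).toLinearMap.rTensor (Pol G) x) := by
      intro x
      induction x using TensorProduct.induction_on with
      | zero => simp
      | add x y hx hy => simp only [map_add, hx, hy]; abel
      | tmul v a => simp [contract, D.leibniz', horParity_inclB]
    have h2 := h1 (P.F b)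
    rw [← coactHor_inclB (u := u), ← D.covariant] at h2
    have e := curvature_spec D (inclB B n b)
    have e' := curvature_spec D (D.D (inclB B n b))
    rw [eq_comm, neg_eq_iff_eq_neg] at e e'
    rw [e, e', map_neg, left_eq_add] at h2
    rw [h2]
    simp [contract]
  exact LinearMap.congr_fun h a

end Covariance

section Conv

variable {m : ℕ} {G : Subgroup (GL (Fin m) ℂ)}

/-- The convolution product `a ↦ ∑ f(a⁽¹⁾) g(a⁽²⁾)`. -/
def conv {W : Type*} [Ring W] [Algebra ℂ W] (f g : Pol G →ₗ[ℂ] W) : Pol G →ₗ[ℂ] W :=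
  LinearMap.mul' ℂ W ∘ₗ TensorProduct.map f g ∘ₗ Coalgebra.comul

theorem convSq_eq {W : Type*} [Ring W] [Algebra ℂ W] (f : Pol G →ₗ[ℂ] W) :
    convSq f = conv f f := rfl

theorem conv_add_left {W : Type*} [Ring W] [Algebra ℂ W] (f f' g : Pol G →ₗ[ℂ] W) :
    conv (f + f') g = conv f g + conv f' g := by
  rw [conv, TensorProduct.map_add_left, LinearMap.add_comp, LinearMap.comp_add]; rfl

theorem conv_add_right {W : Type*} [Ring W] [Algebra ℂ W] (f g g' : Pol G →ₗ[ℂ] W) :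
    conv f (g + g') = conv f g + conv f g' := by
  rw [conv, TensorProduct.map_add_right, LinearMap.add_comp, LinearMap.comp_add]; rfl

theorem conv_neg_left {W : Type*} [Ring W] [Algebra ℂ W] (f g : Pol G →ₗ[ℂ] W) :
    conv (-f) g = - conv f g := by
  rw [eq_neg_iff_add_eq_zero, ← conv_add_left, neg_add_cancel, conv, TensorProduct.map_zero_left]
  simp

theorem conv_neg_right {W : Type*} [Ring W] [Algebra ℂ W] (f g : Pol G →ₗ[ℂ] W) :
    conv f (-g) = - conv f g := by
  rw [eq_neg_iff_add_eq_zero, ← conv_add_right, neg_add_cancel, conv, TensorProduct.map_zero_right]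
  simp

theorem conv_comp {W W' : Type*} [Ring W] [Algebra ℂ W] [Ring W'] [Algebra ℂ W']
    (j : W →ₐ[ℂ] W') (f g : Pol G →ₗ[ℂ] W) :
    conv (j.toLinearMap ∘ₗ f) (j.toLinearMap ∘ₗ g) = j.toLinearMap ∘ₗ conv f g := by
  ext a
  simp only [conv, LinearMap.comp_apply]
  generalize Coalgebra.comul (R := ℂ) a = z
  induction z using TensorProduct.induction_on with
  | zero => simp
  | add x y hx hy => simp only [map_add, hx, hy]
  | tmul x y => simp

theorem conv_assoc {W : Type*} [Ring W] [Algebra ℂ W] (f g h : Pol G →ₗ[ℂ] W) :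
    conv (conv f g) h = conv f (conv g h) := by
  ext a
  have h1 : ∀ z : Pol G ⊗[ℂ] Pol G, LinearMap.mul' ℂ W (TensorProduct.map (conv f g) h z) =
      (LinearMap.mul' ℂ W ∘ₗ TensorProduct.map f (LinearMap.mul' ℂ W ∘ₗ TensorProduct.map g h))
        (TensorProduct.assoc ℂ _ _ _ ((Coalgebra.comul (R := ℂ)).rTensor (Pol G) z)) := by
    intro z
    induction z using TensorProduct.induction_on with
    | zero => simp
    | add x y hx hy => simp only [map_add, hx, hy]
    | tmul x y =>
      simp only [TensorProduct.map_tmul, LinearMap.rTensor_tmul, conv, LinearMap.comp_apply]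
      generalize Coalgebra.comul (R := ℂ) x = w
      induction w using TensorProduct.induction_on with
      | zero => simp
      | add x y hx hy => simp only [map_add, TensorProduct.add_tmul, hx, hy]
      | tmul x y => simp [mul_assoc]
  have h2 : ∀ z : Pol G ⊗[ℂ] Pol G, LinearMap.mul' ℂ W (TensorProduct.map f (conv g h) z) =
      (LinearMap.mul' ℂ W ∘ₗ TensorProduct.map f (LinearMap.mul' ℂ W ∘ₗ TensorProduct.map g h))
        ((Coalgebra.comul (R := ℂ)).lTensor (Pol G) z) := by
    intro z
    induction z using TensorProduct.induction_on with
    | zero => simp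
    | add x y hx hy => simp only [map_add, hx, hy]
    | tmul x y => simp [conv]
  change LinearMap.mul' ℂ W (TensorProduct.map (conv f g) h (Coalgebra.comul a)) =
    LinearMap.mul' ℂ W (TensorProduct.map f (conv g h) (Coalgebra.comul a))
  rw [h1, h2, Coalgebra.coassoc_apply]

end Conv

section Differential

set_option linter.unusedSectionVars false

variable {m n : ℕ} {G : Subgroup (GL (Fin m) ℂ)} [CompactSpace G] {B : Type*} [Ring B]
  [Algebra ℂ B] [StarRing B] [StarModule ℂ B] {P : QuantumPrincipalBundle G B}
  {u : RealUnitaryRep G n} {τ : IntegrableFrameStructure P u}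

theorem Omega.ofHor_mul (φ : Hor B n) (x : Omega τ) :
    Omega.ofHor τ φ * x = Omega.mulHor τ φ x := by
  change Omega.mulLin τ (Omega.tmul φ 1) x = _
  rw [Omega.mulLin_tmul, map_one, mul_one]

theorem Omega.ofPsi_mul (η : PsiExt τ) (x : Omega τ) :
    Omega.ofPsi τ η * x = Omega.mulPsi τ η x := by
  change Omega.mulLin τ (Omega.tmul 1 η) x = _
  rw [Omega.mulLin_tmul, map_one, one_mul]

theorem Omega.ofPsi_ι_mul (ϑ : PsiInv τ) (x : Omega τ) :
    Omega.ofPsi τ (PsiExt.ι τ ϑ) * x = Omega.mulPsiInv τ ϑ x := by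
  rw [Omega.ofPsi_mul, Omega.mulPsi_ι]

theorem Omega.ofPsi_apply (η : PsiExt τ) : Omega.ofPsi τ η = Omega.tmul 1 η := rfl

theorem Omega.ofHor_apply (φ : Hor B n) : Omega.ofHor τ φ = Omega.tmul φ 1 := rfl

theorem Omega.tmul_mul_ofPsi (φ : Hor B n) (η ζ : PsiExt τ) :
    Omega.tmul φ η * Omega.ofPsi τ ζ = Omega.tmul φ (η * ζ) := by
  rw [← Omega.ofHor_mul_ofPsi, mul_assoc, ← map_mul, Omega.ofHor_mul_ofPsi]

/-- The projection `π : 𝒜 → Ψ_inv ⊆ Ψ_inv^∧`. -/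
def PsiExt.π (τ : IntegrableFrameStructure P u) : Pol G →ₗ[ℂ] PsiExt τ :=
  PsiExt.ι τ ∘ₗ PsiInv.π τ

/-- `∑ ρ(a⁽¹⁾) π(a⁽²⁾) = ∑ π(a⁽¹⁾) ρ(a⁽²⁾) + ∑ ρ(a)ₖ π(cₖ)` in `vh_P`, for the curvature `ρ`. -/
theorem conv_curvature (D : Preconnection τ.toFrameStructure) (a : Pol G) :
    conv ((Omega.ofHor τ).toLinearMap ∘ₗ curvature D) ((Omega.ofPsi τ).toLinearMap ∘ₗ PsiExt.π τ) a =
      conv ((Omega.ofPsi τ).toLinearMap ∘ₗ PsiExt.π τ) ((Omega.ofHor τ).toLinearMap ∘ₗ curvature D) a +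
        Omega.ofCoact (PsiExt.π τ) (coactHor P u (curvature D a)) := by
  let Y : Pol G ⊗[ℂ] Pol G →ₗ[ℂ] Hor B n ⊗[ℂ] Pol G := LinearMap.mul' ℂ _ ∘ₗ TensorProduct.map
    (TensorProduct.mk ℂ (Hor B n) (Pol G) 1 ∘ₗ (LinearMap.id - Algebra.linearMap ℂ (Pol G) ∘ₗ
      Coalgebra.counit)) ((coactHor P u).toLinearMap ∘ₗ curvature D)
  have hl : ∀ z : Pol G ⊗[ℂ] Pol G, LinearMap.mul' ℂ _ (TensorProduct.map
      ((Omega.ofHor τ).toLinearMap ∘ₗ curvature D) ((Omega.ofPsi τ).toLinearMap ∘ₗ PsiExt.π τ) z) =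
      Omega.ofCoact (PsiExt.π τ) ((curvature D).rTensor (Pol G) z) := by
    intro z
    induction z using TensorProduct.induction_on with
    | zero => simp
    | add x y hx hy => simp only [map_add, hx, hy]
    | tmul x y => exact Omega.ofHor_mul_ofPsi _ _
  have hr : ∀ z : Pol G ⊗[ℂ] Pol G, LinearMap.mul' ℂ _ (TensorProduct.map
      ((Omega.ofPsi τ).toLinearMap ∘ₗ PsiExt.π τ) ((Omega.ofHor τ).toLinearMap ∘ₗ curvature D) z) =
      Omega.ofCoact (PsiExt.π τ) (Y z) := by
    intro z
    induction z using TensorProduct.induction_on with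
    | zero => simp
    | add x y hx hy => simp only [map_add, hx, hy]
    | tmul x y =>
      change Omega.ofPsi τ (PsiExt.ι τ (PsiInv.π τ x)) * Omega.tmul (curvature D y) 1 =
        Omega.ofCoact (PsiExt.π τ) ((1 ⊗ₜ (x - algebraMap ℂ (Pol G) (Coalgebra.counit x))) *
          coactHor P u (curvature D y))
      rw [Omega.ofPsi_ι_mul, Omega.mulPsiInv_tmul, horParity_curvature]
      generalize coactHor P u (curvature D y) = w
      induction w using TensorProduct.induction_on with
      | zero => simp
      | add x y hx hy => simp only [map_add, mul_add, hx, hy]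
      | tmul v c =>
        rw [Algebra.TensorProduct.tmul_mul_tmul, one_mul, Omega.ofCoact_tmul, Omega.ofCoact_tmul,
          PsiExt.actMul_apply, mul_one, PsiInv.smul_π, sub_mul, ← Algebra.smul_def, PsiExt.π,
          LinearMap.comp_apply]
        simp only [map_sub, map_smul]
  refine (hl _).trans (Eq.trans ?_ (congrArg (· + _) (hr _).symm))
  rw [← map_add]
  congr 1
  apply slice_ext; intro g
  have hY : ∀ z, slice _ g (Y z) = act P u g (curvature D
      (TensorProduct.lid ℂ _ ((evalAt g).toLinearMap.rTensor _ z) -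
        TensorProduct.lid ℂ _ ((evalAt 1).toLinearMap.rTensor _ z))) := by
    intro z
    induction z using TensorProduct.induction_on with
    | zero => simp
    | add x y hx hy => simp only [map_add, map_sub, hx, hy]; abel
    | tmul x y =>
      change slice _ g ((1 ⊗ₜ (x - algebraMap ℂ (Pol G) (Coalgebra.counit x))) *
          coactHor P u (curvature D y)) = _
      rw [slice_mul, slice_coactHor, slice_tmul]
      simp [counit_eq, sub_smul, sub_mul]
  rw [slice_rTensor, map_add, slice_coactHor, hY, ← map_add, ← map_add, act_curvature]
  congr 1
  apply pol_ext; intro k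
  change evalAt k (rightTranslate g a) = evalAt k (conjTranslate g
    (leftTranslate g a - leftTranslate 1 a + a))
  rw [evalAt_rightTranslate, evalAt_conjTranslate, map_add, map_sub, evalAt_leftTranslate,
    evalAt_leftTranslate, one_mul, sub_add_cancel]
  congr 1
  group

/-- The curvature `ϱ_D` as a map `Ψ_inv → hor_P`. -/
def curvatureInv (D : Preconnection τ.toFrameStructure) : PsiInv τ →ₗ[ℂ] Hor B n :=
  PsiInv.lift (curvature D) fun _ hr => hr.2.1 D

theorem curvatureInv_π (D : Preconnection τ.toFrameStructure) (a : Pol G) :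
    curvatureInv D (PsiInv.π τ a) = curvature D a :=
  PsiInv.lift_π τ _ _ (curvature_one D) a

/-- The differential `d π(a) = -∑ π(a⁽¹⁾) π(a⁽²⁾)` of `Ψ^∧` on left-invariant elements. -/
def PsiInv.d (τ : IntegrableFrameStructure P u) : PsiInv τ →ₗ[ℂ] PsiExt τ :=
  PsiInv.lift (-convSq (PsiExt.π τ)) fun r hr => by
    rw [LinearMap.neg_apply, neg_eq_zero]; exact PsiExt.rel τ hr

theorem PsiInv.d_π (a : Pol G) : PsiInv.d τ (PsiInv.π τ a) = -convSq (PsiExt.π τ) a := by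
  refine PsiInv.lift_π τ _ _ ?_ a
  rw [LinearMap.neg_apply, convSq, LinearMap.comp_apply, LinearMap.comp_apply, Bialgebra.comul_one,
    Algebra.TensorProduct.one_def, TensorProduct.map_tmul, PsiExt.π, LinearMap.comp_apply,
    PsiInv.π_one]
  simp

/-- The value `∂_D(ϑ) = ϱ_D(ϑ) + d(ϑ)` for `ϑ ∈ Ψ_inv`. -/
def diffPsiInv (D : Preconnection τ.toFrameStructure) : PsiInv τ →ₗ[ℂ] Omega τ :=
  (Omega.ofHor τ).toLinearMap ∘ₗ curvatureInv D + (Omega.ofPsi τ).toLinearMap ∘ₗ PsiInv.d τ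

theorem diffPsiInv_comp (D : Preconnection τ.toFrameStructure) : diffPsiInv D ∘ₗ PsiInv.π τ =
    (Omega.ofHor τ).toLinearMap ∘ₗ curvature D +
      -((Omega.ofPsi τ).toLinearMap ∘ₗ convSq (PsiExt.π τ)) := by
  ext a
  simp only [diffPsiInv, LinearMap.comp_apply, LinearMap.add_apply, curvatureInv_π, PsiInv.d_π,
    LinearMap.neg_apply, map_neg]

theorem conv_diffPsiInv (D : Preconnection τ.toFrameStructure) (a : Pol G) :
    conv (diffPsiInv D ∘ₗ PsiInv.π τ) ((Omega.ofPsi τ).toLinearMap ∘ₗ PsiExt.π τ) a =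
      conv ((Omega.ofPsi τ).toLinearMap ∘ₗ PsiExt.π τ) (diffPsiInv D ∘ₗ PsiInv.π τ) a +
        Omega.ofCoact (PsiExt.π τ) (coactHor P u (curvature D a)) := by
  rw [diffPsiInv_comp, conv_add_left, conv_add_right, LinearMap.add_apply, LinearMap.add_apply,
    conv_curvature, convSq_eq, ← conv_comp, conv_neg_left, conv_neg_right, conv_assoc]
  abel

/-- The algebra homomorphism encoding the graded Leibniz rule for `∂_D` on `Ψ_inv^∧`: it is the
multiplicative extension of `ϑ ↦ (ϑ, 0; ∂_D ϑ, -ϑ)`. -/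
def diffMatrix (D : Preconnection τ.toFrameStructure) :
    PsiExt τ →ₐ[ℂ] Matrix (Fin 2) (Fin 2) (Omega τ) :=
  PsiExt.lift
    { toFun := fun ϑ => !![Omega.ofPsi τ (PsiExt.ι τ ϑ), 0;
        diffPsiInv D ϑ, -Omega.ofPsi τ (PsiExt.ι τ ϑ)]
      map_add' := fun x y => by
        ext i j; fin_cases i <;> fin_cases j <;> simp [add_comm]
      map_smul' := fun c x => by
        ext i j; fin_cases i <;> fin_cases j <;> simp }
    (fun r hr => by
      have key : ∀ z : Pol G ⊗[ℂ] Pol G, ∀ M : Pol G →ₗ[ℂ] Matrix (Fin 2) (Fin 2) (Omega τ),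
          (∀ a, M a = !![Omega.ofPsi τ (PsiExt.π τ a), 0;
            diffPsiInv D (PsiInv.π τ a), -Omega.ofPsi τ (PsiExt.π τ a)]) →
          LinearMap.mul' ℂ _ (TensorProduct.map M M z) =
          !![Omega.ofPsi τ (LinearMap.mul' ℂ _ (TensorProduct.map (PsiExt.π τ) (PsiExt.π τ) z)), 0;
            LinearMap.mul' ℂ _ (TensorProduct.map (diffPsiInv D ∘ₗ PsiInv.π τ)
              ((Omega.ofPsi τ).toLinearMap ∘ₗ PsiExt.π τ) z) -
            LinearMap.mul' ℂ _ (TensorProduct.map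
              ((Omega.ofPsi τ).toLinearMap ∘ₗ PsiExt.π τ) (diffPsiInv D ∘ₗ PsiInv.π τ) z),
            Omega.ofPsi τ (LinearMap.mul' ℂ _ (TensorProduct.map (PsiExt.π τ) (PsiExt.π τ) z))] := by
        intro z M hM
        induction z using TensorProduct.induction_on with
        | zero => ext i j; fin_cases i <;> fin_cases j <;> simp
        | add x y hx hy =>
          simp only [map_add, hx, hy]
          ext i j; fin_cases i <;> fin_cases j <;> simp
          abel
        | tmul x y =>
          rw [TensorProduct.map_tmul, LinearMap.mul'_apply, hM, hM, Matrix.mul_fin_two]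
          ext i j; fin_cases i <;> fin_cases j <;> simp [sub_eq_add_neg]
      refine (key (Coalgebra.comul (R := ℂ) r) _ fun a => rfl).trans ?_
      have h1 : LinearMap.mul' ℂ _ (TensorProduct.map (PsiExt.π τ) (PsiExt.π τ)
        (Coalgebra.comul (R := ℂ) r)) = 0 := PsiExt.rel τ hr
      have h2 := conv_diffPsiInv D r
      rw [hr.2.1 D, map_zero, map_zero, add_zero] at h2
      have h3 := sub_eq_zero.2 h2
      simp only [conv, LinearMap.comp_apply] at h3
      rw [h1, map_zero, h3]
      ext i j; fin_cases i <;> fin_cases j <;> rfl)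

theorem diffMatrix_ι (D : Preconnection τ.toFrameStructure) (ϑ : PsiInv τ) :
    diffMatrix D (PsiExt.ι τ ϑ) = !![Omega.ofPsi τ (PsiExt.ι τ ϑ), 0;
        diffPsiInv D ϑ, -Omega.ofPsi τ (PsiExt.ι τ ϑ)] :=
  PsiExt.lift_ι τ _ _ ϑ

/-- The restriction of `∂_D` to `Ψ_inv^∧`. -/
def diffPsi (D : Preconnection τ.toFrameStructure) : PsiExt τ →ₗ[ℂ] Omega τ where
  toFun η := diffMatrix D η 1 0
  map_add' x y := by simp
  map_smul' c x := by simp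

theorem diffPsi_ι (D : Preconnection τ.toFrameStructure) (ϑ : PsiInv τ) :
    diffPsi D (PsiExt.ι τ ϑ) = diffPsiInv D ϑ :=
  congrFun (congrFun (diffMatrix_ι D ϑ) 1) 0

/-- The restriction of `∂_D` to `hor_P`: `∂_D(φ) = D(φ) + (-1)^{∂φ} ∑ φₖ π(cₖ)`. -/
def diffHor (D : Preconnection τ.toFrameStructure) : Hor B n →ₗ[ℂ] Omega τ :=
  (Omega.ofHor τ).toLinearMap ∘ₗ D.D +
    Omega.ofCoact (PsiExt.π τ) ∘ₗ (coactHor P u).toLinearMap ∘ₗ (horParity B n).toLinearMap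

theorem diffHor_apply (D : Preconnection τ.toFrameStructure) (φ : Hor B n) : diffHor D φ =
    Omega.ofHor τ (D.D φ) + Omega.ofCoact (PsiExt.π τ) (coactHor P u (horParity B n φ)) := rfl

/-- The differential `∂_D` of `vh_P`: the extension of the maps above by the graded Leibniz rule
`∂_D(φ ⊗ η) = ∂_D(φ) η + (-1)^{∂φ} φ ∂_D(η)`. -/
def diff (D : Preconnection τ.toFrameStructure) : Omega τ →ₗ[ℂ] Omega τ :=
  Omega.lift
    (LinearMap.compl₁₂ (LinearMap.mul ℂ (Omega τ)) (diffHor D) (Omega.ofPsi τ).toLinearMap +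
      LinearMap.compl₁₂ (LinearMap.mul ℂ (Omega τ))
        ((Omega.ofHor τ).toLinearMap ∘ₗ (horParity B n).toLinearMap) (diffPsi D))

theorem diff_tmul (D : Preconnection τ.toFrameStructure) (φ : Hor B n) (η : PsiExt τ) :
    diff D (Omega.tmul φ η) = diffHor D φ * Omega.ofPsi τ η +
      Omega.ofHor τ (horParity B n φ) * diffPsi D η := rfl

end Differential

section Leibniz

set_option linter.unusedSectionVars false

variable {m n : ℕ} {G : Subgroup (GL (Fin m) ℂ)} [CompactSpace G] {B : Type*} [Ring B]
  [Algebra ℂ B] [StarRing B] [StarModule ℂ B] {P : QuantumPrincipalBundle G B}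
  {u : RealUnitaryRep G n} {τ : IntegrableFrameStructure P u}

theorem diffMatrix_apply (D : Preconnection τ.toFrameStructure) (η : PsiExt τ) :
    diffMatrix D η 0 0 = Omega.ofPsi τ η ∧ diffMatrix D η 0 1 = 0 := by
  induction η using PsiExt.induction with
  | algebraMap r =>
    rw [AlgHom.commutes, AlgHom.commutes]
    simp [Matrix.algebraMap_matrix_apply]
  | ι ϑ => rw [diffMatrix_ι]; exact ⟨rfl, rfl⟩
  | mul x y hx hy =>
    rw [map_mul, map_mul, Matrix.mul_apply, Matrix.mul_apply, Fin.sum_univ_two, Fin.sum_univ_two,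
      hx.1, hx.2, hy.1, hy.2]
    simp
  | add x y hx hy =>
    rw [map_add, map_add, Matrix.add_apply, Matrix.add_apply, hx.1, hx.2, hy.1, hy.2]
    simp

/-- The grading automorphism of `Ψ_inv^∧`. -/
def PsiExt.parity (τ : IntegrableFrameStructure P u) : PsiExt τ →ₐ[ℂ] PsiExt τ :=
  PsiExt.lift (-PsiExt.ι τ) fun r hr => by
    have : convSq ((-PsiExt.ι τ) ∘ₗ PsiInv.π τ) r = convSq (PsiExt.ι τ ∘ₗ PsiInv.π τ) r := by
      rw [LinearMap.neg_comp, convSq_eq, conv_neg_left, conv_neg_right, neg_neg, convSq_eq]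
    rw [this, PsiExt.rel τ hr]

theorem PsiExt.parity_ι (ϑ : PsiInv τ) : PsiExt.parity τ (PsiExt.ι τ ϑ) = - PsiExt.ι τ ϑ :=
  PsiExt.lift_ι τ _ _ ϑ

theorem diffMatrix_apply' (D : Preconnection τ.toFrameStructure) (η : PsiExt τ) :
    diffMatrix D η 1 1 = Omega.ofPsi τ (PsiExt.parity τ η) := by
  induction η using PsiExt.induction with
  | algebraMap r =>
    simp [AlgHom.commutes, Matrix.algebraMap_matrix_apply]
  | ι ϑ => rw [diffMatrix_ι, PsiExt.parity_ι, map_neg]; rfl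
  | mul x y hx hy =>
    rw [map_mul, Matrix.mul_apply, Fin.sum_univ_two, hx, hy, (diffMatrix_apply D y).2, map_mul,
      map_mul, mul_zero, zero_add]
  | add x y hx hy => simp only [map_add, Matrix.add_apply, hx, hy]

theorem diffPsi_mul (D : Preconnection τ.toFrameStructure) (η ζ : PsiExt τ) :
    diffPsi D (η * ζ) = diffPsi D η * Omega.ofPsi τ ζ +
      Omega.ofPsi τ (PsiExt.parity τ η) * diffPsi D ζ := by
  change diffMatrix D (η * ζ) 1 0 = diffMatrix D η 1 0 * _ + _ * diffMatrix D ζ 1 0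
  rw [map_mul, Matrix.mul_apply, Fin.sum_univ_two, (diffMatrix_apply D ζ).1, diffMatrix_apply']

theorem diffPsi_one (D : Preconnection τ.toFrameStructure) : diffPsi D 1 = 0 := by
  change diffMatrix D 1 1 0 = 0
  rw [map_one]; simp

theorem PsiExt.π_one : PsiExt.π τ 1 = 0 := by
  rw [PsiExt.π, LinearMap.comp_apply, PsiInv.π_one, map_zero]

theorem diffHor_one (D : Preconnection τ.toFrameStructure) : diffHor D 1 = 0 := by
  rw [diffHor_apply, D.D_one, map_one, map_one, Algebra.TensorProduct.one_def, Omega.ofCoact_tmul,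
    PsiExt.π_one, ← Omega.ofHor_mul_ofPsi]
  simp

theorem diff_ofHor (D : Preconnection τ.toFrameStructure) (φ : Hor B n) :
    diff D (Omega.ofHor τ φ) = diffHor D φ := by
  rw [Omega.ofHor_apply, diff_tmul, map_one, diffPsi_one]
  simp

theorem diff_ofPsi (D : Preconnection τ.toFrameStructure) (η : PsiExt τ) :
    diff D (Omega.ofPsi τ η) = diffPsi D η := by
  rw [Omega.ofPsi_apply, diff_tmul, diffHor_one]
  simp

/-- The grading automorphism `x ↦ (-1)^{∂x} x` of `vh_P`. -/
def Omega.parityLin (τ : IntegrableFrameStructure P u) : Omega τ →ₗ[ℂ] Omega τ :=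
  TensorProduct.map (horParity B n).toLinearMap (PsiExt.parity τ).toLinearMap

theorem Omega.parityLin_tmul (φ : Hor B n) (η : PsiExt τ) :
    Omega.parityLin τ (Omega.tmul φ η) = Omega.tmul (horParity B n φ) (PsiExt.parity τ η) := rfl

theorem Omega.ofHor_mul_tmul (φ ψ : Hor B n) (η : PsiExt τ) :
    Omega.ofHor τ φ * Omega.tmul ψ η = Omega.tmul (φ * ψ) η := by
  rw [Omega.ofHor_mul, Omega.mulHor_tmul]

theorem Omega.ι_mul_tmul (ϑ : PsiInv τ) (φ : Hor B n) (η : PsiExt τ) :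
    Omega.ofPsi τ (PsiExt.ι τ ϑ) * Omega.tmul φ η =
      Omega.ofCoact (PsiExt.actMul τ ϑ η) (coactHor P u (horParity B n φ)) := by
  rw [Omega.ofPsi_ι_mul, Omega.mulPsiInv_tmul]

theorem Omega.parity_ι_mul (ϑ : PsiInv τ) (x : Omega τ) :
    Omega.parityLin τ (Omega.ofPsi τ (PsiExt.ι τ ϑ) * x) =
      - (Omega.ofPsi τ (PsiExt.ι τ ϑ) * Omega.parityLin τ x) := by
  induction x using Omega.induction_on with
  | zero => simp
  | add x y hx hy => simp only [mul_add, map_add, hx, hy, neg_add]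
  | tmul φ η =>
    rw [Omega.parityLin_tmul, Omega.ι_mul_tmul, Omega.ι_mul_tmul, coactHor_horParity (horParity B n φ)]
    generalize coactHor P u (horParity B n φ) = w
    induction w using TensorProduct.induction_on with
    | zero => simp
    | add x y hx hy => simp only [map_add, hx, hy, neg_add]
    | tmul v c =>
      simp only [LinearMap.rTensor_tmul, Omega.ofCoact_tmul, Omega.parityLin_tmul,
        AlgHom.toLinearMap_apply, PsiExt.actMul_apply, map_mul, PsiExt.parity_ι, neg_mul]
      rw [← neg_one_smul ℂ (_ * _), Omega.tmul_smul, neg_one_smul]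

theorem Omega.parity_ofHor_mul (φ : Hor B n) (x : Omega τ) :
    Omega.parityLin τ (Omega.ofHor τ φ * x) =
      Omega.ofHor τ (horParity B n φ) * Omega.parityLin τ x := by
  induction x using Omega.induction_on with
  | zero => simp
  | add x y hx hy => simp only [mul_add, map_add, hx, hy]
  | tmul ψ η =>
    rw [Omega.ofHor_mul_tmul, Omega.parityLin_tmul, Omega.parityLin_tmul, Omega.ofHor_mul_tmul,
      map_mul]

/-- `vh_P` is generated by `hor_P` and `Ψ_inv`. -/
theorem Omega.induction_mul {motive : Omega τ → Prop} (x : Omega τ)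
    (ofHor : ∀ φ, motive (Omega.ofHor τ φ)) (ι : ∀ ϑ, motive (Omega.ofPsi τ (PsiExt.ι τ ϑ)))
    (mul : ∀ x y, motive x → motive y → motive (x * y))
    (add : ∀ x y, motive x → motive y → motive (x + y)) : motive x := by
  induction x using Omega.induction_on with
  | zero => rw [← map_zero (Omega.ofHor τ)]; exact ofHor 0
  | add x y hx hy => exact add _ _ hx hy
  | tmul φ η =>
    rw [← Omega.ofHor_mul_ofPsi]
    refine mul _ _ (ofHor φ) ?_
    induction η using PsiExt.induction with
    | algebraMap r => rw [AlgHom.commutes, ← AlgHom.commutes (Omega.ofHor τ)]; exact ofHor _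
    | ι ϑ => exact ι ϑ
    | mul x y hx hy => rw [map_mul]; exact mul _ _ hx hy
    | add x y hx hy => rw [map_add]; exact add _ _ hx hy

theorem Omega.parity_ofHor (φ : Hor B n) :
    Omega.parityLin τ (Omega.ofHor τ φ) = Omega.ofHor τ (horParity B n φ) := by
  rw [Omega.ofHor_apply, Omega.parityLin_tmul, map_one]; rfl

theorem Omega.parity_ofPsi (η : PsiExt τ) :
    Omega.parityLin τ (Omega.ofPsi τ η) = Omega.ofPsi τ (PsiExt.parity τ η) := by
  rw [Omega.ofPsi_apply, Omega.parityLin_tmul, map_one]; rfl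

theorem Omega.parity_mul (x y : Omega τ) :
    Omega.parityLin τ (x * y) = Omega.parityLin τ x * Omega.parityLin τ y := by
  induction x using Omega.induction_mul generalizing y with
  | ofHor φ => rw [Omega.parity_ofHor_mul, Omega.parity_ofHor]
  | ι ϑ => rw [Omega.parity_ι_mul, Omega.parity_ofPsi, PsiExt.parity_ι, map_neg, neg_mul]
  | mul x x' hx hx' => rw [mul_assoc, hx, hx', hx, mul_assoc]
  | add x x' hx hx' => simp only [add_mul, map_add, hx, hx']

theorem diff_ofHor_mul_ofPsi (D : Preconnection τ.toFrameStructure) (φ : Hor B n) (η : PsiExt τ) :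
    diff D (Omega.ofHor τ φ * Omega.ofPsi τ η) = diff D (Omega.ofHor τ φ) * Omega.ofPsi τ η +
      Omega.ofHor τ (horParity B n φ) * diff D (Omega.ofPsi τ η) := by
  rw [Omega.ofHor_mul_ofPsi, diff_tmul, diff_ofHor, diff_ofPsi]

theorem diff_mul_ofPsi (D : Preconnection τ.toFrameStructure) (x : Omega τ) (η : PsiExt τ) :
    diff D (x * Omega.ofPsi τ η) = diff D x * Omega.ofPsi τ η +
      Omega.parityLin τ x * diff D (Omega.ofPsi τ η) := by
  induction x using Omega.induction_on with
  | zero => simp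
  | add x y hx hy => simp only [add_mul, map_add, hx, hy]; abel
  | tmul φ ζ =>
    rw [← Omega.ofHor_mul_ofPsi, mul_assoc, ← map_mul, diff_ofHor_mul_ofPsi, diff_ofHor_mul_ofPsi,
      Omega.parity_ofHor_mul, Omega.parity_ofPsi, diff_ofPsi, diff_ofPsi, diff_ofPsi, diffPsi_mul,
      map_mul]
    noncomm_ring

theorem PsiExt.π_mul (a c : Pol G) : PsiExt.π τ (a * c) =
    PsiExt.ι τ (c • PsiInv.π τ a) + Coalgebra.counit (R := ℂ) a • PsiExt.π τ c := by
  rw [PsiInv.smul_π, map_sub, map_smul]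
  simp [PsiExt.π]

theorem ofCoact_π_mul (x : Hor B n ⊗[ℂ] Pol G) (ψ : Hor B n) :
    Omega.ofCoact (PsiExt.π τ) (x * coactHor P u (horParity B n ψ)) =
      Omega.ofCoact (PsiExt.π τ) x * Omega.ofHor τ ψ +
        Omega.ofHor τ (slice _ 1 x) * Omega.ofCoact (PsiExt.π τ) (coactHor P u (horParity B n ψ)) := by
  induction x using TensorProduct.induction_on with
  | zero => simp
  | add x y hx hy => simp only [add_mul, map_add, hx, hy]; abel
  | tmul φ a =>
    rw [Omega.ofCoact_tmul, ← Omega.ofHor_mul_ofPsi, mul_assoc, Omega.ofHor_apply ψ, PsiExt.π,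
      LinearMap.comp_apply, Omega.ι_mul_tmul]
    generalize coactHor P u (horParity B n ψ) = w
    induction w using TensorProduct.induction_on with
    | zero => simp
    | add x y hx hy => simp only [mul_add, map_add] at hx hy ⊢; rw [hx, hy]; abel
    | tmul v c =>
      rw [Algebra.TensorProduct.tmul_mul_tmul]
      change Omega.ofCoact (PsiExt.π τ) _ = _ + _ * Omega.ofCoact (PsiExt.π τ) _
      simp only [Omega.ofCoact_tmul, PsiExt.actMul_apply, mul_one,
        Omega.ofHor_mul_tmul, slice_tmul, smul_mul_assoc, PsiExt.π_mul, Omega.tmul_add,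
        Omega.tmul_smul, Omega.smul_tmul, counit_eq]

theorem diff_ofHor_mul_ofHor (D : Preconnection τ.toFrameStructure) (φ ψ : Hor B n) :
    diff D (Omega.ofHor τ φ * Omega.ofHor τ ψ) = diff D (Omega.ofHor τ φ) * Omega.ofHor τ ψ +
      Omega.ofHor τ (horParity B n φ) * diff D (Omega.ofHor τ ψ) := by
  rw [← map_mul, diff_ofHor, diff_ofHor, diff_ofHor, diffHor_apply, diffHor_apply, diffHor_apply,
    D.leibniz', map_mul (horParity B n), map_mul (coactHor P u), ofCoact_π_mul, slice_coactHor,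
    act_one, map_add, map_mul, map_mul]
  noncomm_ring

theorem diff_ofHor_mul (D : Preconnection τ.toFrameStructure) (φ : Hor B n) (x : Omega τ) :
    diff D (Omega.ofHor τ φ * x) = diff D (Omega.ofHor τ φ) * x +
      Omega.ofHor τ (horParity B n φ) * diff D x := by
  induction x using Omega.induction_on with
  | zero => simp
  | add x y hx hy => simp only [mul_add, map_add, hx, hy]; abel
  | tmul ψ η =>
    rw [← Omega.ofHor_mul_ofPsi, ← mul_assoc, diff_mul_ofPsi, diff_ofHor_mul_ofHor,
      diff_mul_ofPsi, Omega.parity_mul, Omega.parity_ofHor, Omega.parity_ofHor]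
    noncomm_ring

/-- The identity in `Ψ_inv^∧` behind the compatibility of `d` with the module structure. -/
theorem PsiExt.d_smul (a c : Pol G) :
    conv (PsiExt.π τ) (PsiExt.actMul τ (PsiInv.π τ a) 1) c + PsiInv.d τ (c • PsiInv.π τ a) =
      - actPi2 τ (Coalgebra.comul (R := ℂ) a ⊗ₜ Coalgebra.comul (R := ℂ) c) -
        conv (PsiExt.actMul τ (PsiInv.π τ a) 1) (PsiExt.π τ) c := by
  have e : ∀ x, convSq (PsiExt.π τ) x = pi2 τ (Coalgebra.comul (R := ℂ) x) := fun x => rfl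
  have h1 : ∀ z : Pol G ⊗[ℂ] Pol G, LinearMap.mul' ℂ _ (TensorProduct.map (PsiExt.π τ)
      (PsiExt.actMul τ (PsiInv.π τ a) 1) z) =
      pi2 τ ((1 ⊗ₜ a) * z) - Coalgebra.counit (R := ℂ) a • pi2 τ z := by
    intro z
    induction z using TensorProduct.induction_on with
    | zero => simp
    | add x y hx hy => simp only [mul_add, map_add, smul_add, hx, hy]; abel
    | tmul x y =>
      rw [TensorProduct.map_tmul, LinearMap.mul'_apply, PsiExt.actMul_apply, mul_one,
        Algebra.TensorProduct.tmul_mul_tmul, one_mul, pi2_tmul, pi2_tmul, PsiInv.smul_π, map_sub,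
        map_smul, mul_sub, mul_smul_comm]
      rfl
  have h2 : ∀ z : Pol G ⊗[ℂ] Pol G, LinearMap.mul' ℂ _ (TensorProduct.map
      (PsiExt.actMul τ (PsiInv.π τ a) 1) (PsiExt.π τ) z) =
      pi2 τ ((a ⊗ₜ 1) * z) - Coalgebra.counit (R := ℂ) a • pi2 τ z := by
    intro z
    induction z using TensorProduct.induction_on with
    | zero => simp
    | add x y hx hy => simp only [mul_add, map_add, smul_add, hx, hy]; abel
    | tmul x y =>
      rw [TensorProduct.map_tmul, LinearMap.mul'_apply, PsiExt.actMul_apply, mul_one,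
        Algebra.TensorProduct.tmul_mul_tmul, one_mul, pi2_tmul, pi2_tmul, PsiInv.smul_π, map_sub,
        map_smul, sub_mul, smul_mul_assoc]
      rfl
  simp only [conv, LinearMap.comp_apply]
  rw [h1, h2, PsiInv.smul_π, map_sub, map_smul, PsiInv.d_π, PsiInv.d_π, actPi2_comul, e, e]
  module

theorem ofCoact_mul_ofPsi (f g : Pol G →ₗ[ℂ] PsiExt τ) (φ : Hor B n) :
    LinearMap.mul' ℂ _ (TensorProduct.map (Omega.ofCoact g ∘ₗ (coactHor P u).toLinearMap)
      ((Omega.ofPsi τ).toLinearMap ∘ₗ f) (coactHor P u φ)) =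
      Omega.ofCoact (conv g f) (coactHor P u φ) := by
  rw [conv, ← LinearMap.comp_assoc, Omega.ofCoact_comp, ← coactHor_coassoc]
  generalize coactHor P u φ = x
  induction x using TensorProduct.induction_on with
  | zero => simp
  | add x y hx hy => simp only [map_add, hx, hy]
  | tmul ψ c =>
    rw [LinearMap.rTensor_tmul, TensorProduct.map_tmul]
    simp only [LinearMap.comp_apply, AlgHom.toLinearMap_apply, LinearMap.mul'_apply]
    generalize coactHor P u ψ = y
    induction y using TensorProduct.induction_on with
    | zero => simp
    | add x y hx hy => simp only [map_add, add_mul, TensorProduct.add_tmul, hx, hy]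
    | tmul χ d =>
      rw [Omega.ofCoact_tmul, Omega.tmul_mul_ofPsi]
      rfl

theorem diff_ofCoact (D : Preconnection τ.toFrameStructure) (f : Pol G →ₗ[ℂ] PsiInv τ)
    (φ : Hor B n) :
    diff D (Omega.ofCoact (PsiExt.ι τ ∘ₗ f) (coactHor P u (horParity B n φ))) =
      Omega.ofCoact (PsiExt.ι τ ∘ₗ f) (coactHor P u (D.D (horParity B n φ))) +
      Omega.ofCoact (conv (PsiExt.π τ) (PsiExt.ι τ ∘ₗ f)) (coactHor P u φ) +
      Omega.ofHor τ (contract (curvatureInv D ∘ₗ f) (coactHor P u φ)) +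
      Omega.ofCoact (PsiInv.d τ ∘ₗ f) (coactHor P u φ) := by
  rw [D.covariant, ← ofCoact_mul_ofPsi, coactHor_horParity]
  generalize coactHor P u φ = x
  induction x using TensorProduct.induction_on with
  | zero => simp
  | add x y hx hy => simp only [map_add, hx, hy]; abel
  | tmul v c =>
    simp only [LinearMap.rTensor_tmul, Omega.ofCoact_tmul, diff_tmul, AlgHom.toLinearMap_apply,
      horParity_horParity, diffHor_apply, LinearMap.comp_apply, diffPsi_ι, diffPsiInv,
      LinearMap.add_apply, TensorProduct.map_tmul, LinearMap.mul'_apply, add_mul, mul_add,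
      Omega.ofHor_mul_ofPsi, contract, LinearMap.lTensor_tmul, map_mul]
    abel

theorem pi2_mul_ofHor (z : Pol G ⊗[ℂ] Pol G) (φ : Hor B n) :
    Omega.ofPsi τ (pi2 τ z) * Omega.ofHor τ φ =
      Omega.ofCoact (actPi2 τ ∘ₗ TensorProduct.mk ℂ _ _ z ∘ₗ Coalgebra.comul)
        (coactHor P u φ) := by
  induction z using TensorProduct.induction_on with
  | zero => simp
  | add x y hx hy =>
    rw [map_add, map_add, add_mul, hx, hy, map_add, LinearMap.add_comp,
      LinearMap.comp_add, map_add, LinearMap.add_apply]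
  | tmul a a' =>
    rw [pi2_tmul, map_mul, mul_assoc, Omega.ofHor_apply, Omega.ι_mul_tmul, Omega.ofPsi_ι_mul,
      Omega.mulPsiInv_ofCoact]
    congr 2
    have : ∀ y : Pol G ⊗[ℂ] Pol G, LinearMap.mul' ℂ _ (TensorProduct.map
        (PsiExt.actMul τ (PsiInv.π τ a) 1) (PsiExt.actMul τ (PsiInv.π τ a') 1) y) =
        actPi2 τ ((a ⊗ₜ a') ⊗ₜ y) := by
      intro y
      induction y using TensorProduct.induction_on with
      | zero => simp
      | add x y hx hy => simp only [map_add, TensorProduct.tmul_add, hx, hy]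
      | tmul c c' =>
        simp only [TensorProduct.map_tmul, PsiExt.actMul_apply, actPi2_tmul,
          LinearMap.mul'_apply, mul_one]
    ext c
    exact this _

theorem diff_ι (D : Preconnection τ.toFrameStructure) (a : Pol G) :
    diff D (Omega.ofPsi τ (PsiExt.ι τ (PsiInv.π τ a))) = Omega.ofHor τ (curvature D a) -
      Omega.ofPsi τ (pi2 τ (Coalgebra.comul (R := ℂ) a)) := by
  rw [diff_ofPsi, diffPsi_ι, diffPsiInv, LinearMap.add_apply, LinearMap.comp_apply,
    LinearMap.comp_apply, curvatureInv_π, PsiInv.d_π, map_neg, ← sub_eq_add_neg]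
  rfl

theorem diff_ι_mul_ofHor (D : Preconnection τ.toFrameStructure) (ϑ : PsiInv τ) (φ : Hor B n) :
    diff D (Omega.ofPsi τ (PsiExt.ι τ ϑ) * Omega.ofHor τ φ) =
      diff D (Omega.ofPsi τ (PsiExt.ι τ ϑ)) * Omega.ofHor τ φ -
        Omega.ofPsi τ (PsiExt.ι τ ϑ) * diff D (Omega.ofHor τ φ) := by
  obtain ⟨a, rfl⟩ := PsiInv.π_surjective τ ϑ
  have hf : PsiExt.actMul τ (PsiInv.π τ a) 1 = PsiExt.ι τ ∘ₗ
      (LinearMap.toSpanSingleton (Pol G) _ (PsiInv.π τ a)).restrictScalars ℂ := by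
    ext c
    rw [PsiExt.actMul_apply, mul_one]; rfl
  have hc : contract (curvatureInv D ∘ₗ
      (LinearMap.toSpanSingleton (Pol G) _ (PsiInv.π τ a)).restrictScalars ℂ) (coactHor P u φ) =
      curvature D a * φ := by
    have h1 := contract_mul (curvature D) φ (fun b => curvature_deriv D (inclB B n b) φ) a
    rw [← sub_eq_iff_eq_add] at h1
    rw [← h1]
    generalize coactHor P u φ = x
    induction x using TensorProduct.induction_on with
    | zero => simp
    | add x y hx hy => simp only [map_add, mul_add, smul_add, hx, hy]; abel
    | tmul v c =>
      simp [contract, PsiInv.smul_π, curvatureInv_π, mul_sub]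
  rw [diff_ι, diff_ofHor, diffHor_apply, sub_mul, pi2_mul_ofHor, mul_add, ← map_mul,
    Omega.ofPsi_ι_mul _ (Omega.ofCoact _ _), Omega.mulPsiInv_ofCoact, Omega.ofHor_apply (D.D φ),
    Omega.ι_mul_tmul, Omega.ofHor_apply φ, Omega.ι_mul_tmul]
  nth_rw 1 [hf]
  rw [diff_ofCoact, hc, ← hf, D.parity, map_neg, map_neg]
  have hd : conv (PsiExt.π τ) (PsiExt.actMul τ (PsiInv.π τ a) 1) + PsiInv.d τ ∘ₗ
      (LinearMap.toSpanSingleton (Pol G) _ (PsiInv.π τ a)).restrictScalars ℂ =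
      -(actPi2 τ ∘ₗ TensorProduct.mk ℂ _ _ (Coalgebra.comul (R := ℂ) a) ∘ₗ Coalgebra.comul) -
        conv (PsiExt.actMul τ (PsiInv.π τ a) 1) (PsiExt.π τ) := by
    ext c
    exact PsiExt.d_smul a c
  have hd2 := congrArg (fun f => Omega.ofCoact f (coactHor P u φ)) hd
  simp only [map_add, map_sub, map_neg, LinearMap.add_apply, LinearMap.sub_apply,
    LinearMap.neg_apply] at hd2
  rw [← eq_sub_iff_add_eq] at hd2
  rw [hd2]
  change _ = _ - (_ + Omega.ofCoact (conv (PsiExt.actMul τ (PsiInv.π τ a) 1) (PsiExt.π τ))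
    (coactHor P u φ))
  abel

theorem diff_ι_mul (D : Preconnection τ.toFrameStructure) (ϑ : PsiInv τ) (x : Omega τ) :
    diff D (Omega.ofPsi τ (PsiExt.ι τ ϑ) * x) =
      diff D (Omega.ofPsi τ (PsiExt.ι τ ϑ)) * x - Omega.ofPsi τ (PsiExt.ι τ ϑ) * diff D x := by
  induction x using Omega.induction_on with
  | zero => simp
  | add x y hx hy => simp only [mul_add, map_add, hx, hy]; abel
  | tmul ψ η =>
    rw [← Omega.ofHor_mul_ofPsi, ← mul_assoc, diff_mul_ofPsi, diff_ι_mul_ofHor, diff_mul_ofPsi,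
      Omega.parity_ι_mul, Omega.parity_ofHor]
    noncomm_ring

/-- The graded Leibniz rule. -/
theorem diff_mul (D : Preconnection τ.toFrameStructure) (x y : Omega τ) :
    diff D (x * y) = diff D x * y + Omega.parityLin τ x * diff D y := by
  induction x using Omega.induction_mul generalizing y with
  | ofHor φ => rw [diff_ofHor_mul, Omega.parity_ofHor]
  | ι ϑ =>
    rw [diff_ι_mul, Omega.parity_ofPsi, PsiExt.parity_ι, map_neg, neg_mul, sub_eq_add_neg]
  | mul x x' hx hx' =>
    rw [mul_assoc, hx, hx', hx, Omega.parity_mul]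
    noncomm_ring
  | add x x' hx hx' => simp only [add_mul, map_add, hx, hx']; abel

theorem Omega.parity_parity (x : Omega τ) : Omega.parityLin τ (Omega.parityLin τ x) = x := by
  induction x using Omega.induction_mul with
  | ofHor φ => rw [Omega.parity_ofHor, Omega.parity_ofHor, horParity_horParity]
  | ι ϑ =>
    rw [Omega.parity_ofPsi, Omega.parity_ofPsi, PsiExt.parity_ι, map_neg, PsiExt.parity_ι, neg_neg]
  | mul x y hx hy => rw [Omega.parity_mul, Omega.parity_mul, hx, hy]
  | add x y hx hy => rw [map_add, map_add, hx, hy]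

theorem diff_parity (D : Preconnection τ.toFrameStructure) (x : Omega τ) :
    diff D (Omega.parityLin τ x) = - Omega.parityLin τ (diff D x) := by
  induction x using Omega.induction_mul with
  | ofHor φ =>
    rw [Omega.parity_ofHor, diff_ofHor, diff_ofHor, diffHor_apply, diffHor_apply, D.parity,
      horParity_horParity, map_add, Omega.parity_ofHor, map_neg, coactHor_horParity]
    generalize coactHor P u φ = w
    have : Omega.parityLin τ (Omega.ofCoact (PsiExt.π τ)
        ((horParity B n).toLinearMap.rTensor (Pol G) w)) = - Omega.ofCoact (PsiExt.π τ) w := by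
      induction w using TensorProduct.induction_on with
      | zero => simp
      | add x y hx hy => simp only [map_add, hx, hy, neg_add]
      | tmul v c =>
        rw [LinearMap.rTensor_tmul, Omega.ofCoact_tmul, Omega.parityLin_tmul,
          AlgHom.toLinearMap_apply, horParity_horParity, PsiExt.π, LinearMap.comp_apply,
          PsiExt.parity_ι, Omega.ofCoact_tmul, ← neg_one_smul ℂ (PsiExt.ι τ _), Omega.tmul_smul,
          neg_one_smul]
        rfl
    rw [this]
    abel
  | ι ϑ =>
    obtain ⟨a, rfl⟩ := PsiInv.π_surjective τ ϑ
    rw [Omega.parity_ofPsi, PsiExt.parity_ι, map_neg, map_neg, diff_ι, map_sub,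
      Omega.parity_ofHor, Omega.parity_ofPsi, horParity_curvature]
    have : ∀ z : Pol G ⊗[ℂ] Pol G, PsiExt.parity τ (pi2 τ z) = pi2 τ z := by
      intro z
      induction z using TensorProduct.induction_on with
      | zero => simp
      | add x y hx hy => rw [map_add, map_add, hx, hy]
      | tmul x y => rw [pi2_tmul, map_mul, PsiExt.parity_ι, PsiExt.parity_ι, neg_mul_neg]
    rw [this]
  | mul x y hx hy =>
    rw [Omega.parity_mul, diff_mul, diff_mul, hx, hy, map_add, Omega.parity_mul, Omega.parity_mul]
    noncomm_ring
  | add x y hx hy => rw [map_add, map_add, hx, hy, map_add, map_add]; abel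

/-- `∂_D² = 0`. -/
theorem diff_diff (D : Preconnection τ.toFrameStructure) (x : Omega τ) : diff D (diff D x) = 0 := by
  induction x using Omega.induction_mul with
  | ofHor φ =>
    have h := diff_ofCoact D (PsiInv.π τ) φ
    have hc : curvatureInv D ∘ₗ PsiInv.π τ = curvature D := by
      ext a; exact curvatureInv_π D a
    have hd : PsiInv.d τ ∘ₗ PsiInv.π τ = - conv (PsiExt.π τ) (PsiExt.π τ) := by
      ext a; exact PsiInv.d_π a
    rw [hc, hd] at h
    rw [diff_ofHor, diffHor_apply, map_add]
    refine (congrArg (_ + ·) h).trans ?_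
    rw [diff_ofHor, diffHor_apply, curvature_spec, D.parity, map_neg, map_neg, map_neg, map_neg,
      LinearMap.neg_apply]
    change _ + Omega.ofCoact (PsiExt.π τ) _ + (-Omega.ofCoact (PsiExt.π τ) _ +
      Omega.ofCoact (conv (PsiExt.π τ) (PsiExt.π τ)) _ + _ + _) = 0
    abel
  | ι ϑ =>
    obtain ⟨a, rfl⟩ := PsiInv.π_surjective τ ϑ
    have h := conv_diffPsiInv D a
    have h2 : ∀ z : Pol G ⊗[ℂ] Pol G, diff D (Omega.ofPsi τ (pi2 τ z)) =
        LinearMap.mul' ℂ _ (TensorProduct.map (diffPsiInv D ∘ₗ PsiInv.π τ)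
          ((Omega.ofPsi τ).toLinearMap ∘ₗ PsiExt.π τ) z) -
        LinearMap.mul' ℂ _ (TensorProduct.map ((Omega.ofPsi τ).toLinearMap ∘ₗ PsiExt.π τ)
          (diffPsiInv D ∘ₗ PsiInv.π τ) z) := by
      intro z
      induction z using TensorProduct.induction_on with
      | zero => simp
      | add x y hx hy => simp only [map_add, hx, hy]; abel
      | tmul x y =>
        rw [pi2_tmul, map_mul, diff_ι_mul, diff_ofPsi, diff_ofPsi, diffPsi_ι, diffPsi_ι]
        rfl
    have h3 := h2 (Coalgebra.comul (R := ℂ) a)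
    simp only [conv, LinearMap.comp_apply] at h
    rw [h, add_sub_cancel_left] at h3
    rw [diff_ι, map_sub, h3, diff_ofHor, diffHor_apply, D_curvature, horParity_curvature]
    simp
  | mul x y hx hy =>
    rw [diff_mul, map_add, diff_mul, diff_mul, hx, hy, diff_parity]
    simp
  | add x y hx hy => rw [map_add, map_add, hx, hy, add_zero]

end Leibniz

section Grading

set_option linter.unusedSectionVars false

variable {m n : ℕ} {G : Subgroup (GL (Fin m) ℂ)} [CompactSpace G] {B : Type*} [Ring B]
  [Algebra ℂ B] [StarRing B] [StarModule ℂ B] {P : QuantumPrincipalBundle G B}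
  {u : RealUnitaryRep G n} {τ : IntegrableFrameStructure P u}

/-- The degree `q` part of `Ψ_inv^∧`. -/
def PsiExt.deg (τ : IntegrableFrameStructure P u) (q : ℕ) : Submodule ℂ (PsiExt τ) :=
  LinearMap.range (PsiExt.ι τ) ^ q

/-- The degree `k` part of `vh_P`: the span of all `φ ⊗ η` with `∂φ + ∂η = k`. -/
def Omega.deg (τ : IntegrableFrameStructure P u) (k : ℕ) : Submodule ℂ (Omega τ) :=
  Submodule.span ℂ {x | ∃ p q, p + q = k ∧ ∃ φ ∈ horDeg B n p, ∃ η ∈ PsiExt.deg τ q,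
    x = Omega.tmul φ η}

theorem Omega.tmul_mem {p q k : ℕ} {φ : Hor B n} {η : PsiExt τ} (hφ : φ ∈ horDeg B n p)
    (hη : η ∈ PsiExt.deg τ q) (h : p + q = k) : Omega.tmul φ η ∈ Omega.deg τ k :=
  Submodule.subset_span ⟨p, q, h, φ, hφ, η, hη, rfl⟩

theorem horDeg_eq (p : ℕ) : horDeg B n p =
    Submodule.span ℂ {x | ∃ b : B, ∃ ω ∈ ⋀[ℂ]^p (Fin n → ℂ), x = b ⊗ₜ[ℂ] ω} := by
  apply le_antisymm
  · rintro _ ⟨x, rfl⟩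
    induction x using TensorProduct.induction_on with
    | zero => simp
    | add x y hx hy => rw [map_add]; exact add_mem hx hy
    | tmul b ω => exact Submodule.subset_span ⟨b, ω.1, ω.2, rfl⟩
  · rw [Submodule.span_le]
    rintro _ ⟨b, ω, hω, rfl⟩
    exact ⟨b ⊗ₜ ⟨ω, hω⟩, rfl⟩

theorem horDeg_mul {p q : ℕ} {φ ψ : Hor B n} (hφ : φ ∈ horDeg B n p) (hψ : ψ ∈ horDeg B n q) :
    φ * ψ ∈ horDeg B n (p + q) := by
  rw [horDeg_eq] at *
  have h := Submodule.mul_mem_mul hφ hψ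
  rw [Submodule.span_mul_span] at h
  refine Submodule.span_mono ?_ h
  rintro _ ⟨_, ⟨b, ω, hω, rfl⟩, _, ⟨c, η, hη, rfl⟩, rfl⟩
  refine ⟨b * c, ω * η, ?_, Algebra.TensorProduct.tmul_mul_tmul _ _ _ _⟩
  rw [ExteriorAlgebra.exteriorPower, pow_add]
  exact Submodule.mul_mem_mul hω hη

theorem one_mem_horDeg : (1 : Hor B n) ∈ horDeg B n 0 := by
  rw [← map_one (inclB B n)]; exact inclB_mem_horDeg 1

/-- The tensors whose first factors are of degree `p`. -/
def horDegPol (G : Subgroup (GL (Fin m) ℂ)) (B : Type*) [Ring B] [Algebra ℂ B] (n p : ℕ) :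
    Submodule ℂ (Hor B n ⊗[ℂ] Pol G) :=
  Submodule.span ℂ {x | ∃ φ ∈ horDeg B n p, ∃ a : Pol G, x = φ ⊗ₜ[ℂ] a}

theorem horParity_mem {p : ℕ} {φ : Hor B n} (hφ : φ ∈ horDeg B n p) :
    horParity B n φ ∈ horDeg B n p := by
  rw [horParity_of_mem hφ]
  exact Submodule.smul_mem _ _ hφ

theorem coactExt_mem {p : ℕ} {ω : Ext n} (hω : ω ∈ ⋀[ℂ]^p (Fin n → ℂ)) : u.coactExt ω ∈
    Submodule.span ℂ {x | ∃ η ∈ ⋀[ℂ]^p (Fin n → ℂ), ∃ a : Pol G, x = η ⊗ₜ[ℂ] a} := by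
  induction hω using Submodule.pow_induction_on_left' with
  | algebraMap r =>
    rw [AlgHom.commutes]
    exact Submodule.subset_span ⟨algebraMap ℂ _ r, by simp [ExteriorAlgebra.exteriorPower], 1, rfl⟩
  | add x y i _ _ hx hy => rw [map_add]; exact add_mem hx hy
  | mem_mul v hv i x _ hx =>
    obtain ⟨v, rfl⟩ := hv
    have h1 : u.coactExt (ExteriorAlgebra.ι ℂ v) ∈ Submodule.span ℂ
        {x | ∃ w : Fin n → ℂ, ∃ a : Pol G, x = ExteriorAlgebra.ι ℂ w ⊗ₜ[ℂ] a} := by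
      rw [RealUnitaryRep.coactExt, ExteriorAlgebra.lift_ι_apply, LinearMap.comp_apply]
      generalize u.coact v = y
      induction y using TensorProduct.induction_on with
      | zero => simp
      | add x y hx hy => rw [map_add]; exact add_mem hx hy
      | tmul w a => exact Submodule.subset_span ⟨w, a, rfl⟩
    have h := Submodule.mul_mem_mul h1 hx
    rw [Submodule.span_mul_span] at h
    rw [map_mul]
    refine Submodule.span_mono ?_ h
    rintro _ ⟨_, ⟨w, a, rfl⟩, _, ⟨η, hη, c, rfl⟩, rfl⟩
    refine ⟨ExteriorAlgebra.ι ℂ w * η, ?_, a * c, Algebra.TensorProduct.tmul_mul_tmul _ _ _ _⟩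
    rw [ExteriorAlgebra.exteriorPower, Nat.succ_eq_add_one, pow_succ']
    exact Submodule.mul_mem_mul ⟨w, rfl⟩ hη

theorem coactHor_mem {p : ℕ} {φ : Hor B n} (hφ : φ ∈ horDeg B n p) :
    coactHor P u φ ∈ horDegPol G B n p := by
  rw [horDeg_eq] at hφ
  induction hφ using Submodule.span_induction with
  | zero => simp
  | add x y _ _ hx hy => rw [map_add]; exact add_mem hx hy
  | smul c x _ hx => rw [map_smul]; exact Submodule.smul_mem _ _ hx
  | mem x hx =>
    obtain ⟨b, ω, hω, rfl⟩ := hx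
    have h1 := coactExt_mem (u := u) hω
    change (Algebra.TensorProduct.map (AlgHom.id ℂ (Hor B n)) (Algebra.TensorProduct.lmul' ℂ))
      (Algebra.TensorProduct.tensorTensorTensorComm ℂ ℂ ℂ ℂ B (Pol G) (Ext n) (Pol G)
        (P.F b ⊗ₜ u.coactExt ω)) ∈ _
    generalize P.F b = y
    generalize u.coactExt ω = w at h1 ⊢
    induction h1 using Submodule.span_induction with
    | zero => simp
    | add x y _ _ hx hy => rw [TensorProduct.tmul_add, map_add, map_add]; exact add_mem hx hy
    | smul c x _ hx =>
      rw [TensorProduct.tmul_smul, map_smul, map_smul]; exact Submodule.smul_mem _ _ hx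
    | mem x hx =>
      obtain ⟨η, hη, a, rfl⟩ := hx
      induction y using TensorProduct.induction_on with
      | zero => simp
      | add x y hx hy => rw [TensorProduct.add_tmul, map_add, map_add]; exact add_mem hx hy
      | tmul c d =>
        refine Submodule.subset_span ⟨c ⊗ₜ η, ⟨c ⊗ₜ ⟨η, hη⟩, rfl⟩, d * a, ?_⟩
        simp

theorem Omega.ofCoact_mem {p q k : ℕ} {f : Pol G →ₗ[ℂ] PsiExt τ} (hf : ∀ c, f c ∈ PsiExt.deg τ q)
    {x : Hor B n ⊗[ℂ] Pol G} (hx : x ∈ horDegPol G B n p) (h : p + q = k) :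
    Omega.ofCoact f x ∈ Omega.deg τ k := by
  induction hx using Submodule.span_induction with
  | zero => simp
  | add x y _ _ hx hy => rw [map_add]; exact add_mem hx hy
  | smul c x _ hx => rw [map_smul]; exact Submodule.smul_mem _ _ hx
  | mem x hx =>
    obtain ⟨φ, hφ, a, rfl⟩ := hx
    exact Omega.tmul_mem hφ (hf a) h

theorem PsiExt.ι_mem (ϑ : PsiInv τ) : PsiExt.ι τ ϑ ∈ PsiExt.deg τ 1 := by
  rw [PsiExt.deg, pow_one]; exact ⟨ϑ, rfl⟩

theorem PsiExt.one_mem : (1 : PsiExt τ) ∈ PsiExt.deg τ 0 := by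
  rw [PsiExt.deg, pow_zero]; exact Submodule.one_le.1 le_rfl

theorem PsiExt.mul_mem {p q : ℕ} {η ζ : PsiExt τ} (hη : η ∈ PsiExt.deg τ p)
    (hζ : ζ ∈ PsiExt.deg τ q) : η * ζ ∈ PsiExt.deg τ (p + q) := by
  rw [PsiExt.deg, pow_add]
  exact Submodule.mul_mem_mul hη hζ

theorem Omega.ofHor_mem {p : ℕ} {φ : Hor B n} (h : φ ∈ horDeg B n p) :
    Omega.ofHor τ φ ∈ Omega.deg τ p := Omega.tmul_mem h PsiExt.one_mem (add_zero p)

theorem Omega.ofPsi_mem {q : ℕ} {η : PsiExt τ} (h : η ∈ PsiExt.deg τ q) :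
    Omega.ofPsi τ η ∈ Omega.deg τ q := Omega.tmul_mem one_mem_horDeg h (zero_add q)

theorem Omega.ofHor_mul_mem {p k : ℕ} {φ : Hor B n} (h : φ ∈ horDeg B n p) {x : Omega τ}
    (hx : x ∈ Omega.deg τ k) : Omega.ofHor τ φ * x ∈ Omega.deg τ (p + k) := by
  induction hx using Submodule.span_induction with
  | zero => simp
  | add x y _ _ hx hy => rw [mul_add]; exact add_mem hx hy
  | smul c x _ hx => rw [mul_smul_comm]; exact Submodule.smul_mem _ _ hx
  | mem x hx =>
    obtain ⟨p', q, rfl, ψ, hψ, η, hη, rfl⟩ := hx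
    rw [Omega.ofHor_mul_tmul]
    exact Omega.tmul_mem (horDeg_mul h hψ) hη (add_assoc _ _ _)

theorem Omega.ι_mul_mem {k : ℕ} (ϑ : PsiInv τ) {x : Omega τ} (hx : x ∈ Omega.deg τ k) :
    Omega.ofPsi τ (PsiExt.ι τ ϑ) * x ∈ Omega.deg τ (k + 1) := by
  induction hx using Submodule.span_induction with
  | zero => simp
  | add x y _ _ hx hy => rw [mul_add]; exact add_mem hx hy
  | smul c x _ hx => rw [mul_smul_comm]; exact Submodule.smul_mem _ _ hx
  | mem x hx =>
    obtain ⟨p, q, rfl, ψ, hψ, η, hη, rfl⟩ := hx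
    rw [Omega.ι_mul_tmul]
    refine Omega.ofCoact_mem (q := 1 + q) (fun c => ?_) (coactHor_mem (horParity_mem hψ)) (by ring)
    rw [PsiExt.actMul_apply]
    exact PsiExt.mul_mem (PsiExt.ι_mem _) hη

theorem Omega.ofPsi_mul_mem {q k : ℕ} {η : PsiExt τ} (h : η ∈ PsiExt.deg τ q) {x : Omega τ}
    (hx : x ∈ Omega.deg τ k) : Omega.ofPsi τ η * x ∈ Omega.deg τ (q + k) := by
  induction h using Submodule.pow_induction_on_left' with
  | algebraMap r =>
    rw [AlgHom.commutes, ← Algebra.smul_def, zero_add]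
    exact Submodule.smul_mem _ _ hx
  | add η ζ i _ _ hη hζ => rw [map_add, add_mul]; exact add_mem hη hζ
  | mem_mul v hv i y _ hy =>
    obtain ⟨ϑ, rfl⟩ := hv
    rw [map_mul, mul_assoc, Nat.succ_eq_add_one, add_right_comm]
    exact Omega.ι_mul_mem ϑ hy

theorem Omega.mul_mem_deg {j k : ℕ} {x y : Omega τ} (hx : x ∈ Omega.deg τ j)
    (hy : y ∈ Omega.deg τ k) : x * y ∈ Omega.deg τ (j + k) := by
  induction hx using Submodule.span_induction with
  | zero => simp
  | add x y _ _ hx hy => rw [add_mul]; exact add_mem hx hy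
  | smul c x _ hx => rw [smul_mul_assoc]; exact Submodule.smul_mem _ _ hx
  | mem x hx =>
    obtain ⟨p, q, rfl, ψ, hψ, η, hη, rfl⟩ := hx
    rw [← Omega.ofHor_mul_ofPsi, mul_assoc, add_assoc]
    exact Omega.ofHor_mul_mem hψ (Omega.ofPsi_mul_mem hη hy)

theorem curvature_mem (D : Preconnection τ.toFrameStructure) (a : Pol G) :
    curvature D a ∈ horDeg B n 2 := by
  obtain ⟨N, q, b, hqb⟩ := exists_free (P := P) (u := u) a
  have e : curvature D a = ∑ k, inclB B n (q k) *
      contract (curvature D) (coactHor P u (inclB B n (b k))) := by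
    have : curvature D a = contract (curvature D) (1 ⊗ₜ a) := by simp [contract]
    rw [this, ← hqb, map_sum]
    exact Finset.sum_congr rfl fun k _ => contract_mul_tmul_one _ _ _
  rw [e]
  refine sum_mem fun k _ => ?_
  have h := curvature_spec D (inclB B n (b k))
  rw [eq_comm, neg_eq_iff_eq_neg] at h
  rw [h, ← zero_add 2]
  exact horDeg_mul (inclB_mem_horDeg _)
    (neg_mem (D.degree _ _ (D.degree _ _ (inclB_mem_horDeg _))))

theorem diff_ι_mem (D : Preconnection τ.toFrameStructure) (ϑ : PsiInv τ) :
    diff D (Omega.ofPsi τ (PsiExt.ι τ ϑ)) ∈ Omega.deg τ 2 := by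
  obtain ⟨a, rfl⟩ := PsiInv.π_surjective τ ϑ
  rw [diff_ι]
  refine sub_mem (Omega.ofHor_mem (curvature_mem D a)) (Omega.ofPsi_mem ?_)
  generalize Coalgebra.comul (R := ℂ) a = z
  induction z using TensorProduct.induction_on with
  | zero => simp
  | add x y hx hy => rw [map_add]; exact add_mem hx hy
  | tmul x y => rw [pi2_tmul]; exact PsiExt.mul_mem (PsiExt.ι_mem _) (PsiExt.ι_mem _)

theorem diffPsi_mem (D : Preconnection τ.toFrameStructure) {q : ℕ} {η : PsiExt τ}
    (h : η ∈ PsiExt.deg τ q) : diff D (Omega.ofPsi τ η) ∈ Omega.deg τ (q + 1) := by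
  induction h using Submodule.pow_induction_on_left' with
  | algebraMap r =>
    rw [Algebra.algebraMap_eq_smul_one, map_smul, map_smul, diff_ofPsi, diffPsi_one, smul_zero]
    exact zero_mem _
  | add η ζ i _ _ hη hζ => rw [map_add, map_add]; exact add_mem hη hζ
  | mem_mul v hv i y hy' hy =>
    obtain ⟨ϑ, rfl⟩ := hv
    rw [map_mul, diff_ι_mul]
    refine sub_mem ?_ (Omega.ι_mul_mem _ hy)
    have := Omega.mul_mem_deg (diff_ι_mem D ϑ) (Omega.ofPsi_mem hy')
    convert this using 2
    rw [Nat.succ_eq_add_one]; ring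

theorem diff_mem (D : Preconnection τ.toFrameStructure) {k : ℕ} {x : Omega τ}
    (hx : x ∈ Omega.deg τ k) : diff D x ∈ Omega.deg τ (k + 1) := by
  induction hx using Submodule.span_induction with
  | zero => simp
  | add x y _ _ hx hy => rw [map_add]; exact add_mem hx hy
  | smul c x _ hx => rw [map_smul]; exact Submodule.smul_mem _ _ hx
  | mem x hx =>
    obtain ⟨p, q, rfl, ψ, hψ, η, hη, rfl⟩ := hx
    rw [← Omega.ofHor_mul_ofPsi, diff_ofHor_mul_ofPsi]
    have h1 := Omega.ofHor_mul_mem (horParity_mem hψ) (diffPsi_mem D hη)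
    have h2 : diff D (Omega.ofHor τ ψ) ∈ Omega.deg τ (p + 1) := by
      rw [diff_ofHor, diffHor_apply]
      exact add_mem (Omega.ofHor_mem (D.degree _ _ hψ))
        (Omega.ofCoact_mem (q := 1) (fun c => PsiExt.ι_mem _) (coactHor_mem (horParity_mem hψ)) rfl)
    have h3 := Omega.mul_mem_deg h2 (Omega.ofPsi_mem hη)
    rw [add_right_comm] at h3
    rw [← add_assoc] at h1
    exact add_mem h3 h1

theorem PsiExt.parity_of_mem {q : ℕ} {η : PsiExt τ} (h : η ∈ PsiExt.deg τ q) :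
    PsiExt.parity τ η = (-1 : ℂ) ^ q • η := by
  induction h using Submodule.pow_induction_on_left' with
  | algebraMap r => simp
  | add x y i _ _ hx hy => simp only [map_add, hx, hy, smul_add]
  | mem_mul v hv i x _ hx =>
    obtain ⟨ϑ, rfl⟩ := hv
    rw [map_mul, hx, PsiExt.parity_ι, Nat.succ_eq_add_one, pow_succ]
    simp

theorem Omega.parity_of_mem {k : ℕ} {x : Omega τ} (hx : x ∈ Omega.deg τ k) :
    Omega.parityLin τ x = (-1 : ℂ) ^ k • x := by
  induction hx using Submodule.span_induction with
  | zero => simp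
  | add x y _ _ hx hy => rw [map_add, hx, hy, smul_add]
  | smul c x _ hx => rw [map_smul, hx, smul_comm]
  | mem x hx =>
    obtain ⟨p, q, rfl, ψ, hψ, η, hη, rfl⟩ := hx
    rw [Omega.parityLin_tmul, horParity_of_mem hψ, PsiExt.parity_of_mem hη, Omega.tmul_smul,
      Omega.smul_tmul, smul_smul, pow_add, mul_comm]

/-- The automorphism of `Ψ_inv^∧` which is `2^q` in degree `q`. -/
def PsiExt.scale (τ : IntegrableFrameStructure P u) : PsiExt τ →ₐ[ℂ] PsiExt τ :=
  PsiExt.lift ((2 : ℂ) • PsiExt.ι τ) fun r hr => by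
    have key : ∀ z : Pol G ⊗[ℂ] Pol G, LinearMap.mul' ℂ _ (TensorProduct.map
        (((2 : ℂ) • PsiExt.ι τ) ∘ₗ PsiInv.π τ) (((2 : ℂ) • PsiExt.ι τ) ∘ₗ PsiInv.π τ) z) =
        (4 : ℂ) • pi2 τ z := by
      intro z
      induction z using TensorProduct.induction_on with
      | zero => simp
      | add x y hx hy => simp only [map_add, hx, hy, smul_add]
      | tmul x y =>
        simp only [TensorProduct.map_tmul, LinearMap.comp_apply, LinearMap.smul_apply,
          LinearMap.mul'_apply, pi2_tmul, smul_mul_smul_comm]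
        norm_num
    refine (key (Coalgebra.comul (R := ℂ) r)).trans ?_
    rw [pi2_comul, PsiExt.rel τ hr, smul_zero]

theorem PsiExt.scale_of_mem {q : ℕ} {η : PsiExt τ} (h : η ∈ PsiExt.deg τ q) :
    PsiExt.scale τ η = (2 : ℂ) ^ q • η := by
  induction h using Submodule.pow_induction_on_left' with
  | algebraMap r => simp
  | add x y i _ _ hx hy => simp only [map_add, hx, hy, smul_add]
  | mem_mul v hv i x _ hx =>
    obtain ⟨ϑ, rfl⟩ := hv
    have : PsiExt.scale τ (PsiExt.ι τ ϑ) = (2 : ℂ) • PsiExt.ι τ ϑ := PsiExt.lift_ι τ _ _ ϑ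
    rw [map_mul, hx, this, Nat.succ_eq_add_one, smul_mul_smul_comm, pow_succ']

/-- The automorphism of `hor_P` which is `2^p` in degree `p`. -/
def horScale (B : Type*) [Ring B] [Algebra ℂ B] (n : ℕ) : Hor B n →ₐ[ℂ] Hor B n :=
  Algebra.TensorProduct.map (AlgHom.id ℂ B) (ExteriorAlgebra.map ((2 : ℂ) • LinearMap.id))

theorem horScale_of_mem {p : ℕ} {φ : Hor B n} (h : φ ∈ horDeg B n p) :
    horScale B n φ = (2 : ℂ) ^ p • φ := by
  rw [horDeg_eq] at h
  induction h using Submodule.span_induction with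
  | zero => simp
  | add x y _ _ hx hy => rw [map_add, hx, hy, smul_add]
  | smul c x _ hx => rw [map_smul, hx, smul_comm]
  | mem x hx =>
    obtain ⟨b, ω, hω, rfl⟩ := hx
    rw [horScale, Algebra.TensorProduct.map_tmul, ← TensorProduct.tmul_smul, AlgHom.id_apply]
    congr 1
    induction hω using Submodule.pow_induction_on_left' with
    | algebraMap r => simp
    | add x y i _ _ hx hy => simp only [map_add, hx, hy, smul_add]
    | mem_mul v hv i x _ hx =>
      obtain ⟨v, rfl⟩ := hv
      rw [map_mul, hx, ExteriorAlgebra.map_apply_ι, Nat.succ_eq_add_one, LinearMap.smul_apply,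
        LinearMap.id_apply, map_smul, smul_mul_smul_comm, pow_succ']

/-- The linear map of `vh_P` which is `2^k` in degree `k`. -/
def Omega.scale (τ : IntegrableFrameStructure P u) : Module.End ℂ (Omega τ) :=
  TensorProduct.map (horScale B n).toLinearMap (PsiExt.scale τ).toLinearMap

theorem Omega.deg_le_eigenspace (k : ℕ) :
    Omega.deg τ k ≤ (Omega.scale τ).eigenspace ((2 : ℂ) ^ k) := by
  rw [Omega.deg, Submodule.span_le]
  rintro _ ⟨p, q, rfl, ψ, hψ, η, hη, rfl⟩
  refine Module.End.mem_eigenspace_iff.2 ?_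
  change Omega.tmul (horScale B n ψ) (PsiExt.scale τ η) = _
  rw [horScale_of_mem hψ, PsiExt.scale_of_mem hη, Omega.tmul_smul, Omega.smul_tmul, smul_smul,
    pow_add, mul_comm]

theorem PsiExt.exists_deg (η : PsiExt τ) : η ∈ ⨆ q, PsiExt.deg τ q := by
  induction η using PsiExt.induction with
  | algebraMap r =>
    refine Submodule.mem_iSup_of_mem 0 ?_
    rw [Algebra.algebraMap_eq_smul_one]
    exact Submodule.smul_mem _ _ PsiExt.one_mem
  | ι ϑ => exact Submodule.mem_iSup_of_mem 1 (PsiExt.ι_mem ϑ)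
  | mul x y hx hy =>
    have h := Submodule.mul_mem_mul hx hy
    rw [Submodule.iSup_mul] at h
    refine (iSup_le fun p => ?_ : _ ≤ ⨆ q, PsiExt.deg τ q) h
    rw [Submodule.mul_iSup]
    refine iSup_le fun q => ?_
    exact (Submodule.mul_le.2 fun _ hx _ hy => PsiExt.mul_mem hx hy).trans
      (le_iSup (PsiExt.deg τ) (p + q))
  | add x y hx hy => exact add_mem hx hy

theorem Omega.isInternal : DirectSum.IsInternal (Omega.deg τ) := by
  rw [DirectSum.isInternal_submodule_iff_iSupIndep_and_iSup_eq_top]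
  constructor
  · have h := (Module.End.eigenspaces_iSupIndep (Omega.scale τ)).comp
      (f := fun k : ℕ => (2 : ℂ) ^ k) (fun i j h => by
        have h2 : ((2 ^ i : ℕ) : ℂ) = ((2 ^ j : ℕ) : ℂ) := by push_cast; exact h
        exact Nat.pow_right_injective le_rfl (Nat.cast_injective h2))
    exact h.mono Omega.deg_le_eigenspace
  · rw [eq_top_iff]
    rintro x -
    induction x using Omega.induction_on with
    | zero => exact zero_mem _
    | add x y hx hy => exact add_mem hx hy
    | tmul φ η =>
      induction φ using hor_homog_induction with
      | add x y hx hy => rw [Omega.add_tmul]; exact add_mem hx hy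
      | homog p φ hφ =>
        have h := PsiExt.exists_deg η
        induction h using Submodule.iSup_induction' with
        | mem q η hη => exact Submodule.mem_iSup_of_mem (p + q) (Omega.tmul_mem hφ hη rfl)
        | zero =>
          rw [← Omega.ofHor_mul_ofPsi, map_zero, mul_zero]; exact zero_mem _
        | add x y _ _ hx hy => rw [Omega.tmul_add]; exact add_mem hx hy

end Grading

section HorStar

set_option linter.unusedSectionVars false

variable {m n : ℕ} {G : Subgroup (GL (Fin m) ℂ)} {B : Type*} [Ring B] [Algebra ℂ B] [StarRing B]
  [StarModule ℂ B] {P : QuantumPrincipalBundle G B} {u : RealUnitaryRep G n}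

theorem extStar_mul (x y : Ext n) : extStar n (x * y) = extStar n x * extStar n y :=
  map_mul (extStarHom n) x y

theorem extStar_ι (v : Fin n → ℂ) :
    extStar n (ExteriorAlgebra.ι ℂ v) = ExteriorAlgebra.ι ℂ (star v) :=
  congrArg (ConjAlg.of (Ext n)).symm (ExteriorAlgebra.lift_ι_apply ℂ _ _ _)

theorem extStar_one : extStar n 1 = 1 := map_one (extStarHom n)

theorem extStar_algebraMap (r : ℂ) :
    extStar n (algebraMap ℂ (Ext n) r) = algebraMap ℂ (Ext n) (star r) := by
  rw [Algebra.algebraMap_eq_smul_one, Algebra.algebraMap_eq_smul_one, LinearMap.map_smulₛₗ,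
    extStar_one]
  rfl

theorem extStar_extStar (x : Ext n) : extStar n (extStar n x) = x := by
  induction x using ExteriorAlgebra.induction with
  | algebraMap r => rw [extStar_algebraMap, extStar_algebraMap, star_star]
  | ι v => rw [extStar_ι, extStar_ι, star_star]
  | mul x y hx hy => rw [extStar_mul, extStar_mul, hx, hy]
  | add x y hx hy => rw [map_add, map_add, hx, hy]

theorem extStar_involute (x : Ext n) :
    extStar n (CliffordAlgebra.involute x) = CliffordAlgebra.involute (extStar n x) := by
  induction x using ExteriorAlgebra.induction with
  | algebraMap r => rw [AlgHom.commutes, extStar_algebraMap, AlgHom.commutes]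
  | ι v =>
    rw [extStar_ι, CliffordAlgebra.involute_ι, CliffordAlgebra.involute_ι, map_neg, extStar_ι]
  | mul x y hx hy => rw [extStar_mul, map_mul, extStar_mul, map_mul, hx, hy]
  | add x y hx hy => simp only [map_add, hx, hy]

theorem extStar_mem {p : ℕ} {ω : Ext n} (hω : ω ∈ ⋀[ℂ]^p (Fin n → ℂ)) :
    extStar n ω ∈ ⋀[ℂ]^p (Fin n → ℂ) := by
  induction hω using Submodule.pow_induction_on_left' with
  | algebraMap r => rw [extStar_algebraMap]; simp [ExteriorAlgebra.exteriorPower]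
  | add x y i _ _ hx hy => rw [map_add]; exact add_mem hx hy
  | mem_mul v hv i x _ hx =>
    obtain ⟨v, rfl⟩ := hv
    rw [extStar_mul, extStar_ι, ExteriorAlgebra.exteriorPower, Nat.succ_eq_add_one, pow_succ']
    exact Submodule.mul_mem_mul ⟨_, rfl⟩ hx

theorem ι_mul_comm (v : Fin n → ℂ) (x : Ext n) :
    ExteriorAlgebra.ι ℂ v * x = CliffordAlgebra.involute x * ExteriorAlgebra.ι ℂ v := by
  induction x using ExteriorAlgebra.induction with
  | algebraMap r => rw [AlgHom.commutes, Algebra.commutes]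
  | ι w =>
    rw [CliffordAlgebra.involute_ι, neg_mul]
    exact eq_neg_of_add_eq_zero_left (ExteriorAlgebra.ι_add_mul_swap _ _)
  | mul x y hx hy => rw [← mul_assoc, hx, mul_assoc, hy, map_mul, mul_assoc]
  | add x y hx hy => rw [mul_add, hx, hy, map_add, add_mul]

theorem ext_comm {p : ℕ} {ω : Ext n} (hω : ω ∈ ⋀[ℂ]^p (Fin n → ℂ)) (x : Ext n) :
    ω * x = (CliffordAlgebra.involute : Ext n →ₐ[ℂ] Ext n)^[p] x * ω := by
  induction hω using Submodule.pow_induction_on_left' generalizing x with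
  | algebraMap r => exact Algebra.commutes _ _
  | add x y i _ _ hx hy => rw [add_mul, hx, hy, mul_add]
  | mem_mul v hv i y _ hy =>
    obtain ⟨v, rfl⟩ := hv
    rw [mul_assoc, hy, ← mul_assoc, ι_mul_comm, mul_assoc, Nat.succ_eq_add_one,
      Function.iterate_succ_apply']

theorem horStar_tmul (b : B) (ω : Ext n) : horStar B n (b ⊗ₜ ω) = star b ⊗ₜ extStar n ω := rfl

theorem horStar_horStar (φ : Hor B n) : horStar B n (horStar B n φ) = φ := by
  induction φ using TensorProduct.induction_on with
  | zero => simp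
  | add x y hx hy => rw [map_add, map_add, hx, hy]
  | tmul b ω => rw [horStar_tmul, horStar_tmul, star_star, extStar_extStar]

theorem horStar_inclB (b : B) : horStar B n (inclB B n b) = inclB B n (star b) := by
  rw [inclB_apply, horStar_tmul, extStar_one, inclB_apply]

theorem horStar_one : horStar B n 1 = 1 := by
  rw [← map_one (inclB B n), horStar_inclB, star_one]

theorem horStar_parity (φ : Hor B n) :
    horStar B n (horParity B n φ) = horParity B n (horStar B n φ) := by
  induction φ using TensorProduct.induction_on with
  | zero => simp
  | add x y hx hy => simp only [map_add, hx, hy]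
  | tmul b ω =>
    simp only [horParity, Algebra.TensorProduct.map_tmul, horStar_tmul, AlgHom.id_apply,
      extStar_involute]

theorem horStar_mem {p : ℕ} {φ : Hor B n} (h : φ ∈ horDeg B n p) :
    horStar B n φ ∈ horDeg B n p := by
  rw [horDeg_eq] at *
  induction h using Submodule.span_induction with
  | zero => simp
  | add x y _ _ hx hy => rw [map_add]; exact add_mem hx hy
  | smul c x _ hx => rw [LinearMap.map_smulₛₗ]; exact Submodule.smul_mem _ _ hx
  | mem x hx =>
    obtain ⟨b, ω, hω, rfl⟩ := hx
    exact Submodule.subset_span ⟨star b, _, extStar_mem hω, horStar_tmul b ω⟩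

/-- `(φψ)^* = (-1)^{∂φ∂ψ} ψ^* φ^*` in `hor_P`. -/
theorem horStar_mul {p : ℕ} (φ : Hor B n) {ψ : Hor B n} (hψ : ψ ∈ horDeg B n p) :
    horStar B n (φ * ψ) = horStar B n ψ * (horParity B n)^[p] (horStar B n φ) := by
  have key : ∀ (q : ℕ) (c : B) (x : Ext n), (horParity B n)^[q] (c ⊗ₜ x) =
      c ⊗ₜ ((CliffordAlgebra.involute : Ext n →ₐ[ℂ] Ext n)^[q] x) := by
    intro q c x
    induction q with
    | zero => rfl
    | succ q ih => rw [Function.iterate_succ_apply', Function.iterate_succ_apply', ih]; rfl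
  rw [horDeg_eq] at hψ
  induction hψ using Submodule.span_induction with
  | zero => simp
  | add x y _ _ hx hy => rw [mul_add, map_add, map_add, hx, hy, add_mul]
  | smul c x _ hx =>
    rw [mul_smul_comm, LinearMap.map_smulₛₗ, LinearMap.map_smulₛₗ, hx, smul_mul_assoc]
  | mem x hx =>
    obtain ⟨b, ω, hω, rfl⟩ := hx
    induction φ using TensorProduct.induction_on with
    | zero => simp
    | add x y hx hy => rw [add_mul, map_add, map_add, hx, hy, iterate_map_add, mul_add]
    | tmul c η =>
      rw [Algebra.TensorProduct.tmul_mul_tmul, horStar_tmul, horStar_tmul, horStar_tmul, key,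
        Algebra.TensorProduct.tmul_mul_tmul, star_mul, extStar_mul]
      congr 1
      have h := ext_comm (extStar_mem hω) ((CliffordAlgebra.involute : Ext n →ₐ[ℂ] Ext n)^[p]
        (extStar n η))
      rw [h, ← Function.iterate_add_apply, ← two_mul, Function.iterate_mul]
      congr 1
      have : ((CliffordAlgebra.involute : Ext n →ₐ[ℂ] Ext n)^[2]) = id := by
        funext x; exact CliffordAlgebra.involute_involute x
      rw [this, Function.iterate_id]
      rfl

theorem horStar_inclB_mul (b : B) (φ : Hor B n) :
    horStar B n (inclB B n b * φ) = horStar B n φ * inclB B n (star b) := by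
  induction φ using hor_homog_induction with
  | add x y hx hy => rw [mul_add, map_add, hx, hy, map_add, add_mul]
  | homog p φ h =>
    rw [horStar_mul _ h, horStar_inclB]
    congr 1
    exact Function.iterate_fixed (horParity_inclB _) p

theorem horStar_mul_inclB (b : B) (φ : Hor B n) :
    horStar B n (φ * inclB B n b) = inclB B n (star b) * horStar B n φ := by
  rw [horStar_mul _ (inclB_mem_horDeg b), horStar_inclB]; rfl

/-- The `*`-structure of `hor_P ⊗ 𝒜`. -/
def horPolStar (G : Subgroup (GL (Fin m) ℂ)) (B : Type*) [Ring B] [Algebra ℂ B] [StarRing B]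
    [StarModule ℂ B] (n : ℕ) : Hor B n ⊗[ℂ] Pol G →ₗ⋆[ℂ] Hor B n ⊗[ℂ] Pol G :=
  TensorProduct.map (horStar B n) (starLinearEquiv ℂ : Pol G ≃ₗ⋆[ℂ] Pol G).toLinearMap

theorem horPolStar_tmul (φ : Hor B n) (a : Pol G) :
    horPolStar G B n (φ ⊗ₜ a) = horStar B n φ ⊗ₜ star a := rfl

theorem actB_star (g : G) (b : B) : actB P g (star b) = star (actB P g b) := by
  change slice B g (P.F (star b)) = star (slice B g (P.F b))
  rw [P.map_star]
  generalize P.F b = x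
  induction x using TensorProduct.induction_on with
  | zero => simp
  | add x y hx hy => simp only [star_add, map_add, hx, hy]
  | tmul c a => rw [TensorProduct.star_tmul, slice_tmul, slice_tmul, star_smul, evalAt_star]

theorem actE_star (g : G) (x : Ext n) : actE u g (extStar n x) = extStar n (actE u g x) := by
  induction x using ExteriorAlgebra.induction with
  | algebraMap r => rw [extStar_algebraMap, actE_algebraMap, actE_algebraMap, extStar_algebraMap]
  | ι v =>
    rw [extStar_ι, actE_ι, actE_ι, extStar_ι]
    congr 1
    ext i
    simp only [Matrix.mulVec, dotProduct, Pi.star_apply, star_sum, star_mul']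
    refine Finset.sum_congr rfl fun j _ => ?_
    congr 1
    change evalAt g (u.mat i j) = star (evalAt g (u.mat i j))
    rw [← evalAt_star, u.real]
  | mul x y hx hy => rw [extStar_mul, actE_mul, actE_mul, extStar_mul, hx, hy]
  | add x y hx hy => simp only [map_add, hx, hy]

theorem act_star (g : G) (φ : Hor B n) :
    act P u g (horStar B n φ) = horStar B n (act P u g φ) := by
  induction φ using TensorProduct.induction_on with
  | zero => simp
  | add x y hx hy => simp only [map_add, hx, hy]
  | tmul b ω => rw [horStar_tmul, act_tmul, act_tmul, horStar_tmul, actB_star, actE_star]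

theorem coactHor_star (φ : Hor B n) :
    coactHor P u (horStar B n φ) = horPolStar G B n (coactHor P u φ) := by
  apply slice_ext; intro g
  have : ∀ x : Hor B n ⊗[ℂ] Pol G, slice _ g (horPolStar G B n x) =
      horStar B n (slice _ g x) := by
    intro x
    induction x using TensorProduct.induction_on with
    | zero => simp
    | add x y hx hy => simp only [map_add, hx, hy]
    | tmul c a =>
      rw [horPolStar_tmul, slice_tmul, slice_tmul, LinearMap.map_smulₛₗ, evalAt_star]; rfl
  rw [this, slice_coactHor, slice_coactHor, act_star]

/-- The map `∑ φₖ ⊗ cₖ ↦ ∑ (1 ⊗ κ(cₖ)) F^∧(φₖ)`. -/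
def antiCoact (P : QuantumPrincipalBundle G B) (u : RealUnitaryRep G n) :
    Hor B n ⊗[ℂ] Pol G →ₗ[ℂ] Hor B n ⊗[ℂ] Pol G :=
  LinearMap.mul' ℂ _ ∘ₗ TensorProduct.map (coactHor P u).toLinearMap
    (TensorProduct.mk ℂ (Hor B n) (Pol G) 1 ∘ₗ antipodeHom.toLinearMap)

theorem antiCoact_tmul (φ : Hor B n) (a : Pol G) :
    antiCoact P u (φ ⊗ₜ a) = (1 ⊗ₜ antipodeHom a) * coactHor P u φ := by
  change coactHor P u φ * (1 ⊗ₜ antipodeHom a) = _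
  generalize coactHor P u φ = x
  induction x using TensorProduct.induction_on with
  | zero => simp
  | add x y hx hy => rw [add_mul, hx, hy, mul_add]
  | tmul c a => simp [mul_comm]

theorem antiCoact_coactHor (φ : Hor B n) : antiCoact P u (coactHor P u φ) = φ ⊗ₜ 1 := by
  apply slice_ext; intro g
  have : ∀ x, slice _ g (antiCoact P u x) = act P u g (slice _ g⁻¹ x) := by
    intro x
    induction x using TensorProduct.induction_on with
    | zero => simp
    | add x y hx hy => simp only [map_add, hx, hy]
    | tmul ψ a => simp [antiCoact_tmul, slice_mul, slice_coactHor]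
  rw [this, slice_coactHor, act_act, mul_inv_cancel, act_one]
  simp

theorem star_antipodeHom (a : Pol G) : star (antipodeHom a) = antipodeHom (star a) := rfl

theorem antipodeHom_antipodeHom (a : Pol G) : antipodeHom (antipodeHom a) = a := by
  apply pol_ext; intro g; simp

theorem contract_antipode (χ : Pol G →ₗ[ℂ] Hor B n) (h1 : χ 1 = 0)
    (hd : ∀ b c, contract χ (coactHor P u (inclB B n b) * coactHor P u (inclB B n c)) =
      contract χ (coactHor P u (inclB B n b)) * inclB B n c +
        inclB B n b * contract χ (coactHor P u (inclB B n c))) (c : B) :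
    LinearMap.mul' ℂ _ (TensorProduct.map (χ ∘ₗ antipodeHom.toLinearMap) (inclB B n).toLinearMap
      (TensorProduct.comm ℂ _ _ (P.F c))) = - contract χ (coactHor P u (inclB B n c)) := by
  have h : ∀ x : B ⊗[ℂ] Pol G, LinearMap.mul' ℂ _ (TensorProduct.map (χ ∘ₗ antipodeHom.toLinearMap)
      (inclB B n).toLinearMap (TensorProduct.comm ℂ _ _ x)) =
      contract χ (antiCoact P u ((inclB B n).toLinearMap.rTensor (Pol G) x)) -
        contract χ (coactHor P u (inclB B n (slice _ 1 x))) := by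
    intro x
    induction x using TensorProduct.induction_on with
    | zero => simp
    | add x y hx hy => simp only [map_add, hx, hy]; abel
    | tmul b a =>
      have h := contract_mul χ (inclB B n b) (fun d => hd d b) (antipodeHom a)
      rw [LinearMap.rTensor_tmul, antiCoact_tmul, AlgHom.toLinearMap_apply, h]
      simp [counit_eq]
  have hs : slice _ 1 (P.F c) = c := actB_one P c
  rw [h, ← coactHor_inclB (u := u), antiCoact_coactHor, hs]
  simp [contract, h1]

/-- Hermitian derivations and the antipode: `χ(κ(a)^*)^* = -χ(a)`. -/
theorem star_antipode (χ : Pol G →ₗ[ℂ] Hor B n) (h1 : χ 1 = 0)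
    (hd : ∀ b c, contract χ (coactHor P u (inclB B n b) * coactHor P u (inclB B n c)) =
      contract χ (coactHor P u (inclB B n b)) * inclB B n c +
        inclB B n b * contract χ (coactHor P u (inclB B n c)))
    (hs : ∀ b, horStar B n (contract χ (coactHor P u (inclB B n b))) =
      contract χ (coactHor P u (inclB B n (star b)))) (a : Pol G) :
    horStar B n (χ (star (antipodeHom a))) = - χ a := by
  let χ' : Pol G →ₗ[ℂ] Hor B n :=
    { toFun := fun a => - horStar B n (χ (star (antipodeHom a)))
      map_add' := fun x y => by simp only [map_add, star_add, neg_add]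
      map_smul' := fun c x => by
        simp only [map_smul, star_smul, LinearMap.map_smulₛₗ, RingHom.id_apply, smul_neg]
        simp }
  have h : χ' = χ := by
    apply contract_ext (P := P) (u := u)
    intro b
    have e : ∀ x : B ⊗[ℂ] Pol G, contract χ' ((inclB B n).toLinearMap.rTensor (Pol G) x) =
        - horStar B n (LinearMap.mul' ℂ _ (TensorProduct.map (χ ∘ₗ antipodeHom.toLinearMap)
          (inclB B n).toLinearMap (TensorProduct.comm ℂ _ _ (star x)))) := by
      intro x
      induction x using TensorProduct.induction_on with
      | zero => simp
      | add x y hx hy => simp only [star_add, map_add, hx, hy, neg_add]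
      | tmul b a =>
        rw [TensorProduct.star_tmul, TensorProduct.comm_tmul, TensorProduct.map_tmul,
          LinearMap.mul'_apply, AlgHom.toLinearMap_apply, horStar_mul_inclB, star_star]
        change inclB B n b * χ' a = _
        change inclB B n b * - horStar B n (χ (star (antipodeHom a))) = _
        rw [star_antipodeHom, mul_neg]
        rfl
    rw [coactHor_inclB, e, ← P.map_star, contract_antipode χ h1 hd, map_neg, neg_neg, hs,
      star_star, coactHor_inclB]
  have h2 := LinearMap.congr_fun h a
  rw [← h2]
  change _ = - - _
  rw [neg_neg]

end HorStar

section OmegaStar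

set_option linter.unusedSectionVars false

variable {m n : ℕ} {G : Subgroup (GL (Fin m) ℂ)} [CompactSpace G] {B : Type*} [Ring B]
  [Algebra ℂ B] [StarRing B] [StarModule ℂ B] {P : QuantumPrincipalBundle G B}
  {u : RealUnitaryRep G n} {τ : IntegrableFrameStructure P u}

theorem curvature_hs (D : Preconnection τ.toFrameStructure) (b : B) :
    horStar B n (contract (curvature D) (coactHor P u (inclB B n b))) =
      contract (curvature D) (coactHor P u (inclB B n (star b))) := by
  have h := curvature_spec D (inclB B n b)
  have h' := curvature_spec D (inclB B n (star b))
  rw [eq_comm, neg_eq_iff_eq_neg] at h h'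
  rw [h, h', map_neg, ← horStar_inclB, D.hermitian, D.hermitian]

theorem displacement_inclB (D D' : Preconnection τ.toFrameStructure) (b : B) :
    contract (displacement D D') (coactHor P u (inclB B n b)) =
      D.D (inclB B n b) - D'.D (inclB B n b) := by
  have := displacement_spec D D' 0 _ (inclB_mem_horDeg b)
  rw [pow_zero, neg_smul, one_smul, LinearMap.sub_apply, eq_comm, neg_eq_iff_eq_neg,
    neg_sub] at this
  exact this

theorem displacement_one (D D' : Preconnection τ.toFrameStructure) :
    displacement D D' 1 = 0 := by
  have := displacement_inclB D D' 1
  rw [map_one, D.D_one, D'.D_one, map_one, Algebra.TensorProduct.one_def] at this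
  simpa [contract] using this

theorem star_curvature (D : Preconnection τ.toFrameStructure) (a : Pol G) :
    horStar B n (curvature D (star (antipodeHom a))) = - curvature D a :=
  star_antipode _ (curvature_one D) (fun _ _ => curvature_deriv D _ _) (curvature_hs D) a

theorem idealR_star {r : Pol G} (hr : r ∈ idealR τ) : star (antipodeHom r) ∈ idealR τ := by
  refine ⟨?_, fun D => ?_, fun D D' => ?_⟩
  · have h : Coalgebra.counit (R := ℂ) r = 0 := hr.1
    rw [counit_eq] at *
    rw [evalAt_star, evalAt_antipodeHom, inv_one, h, star_zero]
  · rw [← horStar_horStar (curvature D _), star_curvature, hr.2.1 D, neg_zero, map_zero]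
  · have h := star_antipode (displacement D D') (displacement_one D D')
      (fun b c => displacement_deriv D D' b c) (fun b => by
        rw [displacement_inclB, displacement_inclB, map_sub, ← horStar_inclB, D.hermitian,
          D'.hermitian]) r
    rw [← horStar_horStar (displacement D D' _), h, hr.2.2 D D', neg_zero, map_zero]

/-- The `*`-structure of `Ψ_inv`: `π(a)^* = -π(κ(a)^*)`. -/
def PsiInv.star (τ : IntegrableFrameStructure P u) : PsiInv τ →ₗ⋆[ℂ] PsiInv τ :=
  ((relKer τ).restrictScalars ℂ).liftQ
      ({ toFun := fun a => - PsiInv.π τ (Star.star (antipodeHom (a : Pol G)))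
         map_add' := fun x y => by simp [add_comm]
         map_smul' := fun c x => by simp } : ↥(kerCounit G) →ₗ⋆[ℂ] PsiInv τ)
      (fun a ha => by
        have h : Star.star (antipodeHom (a : Pol G)) ∈ idealR τ := idealR_star ha
        change - PsiInv.π τ (Star.star (antipodeHom (a : Pol G))) = 0
        rw [PsiInv.π_eq_zero τ h, neg_zero]) ∘ₛₗ
    (Submodule.Quotient.restrictScalarsEquiv ℂ (relKer τ)).symm.toLinearMap

theorem PsiInv.star_π (a : Pol G) :
    PsiInv.star τ (PsiInv.π τ a) = - PsiInv.π τ (Star.star (antipodeHom a)) := by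
  change - PsiInv.π τ (Star.star (antipodeHom (a - algebraMap ℂ (Pol G) (Coalgebra.counit a)))) = _
  rw [map_sub, AlgHom.commutes, star_sub, map_sub, Algebra.algebraMap_eq_smul_one, star_smul,
    star_one, map_smul, PsiInv.π_one, smul_zero, sub_zero]

theorem PsiInv.star_star (ϑ : PsiInv τ) : PsiInv.star τ (PsiInv.star τ ϑ) = ϑ := by
  obtain ⟨a, rfl⟩ := PsiInv.π_surjective τ ϑ
  have e : Star.star (antipodeHom (Star.star (antipodeHom a))) = a := by
    apply pol_ext; intro g
    rw [evalAt_star, evalAt_antipodeHom, evalAt_star, evalAt_antipodeHom, inv_inv,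
      _root_.star_star]
  rw [PsiInv.star_π, map_neg, PsiInv.star_π, neg_neg, e]

theorem PsiInv.star_smul (c : Pol G) (ϑ : PsiInv τ) :
    PsiInv.star τ (c • ϑ) = Star.star (antipodeHom c) • PsiInv.star τ ϑ := by
  obtain ⟨a, rfl⟩ := PsiInv.π_surjective τ ϑ
  have : Coalgebra.counit (R := ℂ) (Star.star (antipodeHom a)) =
      Star.star (Coalgebra.counit (R := ℂ) a) := by
    rw [counit_eq, counit_eq, evalAt_star, evalAt_antipodeHom, inv_one]
  have h := PsiInv.smul_π τ (Star.star (antipodeHom c)) (Star.star (antipodeHom a))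
  rw [PsiInv.smul_π, map_sub, LinearMap.map_smulₛₗ, PsiInv.star_π, PsiInv.star_π, PsiInv.star_π,
    smul_neg (Star.star (antipodeHom c)), h, this, map_mul, StarMul.star_mul, smul_neg]
  rw [mul_comm (Star.star (antipodeHom c))]
  change _ - -(Star.star (Coalgebra.counit (R := ℂ) a) • _) = _
  abel

/-- The map `a ⊗ b ↦ κ(b)^* ⊗ κ(a)^*`. -/
def polAnti (G : Subgroup (GL (Fin m) ℂ)) : Pol G ⊗[ℂ] Pol G →ₗ⋆[ℂ] Pol G ⊗[ℂ] Pol G :=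
  (TensorProduct.map (starLinearEquiv ℂ : Pol G ≃ₗ⋆[ℂ] Pol G).toLinearMap
    (starLinearEquiv ℂ : Pol G ≃ₗ⋆[ℂ] Pol G).toLinearMap) ∘ₛₗ
  (TensorProduct.map antipodeHom.toLinearMap antipodeHom.toLinearMap ∘ₗ
    (TensorProduct.comm ℂ (Pol G) (Pol G)).toLinearMap)

theorem polAnti_tmul (a b : Pol G) :
    polAnti G (a ⊗ₜ b) = star (antipodeHom b) ⊗ₜ star (antipodeHom a) := rfl

theorem comul_anti (a : Pol G) : Coalgebra.comul (R := ℂ) (star (antipodeHom a)) =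
    polAnti G (Coalgebra.comul (R := ℂ) a) := by
  apply eval2_ext; intro g h
  have : ∀ z : Pol G ⊗[ℂ] Pol G, eval2 g h (polAnti G z) = star (eval2 h⁻¹ g⁻¹ z) := by
    intro z
    induction z using TensorProduct.induction_on with
    | zero => simp
    | add x y hx hy => simp only [map_add, hx, hy, star_add]
    | tmul x y =>
      rw [polAnti_tmul, eval2_tmul, eval2_tmul, evalAt_star, evalAt_star, evalAt_antipodeHom,
        evalAt_antipodeHom, star_mul']
      ring
  rw [this, eval2_comul, eval2_comul, evalAt_star, evalAt_antipodeHom, mul_inv_rev]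

/-- Auxiliary to the `*`-structure of `vh_P`: the operators `x^* ↦ (xη)^*`, depending
antilinearly and antimultiplicatively on `η ∈ Ψ_inv^∧`. For `ϑ ∈ Ψ_inv` we have
`(xϑ)^* = (-1)^{∂x} ϑ^* x^*`. -/
def Omega.starPsiHom (τ : IntegrableFrameStructure P u) :
    PsiExt τ →ₐ[ℂ] ConjAlg (Module.End ℂ (Omega τ))ᵐᵒᵖ :=
  PsiExt.lift
    { toFun := fun ϑ => ConjAlg.of _ (MulOpposite.op
        (LinearMap.mulLeft ℂ (Omega.ofPsi τ (PsiExt.ι τ (PsiInv.star τ ϑ))) ∘ₗ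
          Omega.parityLin τ))
      map_add' := fun x y => by
        rw [← map_add, ← MulOpposite.op_add, ← LinearMap.add_comp]
        congr 3
        ext z
        simp [add_mul]
      map_smul' := fun c x => by
        rw [RingHom.id_apply, ← ConjAlg.of_smul, ← MulOpposite.op_smul, ← LinearMap.smul_comp]
        congr 3
        ext z
        rw [LinearMap.map_smulₛₗ]
        simp }
    (fun r hr => by
      have key : ∀ (f : Pol G →ₗ[ℂ] ConjAlg (Module.End ℂ (Omega τ))ᵐᵒᵖ),
          (∀ a, f a = ConjAlg.of _ (MulOpposite.op
            (LinearMap.mulLeft ℂ (Omega.ofPsi τ (PsiExt.ι τ (PsiInv.star τ (PsiInv.π τ a)))) ∘ₗ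
              Omega.parityLin τ))) → ∀ z : Pol G ⊗[ℂ] Pol G,
          LinearMap.mul' ℂ _ (TensorProduct.map f f z) = ConjAlg.of _ (MulOpposite.op
            (LinearMap.mulLeft ℂ (Omega.ofPsi τ (- pi2 τ (polAnti G z))))) := by
        intro f hf z
        induction z using TensorProduct.induction_on with
        | zero =>
          rw [map_zero, map_zero, map_zero, map_zero, neg_zero, map_zero, LinearMap.mulLeft_zero_eq_zero,
            MulOpposite.op_zero, map_zero]
        | add x y hx hy =>
          rw [map_add, map_add, hx, hy, ← map_add, ← MulOpposite.op_add]
          congr 2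
          ext z
          simp [add_mul, add_comm]
        | tmul x y =>
          rw [TensorProduct.map_tmul, LinearMap.mul'_apply, hf, hf, ← map_mul, ← MulOpposite.op_mul]
          congr 2
          ext z
          change Omega.ofPsi τ (PsiExt.ι τ (PsiInv.star τ (PsiInv.π τ y))) * Omega.parityLin τ
            (Omega.ofPsi τ (PsiExt.ι τ (PsiInv.star τ (PsiInv.π τ x))) * Omega.parityLin τ z) =
              Omega.ofPsi τ _ * z
          rw [Omega.parity_ι_mul, Omega.parity_parity, polAnti_tmul, pi2_tmul, PsiInv.star_π,
            PsiInv.star_π]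
          simp [mul_assoc]
      refine (key _ (fun a => rfl) (Coalgebra.comul (R := ℂ) r)).trans ?_
      rw [← comul_anti, pi2_comul, PsiExt.rel τ (idealR_star hr), neg_zero, map_zero,
        LinearMap.mulLeft_zero_eq_zero, MulOpposite.op_zero, map_zero])

/-- The operators `x^* ↦ (xη)^*`. -/
def Omega.starPsi (τ : IntegrableFrameStructure P u) :
    PsiExt τ →ₗ⋆[ℂ] Module.End ℂ (Omega τ) where
  toFun η := MulOpposite.unop ((ConjAlg.of _).symm (Omega.starPsiHom τ η))
  map_add' x y := by simp only [map_add, MulOpposite.unop_add]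
  map_smul' c x := by rw [map_smul, ConjAlg.of_symm_smul, MulOpposite.unop_smul]; rfl

theorem Omega.starPsi_ι (ϑ : PsiInv τ) (x : Omega τ) : Omega.starPsi τ (PsiExt.ι τ ϑ) x =
    Omega.ofPsi τ (PsiExt.ι τ (PsiInv.star τ ϑ)) * Omega.parityLin τ x := by
  have h : Omega.starPsiHom τ (PsiExt.ι τ ϑ) = _ := PsiExt.lift_ι τ _ _ ϑ
  change MulOpposite.unop ((ConjAlg.of _).symm (Omega.starPsiHom τ (PsiExt.ι τ ϑ))) x = _
  rw [h]
  rfl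

theorem Omega.starPsi_mul (η ζ : PsiExt τ) :
    Omega.starPsi τ (η * ζ) = Omega.starPsi τ ζ * Omega.starPsi τ η := by
  change MulOpposite.unop ((ConjAlg.of _).symm (Omega.starPsiHom τ (η * ζ))) = _
  rw [map_mul, map_mul, MulOpposite.unop_mul]
  rfl

theorem Omega.starPsi_one : Omega.starPsi τ 1 = 1 := by
  change MulOpposite.unop ((ConjAlg.of _).symm (Omega.starPsiHom τ 1)) = _
  rw [map_one, map_one, MulOpposite.unop_one]

/-- The `*`-structure of `vh_P`: `(φ ⊗ η)^* = (-1)^{∂φ∂η} η^* φ^*`, that is,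
`(φ ⊗ η)^* = ∑ φₖ^* ⊗ (η^* ∘ cₖ^*)`. -/
def Omega.star (τ : IntegrableFrameStructure P u) : Omega τ →ₗ⋆[ℂ] Omega τ :=
  TensorProduct.lift
    (((LinearMap.applyₗ ∘ₗ (Omega.ofHor τ).toLinearMap :
      Hor B n →ₗ[ℂ] Module.End ℂ (Omega τ) →ₗ[ℂ] Omega τ) ∘ₛₗ horStar B n).compl₂
        (Omega.starPsi τ))

theorem Omega.star_tmul (φ : Hor B n) (η : PsiExt τ) : Omega.star τ (Omega.tmul φ η) =
    Omega.starPsi τ η (Omega.ofHor τ (horStar B n φ)) := rfl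

end OmegaStar

section StarProperties

set_option linter.unusedSectionVars false

variable {m n : ℕ} {G : Subgroup (GL (Fin m) ℂ)} [CompactSpace G] {B : Type*} [Ring B]
  [Algebra ℂ B] [StarRing B] [StarModule ℂ B] {P : QuantumPrincipalBundle G B}
  {u : RealUnitaryRep G n} {τ : IntegrableFrameStructure P u}

theorem Omega.star_ofHor (φ : Hor B n) :
    Omega.star τ (Omega.ofHor τ φ) = Omega.ofHor τ (horStar B n φ) := by
  rw [Omega.ofHor_apply, Omega.star_tmul, Omega.starPsi_one]; rfl

theorem Omega.star_mul_ofPsi (x : Omega τ) (ζ : PsiExt τ) :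
    Omega.star τ (x * Omega.ofPsi τ ζ) = Omega.starPsi τ ζ (Omega.star τ x) := by
  induction x using Omega.induction_on with
  | zero => simp
  | add x y hx hy => simp only [add_mul, map_add, hx, hy]
  | tmul φ η =>
    rw [Omega.tmul_mul_ofPsi, Omega.star_tmul, Omega.star_tmul, Omega.starPsi_mul]; rfl

theorem Omega.star_mul_ι (x : Omega τ) (ϑ : PsiInv τ) :
    Omega.star τ (x * Omega.ofPsi τ (PsiExt.ι τ ϑ)) =
      Omega.ofPsi τ (PsiExt.ι τ (PsiInv.star τ ϑ)) * Omega.parityLin τ (Omega.star τ x) := by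
  rw [Omega.star_mul_ofPsi, Omega.starPsi_ι]

theorem Omega.star_one : Omega.star τ 1 = 1 := by
  rw [← map_one (Omega.ofHor τ), Omega.star_ofHor, horStar_one]

theorem Omega.parity_one : Omega.parityLin τ 1 = 1 := by
  rw [← map_one (Omega.ofHor τ), Omega.parity_ofHor, map_one]

theorem Omega.star_ι (ϑ : PsiInv τ) : Omega.star τ (Omega.ofPsi τ (PsiExt.ι τ ϑ)) =
    Omega.ofPsi τ (PsiExt.ι τ (PsiInv.star τ ϑ)) := by
  have := Omega.star_mul_ι 1 ϑ
  rwa [one_mul, Omega.star_one, Omega.parity_one, mul_one] at this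

theorem Omega.iterate_mul (p : ℕ) (x y : Omega τ) : (Omega.parityLin τ)^[p] (x * y) =
    (Omega.parityLin τ)^[p] x * (Omega.parityLin τ)^[p] y := by
  induction p with
  | zero => rfl
  | succ p ih => simp only [Function.iterate_succ_apply', ih, Omega.parity_mul]

theorem Omega.iterate_ofHor (p : ℕ) (φ : Hor B n) : (Omega.parityLin τ)^[p] (Omega.ofHor τ φ) =
    Omega.ofHor τ ((horParity B n)^[p] φ) := by
  induction p with
  | zero => rfl
  | succ p ih => simp only [Function.iterate_succ_apply', ih, Omega.parity_ofHor]

theorem Omega.iterate_ι (p : ℕ) (ϑ : PsiInv τ) :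
    (Omega.parityLin τ)^[p] (Omega.ofPsi τ (PsiExt.ι τ ϑ)) =
      (-1 : ℂ) ^ p • Omega.ofPsi τ (PsiExt.ι τ ϑ) := by
  induction p with
  | zero => simp
  | succ p ih =>
    rw [Function.iterate_succ_apply', ih, map_smul, Omega.parity_ofPsi, PsiExt.parity_ι, map_neg,
      pow_succ]
    simp

theorem Omega.iterate_of_mem {k : ℕ} (p : ℕ) {x : Omega τ} (hx : x ∈ Omega.deg τ k) :
    (Omega.parityLin τ)^[p] x = (-1 : ℂ) ^ (p * k) • x := by
  induction p with
  | zero => simp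
  | succ p ih =>
    rw [Function.iterate_succ_apply', ih, map_smul, Omega.parity_of_mem hx, smul_smul, ← pow_add]
    ring_nf

theorem Omega.star_ι_mul_ofHor (x : Omega τ)
    (hx : ∀ p, ∀ ψ ∈ horDeg B n p, Omega.star τ (x * Omega.ofHor τ ψ) =
      Omega.ofHor τ (horStar B n ψ) * (Omega.parityLin τ)^[p] (Omega.star τ x))
    (ϑ : PsiInv τ) : ∀ p, ∀ ψ ∈ horDeg B n p,
    Omega.star τ (x * Omega.ofPsi τ (PsiExt.ι τ ϑ) * Omega.ofHor τ ψ) =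
      Omega.ofHor τ (horStar B n ψ) *
        (Omega.parityLin τ)^[p] (Omega.star τ (x * Omega.ofPsi τ (PsiExt.ι τ ϑ))) := by
  intro p ψ hψ
  have key : ∀ w ∈ horDegPol G B n p,
      Omega.star τ (x * Omega.ofCoact (PsiExt.actMul τ ϑ 1) w) =
        Omega.ofCoact (PsiExt.actMul τ (PsiInv.star τ ϑ) 1) (antiCoact P u (horPolStar G B n w)) *
          (Omega.parityLin τ)^[p + 1] (Omega.star τ x) := by
    intro w hw
    induction hw using Submodule.span_induction with
    | zero => simp
    | add x y _ _ hx hy => simp only [map_add, mul_add, add_mul, hx, hy]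
    | smul c x _ hx =>
      rw [map_smul, mul_smul_comm, LinearMap.map_smulₛₗ, hx, LinearMap.map_smulₛₗ, map_smul,
        map_smul, smul_mul_assoc]
    | mem w hw =>
      obtain ⟨φ, hφ, c, rfl⟩ := hw
      rw [Omega.ofCoact_tmul, ← Omega.ofHor_mul_ofPsi, ← mul_assoc, PsiExt.actMul_apply, mul_one,
        Omega.star_mul_ι, hx p φ hφ, Omega.parity_mul, Omega.parity_ofHor, ← mul_assoc,
        Function.iterate_succ_apply', Omega.ofHor_apply, Omega.ι_mul_tmul, horParity_horParity,
        horPolStar_tmul, antiCoact_tmul, PsiInv.star_smul, ← star_antipodeHom]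
      congr 1
      generalize coactHor P u (horStar B n φ) = y
      induction y using TensorProduct.induction_on with
      | zero => simp
      | add x y hx hy => simp only [map_add, mul_add, hx, hy]
      | tmul v d =>
        rw [Algebra.TensorProduct.tmul_mul_tmul, one_mul, Omega.ofCoact_tmul, Omega.ofCoact_tmul,
          PsiExt.actMul_apply, PsiExt.actMul_apply, smul_smul, mul_comm d]
  rw [mul_assoc, Omega.ofHor_apply, Omega.ι_mul_tmul, key _ (coactHor_mem (horParity_mem hψ)),
    ← coactHor_star, antiCoact_coactHor, Omega.ofCoact_tmul, PsiExt.actMul_apply, one_smul,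
    mul_one, horParity_of_mem hψ, Omega.star_mul_ι, Omega.iterate_mul, Omega.iterate_ι,
    ← Function.iterate_succ_apply, LinearMap.map_smulₛₗ, Omega.smul_tmul, ← Omega.ofHor_mul_ofPsi,
    smul_mul_assoc, smul_mul_assoc, mul_smul_comm, mul_assoc]
  simp

theorem Omega.star_mul_ofHor (x : Omega τ) : ∀ p, ∀ ψ ∈ horDeg B n p,
    Omega.star τ (x * Omega.ofHor τ ψ) =
      Omega.ofHor τ (horStar B n ψ) * (Omega.parityLin τ)^[p] (Omega.star τ x) := by
  induction x using Omega.induction_on with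
  | zero =>
    intro p ψ _
    rw [zero_mul, map_zero, iterate_map_zero, mul_zero]
  | add x y hx hy =>
    intro p ψ h
    rw [add_mul, map_add, hx p ψ h, hy p ψ h, map_add, iterate_map_add, mul_add]
  | tmul φ η =>
    rw [← Omega.ofHor_mul_ofPsi]
    have h0 : ∀ p, ∀ ψ ∈ horDeg B n p, Omega.star τ (Omega.ofHor τ φ * Omega.ofHor τ ψ) =
        Omega.ofHor τ (horStar B n ψ) *
          (Omega.parityLin τ)^[p] (Omega.star τ (Omega.ofHor τ φ)) := by
      intro p ψ h
      rw [← map_mul, Omega.star_ofHor, Omega.star_ofHor, horStar_mul _ h, Omega.iterate_ofHor,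
        map_mul]
    generalize Omega.ofHor τ φ = x at h0 ⊢
    induction η using PsiExt.induction generalizing x with
    | algebraMap r =>
      intro p ψ h
      rw [AlgHom.commutes, ← Algebra.commutes, ← Algebra.smul_def, smul_mul_assoc,
        LinearMap.map_smulₛₗ, LinearMap.map_smulₛₗ, h0 p ψ h, ← mul_smul_comm]
      congr 1
      have := fun y => LinearMap.map_smul ((Omega.parityLin τ : Module.End ℂ (Omega τ)) ^ p)
        ((starRingEnd ℂ) r) y
      simp only [Module.End.pow_apply] at this
      rw [this]
    | ι ϑ => exact Omega.star_ι_mul_ofHor x h0 ϑ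
    | mul η ζ hη hζ =>
      rw [map_mul, ← mul_assoc]
      exact hζ _ (hη x h0)
    | add η ζ hη hζ =>
      intro p ψ h
      rw [map_add, mul_add, add_mul, map_add, hη x h0 p ψ h, hζ x h0 p ψ h, map_add,
        iterate_map_add, mul_add]

theorem Omega.starPsi_mul_apply {q : ℕ} {η : PsiExt τ} (h : η ∈ PsiExt.deg τ q) (x y : Omega τ) :
    Omega.starPsi τ η (x * y) = Omega.starPsi τ η x * (Omega.parityLin τ)^[q] y := by
  induction h using Submodule.pow_induction_on_left' generalizing x y with
  | algebraMap r =>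
    rw [Algebra.algebraMap_eq_smul_one, LinearMap.map_smulₛₗ, Omega.starPsi_one,
      LinearMap.smul_apply, LinearMap.smul_apply, Module.End.one_apply, Module.End.one_apply,
      smul_mul_assoc]
    rfl
  | add η ζ i _ _ hη hζ =>
    rw [map_add, LinearMap.add_apply, LinearMap.add_apply, hη, hζ, add_mul]
  | mem_mul v hv i η _ hη =>
    obtain ⟨ϑ, rfl⟩ := hv
    rw [Omega.starPsi_mul, Module.End.mul_apply, Module.End.mul_apply, Omega.starPsi_ι,
      Omega.starPsi_ι, Omega.parity_mul, ← mul_assoc, hη, Nat.succ_eq_add_one,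
      Function.iterate_succ_apply]

theorem Omega.star_mul' (x : Omega τ) {k : ℕ} {y : Omega τ} (hy : y ∈ Omega.deg τ k) :
    Omega.star τ (x * y) = Omega.star τ y * (Omega.parityLin τ)^[k] (Omega.star τ x) := by
  induction hy using Submodule.span_induction with
  | zero => simp
  | add y z _ _ hy hz => rw [mul_add, map_add, map_add, hy, hz, add_mul]
  | smul c y _ hy =>
    rw [mul_smul_comm, LinearMap.map_smulₛₗ, LinearMap.map_smulₛₗ, hy, smul_mul_assoc]
  | mem y hy =>
    obtain ⟨p, q, rfl, ψ, hψ, η, hη, rfl⟩ := hy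
    rw [← Omega.ofHor_mul_ofPsi, ← mul_assoc, Omega.star_mul_ofPsi, Omega.star_mul_ofHor x p ψ hψ,
      Omega.starPsi_mul_apply hη, ← Function.iterate_add_apply, Omega.star_mul_ofPsi,
      Omega.star_ofHor, add_comm]

theorem Omega.parity_mem {k : ℕ} {x : Omega τ} (hx : x ∈ Omega.deg τ k) :
    Omega.parityLin τ x ∈ Omega.deg τ k := by
  rw [Omega.parity_of_mem hx]; exact Submodule.smul_mem _ _ hx

theorem Omega.starPsi_mem {q : ℕ} {η : PsiExt τ} (h : η ∈ PsiExt.deg τ q) {k : ℕ} {x : Omega τ}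
    (hx : x ∈ Omega.deg τ k) : Omega.starPsi τ η x ∈ Omega.deg τ (k + q) := by
  induction h using Submodule.pow_induction_on_left' generalizing x k with
  | algebraMap r =>
    rw [Algebra.algebraMap_eq_smul_one, LinearMap.map_smulₛₗ, Omega.starPsi_one,
      LinearMap.smul_apply]
    exact Submodule.smul_mem _ _ hx
  | add η ζ i _ _ hη hζ => rw [map_add, LinearMap.add_apply]; exact add_mem (hη hx) (hζ hx)
  | mem_mul v hv i η _ hη =>
    obtain ⟨ϑ, rfl⟩ := hv
    rw [Omega.starPsi_mul, Module.End.mul_apply, Omega.starPsi_ι]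
    have := hη (Omega.ι_mul_mem (PsiInv.star τ ϑ) (Omega.parity_mem hx))
    rwa [add_assoc, add_comm 1 i] at this

theorem Omega.star_mem {k : ℕ} {x : Omega τ} (hx : x ∈ Omega.deg τ k) :
    Omega.star τ x ∈ Omega.deg τ k := by
  induction hx using Submodule.span_induction with
  | zero => simp
  | add y z _ _ hy hz => rw [map_add]; exact add_mem hy hz
  | smul c y _ hy => rw [LinearMap.map_smulₛₗ]; exact Submodule.smul_mem _ _ hy
  | mem y hy =>
    obtain ⟨p, q, rfl, ψ, hψ, η, hη, rfl⟩ := hy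
    exact Omega.starPsi_mem hη (Omega.ofHor_mem (horStar_mem hψ))

/-- `(xy)^* = (-1)^{∂x∂y} y^* x^*`. -/
theorem Omega.star_mul {j k : ℕ} {x y : Omega τ} (hx : x ∈ Omega.deg τ j)
    (hy : y ∈ Omega.deg τ k) :
    Omega.star τ (x * y) = (-1 : ℂ) ^ (j * k) • (Omega.star τ y * Omega.star τ x) := by
  rw [Omega.star_mul' x hy, Omega.iterate_of_mem k (Omega.star_mem hx), mul_smul_comm, mul_comm k j]

theorem conj_sign (k : ℕ) : (starRingEnd ℂ) ((-1 : ℂ) ^ k) = (-1 : ℂ) ^ k := by simp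

theorem sign_mul_self (k : ℕ) : (-1 : ℂ) ^ k * (-1 : ℂ) ^ k = 1 := by
  rw [← mul_pow]; simp

theorem Omega.star_star_mul {j k : ℕ} {x y : Omega τ} (hx : x ∈ Omega.deg τ j)
    (hy : y ∈ Omega.deg τ k) (h : Omega.star τ (Omega.star τ x) = x)
    (h' : Omega.star τ (Omega.star τ y) = y) : Omega.star τ (Omega.star τ (x * y)) = x * y := by
  rw [Omega.star_mul hx hy, LinearMap.map_smulₛₗ,
    Omega.star_mul (Omega.star_mem hy) (Omega.star_mem hx), h, h', conj_sign, smul_smul,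
    mul_comm k j, sign_mul_self, one_smul]

/-- A property of elements of `vh_P` which follows from homogeneous elements. -/
theorem Omega.homog_induction {motive : Omega τ → Prop} (x : Omega τ)
    (ofHor : ∀ p, ∀ φ ∈ horDeg B n p, motive (Omega.ofHor τ φ))
    (ι : ∀ ϑ, motive (Omega.ofPsi τ (PsiExt.ι τ ϑ)))
    (mul : ∀ j k, ∀ x ∈ Omega.deg τ j, ∀ y ∈ Omega.deg τ k, motive x → motive y → motive (x * y))
    (add : ∀ x y, motive x → motive y → motive (x + y)) : motive x := by
  induction x using Omega.induction_on with
  | zero => rw [← map_zero (Omega.ofHor τ)]; exact ofHor 0 0 (zero_mem _)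
  | add x y hx hy => exact add _ _ hx hy
  | tmul φ η =>
    induction φ using hor_homog_induction with
    | add x y hx hy => rw [Omega.add_tmul]; exact add _ _ hx hy
    | homog p φ hφ =>
      have hη := PsiExt.exists_deg η
      induction hη using Submodule.iSup_induction' with
      | zero =>
        rw [← Omega.ofHor_mul_ofPsi, map_zero, mul_zero, ← map_zero (Omega.ofHor τ)]
        exact ofHor 0 0 (zero_mem _)
      | add x y _ _ hx hy => rw [Omega.tmul_add]; exact add _ _ hx hy
      | mem q η hη =>
        rw [← Omega.ofHor_mul_ofPsi]
        refine mul p q _ (Omega.ofHor_mem hφ) _ (Omega.ofPsi_mem hη) (ofHor p φ hφ) ?_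
        induction hη using Submodule.pow_induction_on_left' with
        | algebraMap r =>
          rw [AlgHom.commutes, ← AlgHom.commutes (Omega.ofHor τ), Algebra.algebraMap_eq_smul_one]
          exact ofHor 0 _ (Submodule.smul_mem _ _ one_mem_horDeg)
        | add η ζ i _ _ hη hζ => rw [map_add]; exact add _ _ hη hζ
        | mem_mul v hv i η hη' hη =>
          obtain ⟨ϑ, rfl⟩ := hv
          rw [map_mul]
          exact mul 1 i _ (Omega.ofPsi_mem (PsiExt.ι_mem ϑ)) _ (Omega.ofPsi_mem hη') (ι ϑ) hη

theorem Omega.star_star (x : Omega τ) : Omega.star τ (Omega.star τ x) = x := by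
  induction x using Omega.homog_induction with
  | ofHor p φ _ => rw [Omega.star_ofHor, Omega.star_ofHor, horStar_horStar]
  | ι ϑ => rw [Omega.star_ι, Omega.star_ι, PsiInv.star_star]
  | mul j k x hx y hy h h' => exact Omega.star_star_mul hx hy h h'
  | add x y hx hy => rw [map_add, map_add, hx, hy]

theorem Omega.star_ofCoact_π (φ : Hor B n) :
    Omega.star τ (Omega.ofCoact (PsiExt.π τ) (coactHor P u φ)) =
      Omega.ofCoact (PsiExt.π τ) (coactHor P u (horStar B n φ)) := by
  have key : ∀ w : Hor B n ⊗[ℂ] Pol G, Omega.star τ (Omega.ofCoact (PsiExt.π τ) w) =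
      Omega.ofCoact (PsiExt.π τ) (coactHor P u (slice _ 1 (horPolStar G B n w))) -
        Omega.ofCoact (PsiExt.π τ) (antiCoact P u (horPolStar G B n w)) := by
    intro w
    induction w using TensorProduct.induction_on with
    | zero => simp
    | add x y hx hy => simp only [map_add, hx, hy]; abel
    | tmul φ c =>
      have h := ofCoact_π_mul (τ := τ) (1 ⊗ₜ antipodeHom (Star.star c))
        (horParity B n (horStar B n φ))
      rw [horParity_horParity, Omega.ofCoact_tmul, ← Omega.ofPsi_apply, slice_tmul,
        evalAt_antipodeHom, inv_one, map_smul, map_one, smul_mul_assoc, one_mul] at h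
      rw [Omega.ofCoact_tmul, ← Omega.ofHor_mul_ofPsi, PsiExt.π, LinearMap.comp_apply,
        Omega.star_mul_ι, Omega.star_ofHor, Omega.parity_ofHor, PsiInv.star_π, star_antipodeHom,
        horPolStar_tmul, antiCoact_tmul, slice_tmul, map_neg, map_neg, neg_mul, map_smul, map_smul]
      change -(Omega.ofPsi τ (PsiExt.π τ _) * _) = _ • Omega.ofCoact (PsiExt.π τ) _ -
        Omega.ofCoact (PsiExt.π τ) _
      rw [h]
      abel
  rw [key, ← coactHor_star, slice_coactHor, act_one, antiCoact_coactHor, Omega.ofCoact_tmul,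
    PsiExt.π_one, ← Omega.ofHor_mul_ofPsi]
  simp

theorem Omega.star_pi2 (z : Pol G ⊗[ℂ] Pol G) :
    Omega.star τ (Omega.ofPsi τ (pi2 τ z)) = - Omega.ofPsi τ (pi2 τ (polAnti G z)) := by
  induction z using TensorProduct.induction_on with
  | zero => simp
  | add x y hx hy => simp only [map_add, hx, hy, neg_add]
  | tmul x y =>
    rw [pi2_tmul, map_mul, Omega.star_mul_ι, Omega.star_ι, Omega.parity_ofPsi, PsiExt.parity_ι,
      PsiInv.star_π, PsiInv.star_π, polAnti_tmul, pi2_tmul]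
    simp

theorem diff_star_mul (D : Preconnection τ.toFrameStructure) {j k : ℕ} {x y : Omega τ}
    (hx : x ∈ Omega.deg τ j) (hy : y ∈ Omega.deg τ k)
    (h : diff D (Omega.star τ x) = Omega.star τ (diff D x))
    (h' : diff D (Omega.star τ y) = Omega.star τ (diff D y)) :
    diff D (Omega.star τ (x * y)) = Omega.star τ (diff D (x * y)) := by
  rw [Omega.star_mul hx hy, map_smul, diff_mul, diff_mul, map_add,
    Omega.star_mul (diff_mem D hx) hy, Omega.parity_of_mem hx,
    Omega.parity_of_mem (Omega.star_mem hy), smul_mul_assoc, smul_mul_assoc, LinearMap.map_smulₛₗ,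
    Omega.star_mul hx (diff_mem D hy), h, h', conj_sign, smul_add, smul_smul, smul_smul, ← pow_add,
    ← pow_add, add_comm]
  congr 2
  · rw [add_mul, one_mul]
  · rw [mul_add, mul_one, ← add_assoc, add_right_comm, pow_add, pow_add, sign_mul_self, one_mul]

theorem diff_star (D : Preconnection τ.toFrameStructure) (x : Omega τ) :
    diff D (Omega.star τ x) = Omega.star τ (diff D x) := by
  induction x using Omega.homog_induction with
  | ofHor p φ _ =>
    rw [Omega.star_ofHor, diff_ofHor, diff_ofHor, diffHor_apply, diffHor_apply, map_add,
      Omega.star_ofHor, D.hermitian, Omega.star_ofCoact_π, horStar_parity]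
  | ι ϑ =>
    obtain ⟨a, rfl⟩ := PsiInv.π_surjective τ ϑ
    rw [Omega.star_ι, diff_ι, map_sub, Omega.star_ofHor, Omega.star_pi2, PsiInv.star_π, map_neg,
      map_neg, map_neg, diff_ι, comul_anti, ← horStar_horStar (curvature D (Star.star _)),
      star_curvature, map_neg, map_neg]
    abel
  | mul j k x hx y hy h h' => exact diff_star_mul D hx hy h h'
  | add x y hx hy => simp only [map_add, hx, hy]

end StarProperties

section Structure

/-- A structure of graded-differential `*`-algebra on a complex algebra `A`: a grading
`A = ⨁ₖ Aᵏ`, a hermitian differential `d` of degree one satisfying the graded Leibniz rule and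
`d² = 0`, and an antilinear involution with `(xy)^* = (-1)^{∂x∂y} y^* x^*`. -/
structure GradedDifferentialStarStructure (A : Type*) [Ring A] [Algebra ℂ A] where
  deg : ℕ → Submodule ℂ A
  isInternal : DirectSum.IsInternal deg
  one_mem : 1 ∈ deg 0
  mul_mem : ∀ {j k : ℕ} {x y : A}, x ∈ deg j → y ∈ deg k → x * y ∈ deg (j + k)
  d : A →ₗ[ℂ] A
  d_mem : ∀ {k : ℕ} {x : A}, x ∈ deg k → d x ∈ deg (k + 1)
  d_mul : ∀ {k : ℕ} {x : A}, x ∈ deg k → ∀ y, d (x * y) = d x * y + (-1 : ℂ) ^ k • (x * d y)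
  d_d : ∀ x, d (d x) = 0
  star : A →ₗ⋆[ℂ] A
  star_mem : ∀ {k : ℕ} {x : A}, x ∈ deg k → star x ∈ deg k
  star_mul : ∀ {j k : ℕ} {x y : A}, x ∈ deg j → y ∈ deg k →
    star (x * y) = (-1 : ℂ) ^ (j * k) • (star y * star x)
  star_star : ∀ x, star (star x) = x
  d_star : ∀ x, d (star x) = star (d x)

/-- The differential subalgebra generated by a subset: the smallest subalgebra which contains the
subset and which is stable under the differential. -/
def GradedDifferentialStarStructure.differentialClosure {A : Type*} [Ring A] [Algebra ℂ A]
    (Γ : GradedDifferentialStarStructure A) (S : Set A) : Subalgebra ℂ A :=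
  sInf {T | S ⊆ T ∧ ∀ x ∈ T, Γ.d x ∈ T}

/-- The graded-differential `*`-algebra `Ω_P`, in the representation `Ω_P ↔ (vh_P, ∂_D)` given by
the preconnection `D`. -/
def omegaP {m n : ℕ} {G : Subgroup (GL (Fin m) ℂ)} [CompactSpace G] {B : Type*} [Ring B]
    [Algebra ℂ B] [StarRing B] [StarModule ℂ B] {P : QuantumPrincipalBundle G B}
    {u : RealUnitaryRep G n} (τ : IntegrableFrameStructure P u)
    (D : Preconnection τ.toFrameStructure) : GradedDifferentialStarStructure (Omega τ) where
  deg := Omega.deg τ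
  isInternal := Omega.isInternal
  one_mem := by
    rw [← map_one (Omega.ofHor τ)]; exact Omega.ofHor_mem one_mem_horDeg
  mul_mem := Omega.mul_mem_deg
  d := diff D
  d_mem := diff_mem D
  d_mul := fun hx y => by rw [diff_mul, Omega.parity_of_mem hx, smul_mul_assoc]
  d_d := diff_diff D
  star := Omega.star τ
  star_mem := Omega.star_mem
  star_mul := Omega.star_mul
  star_star := Omega.star_star
  d_star := diff_star D

end Structure

end FramedBundle

end

/-!
The embedding of `ℬ` is read off from the bigrading of `vh_P = hor_P ⊗ Ψ_inv^∧`: the degree-zero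
parts of the two factors are `ℬ` and `ℂ`, so `ℬ` is all of the degree zero, and it embeds because
`Ψ_inv^∧` is nonzero. The `*`-structure of `vh_P` extends that of `hor_P`, hence that of `ℬ`.

For the generation, let `T` be a subalgebra which contains `ℬ` and is stable under `∂_D`. On the
base algebra `𝒱` the vertical part of `∂_D` vanishes, since `F(v) = v ⊗ 1` and `π(1) = 0`, so
`∂_D(v) = D(v)` is in `T`; by completeness of the frame, each `θᵢ` has the form `∑ b D(v)`
(`Preconnection.theta_mem`). Hence `T` contains `hor_P`. Subtracting the horizontal part `D(b)` from
`∂_D(b)`, it contains `∑ bₖ π(cₖ)` for every `b ∈ ℬ` with `F(b) = ∑ bₖ ⊗ cₖ`. Freeness of the action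
expresses `1 ⊗ a` as `∑ q F(b)`, so `π(a) = ∑ q (∑ bₖ π(cₖ))` is in `T` for every `a ∈ 𝒜`.
Finally `hor_P` and `Ψ_inv = π(𝒜)` generate `vh_P`.
-/

namespace FramedBundle

variable {m n : ℕ} {G : Subgroup (GL (Fin m) ℂ)} [CompactSpace G] {B : Type*} [Ring B]
  [Algebra ℂ B] [StarRing B] [StarModule ℂ B] {P : QuantumPrincipalBundle G B}
  {u : RealUnitaryRep G n} {τ : IntegrableFrameStructure P u}

/-- `Ψ_inv^∧` has a character, namely the one which vanishes on `Ψ_inv`. -/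
theorem PsiExt.nontrivial : Nontrivial (PsiExt τ) :=
  (PsiExt.lift (τ := τ) (0 : PsiInv τ →ₗ[ℂ] ℂ) fun r _ => by
    rw [LinearMap.zero_comp, convSq, TensorProduct.map_zero_left]; simp).toRingHom.domain_nontrivial

theorem Omega.ofHor_injective : Function.Injective (Omega.ofHor τ) := by
  have := PsiExt.nontrivial (τ := τ)
  exact Algebra.TensorProduct.includeLeft_injective (S := ℂ) (A := Hor B n) (B := PsiExt τ)
    (algebraMap ℂ (PsiExt τ)).injective

theorem Omega.ofB_injective : Function.Injective (Omega.ofB τ) :=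
  Omega.ofHor_injective.comp <|
    Algebra.TensorProduct.includeLeft_injective (S := ℂ) (algebraMap ℂ (Ext n)).injective

theorem horDeg_zero_le : horDeg B n 0 ≤ Subalgebra.toSubmodule (inclB B n).range := by
  rw [horDeg_eq, Submodule.span_le]
  rintro _ ⟨b, ω, hω, rfl⟩
  rw [ExteriorAlgebra.exteriorPower, pow_zero, Submodule.mem_one] at hω
  obtain ⟨r, rfl⟩ := hω
  refine ⟨r • b, ?_⟩
  rw [Algebra.algebraMap_eq_smul_one, TensorProduct.tmul_smul]
  rfl

theorem Omega.toSubmodule_range_ofB :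
    Subalgebra.toSubmodule (Omega.ofB τ).range = Omega.deg τ 0 := by
  apply le_antisymm
  · rintro _ ⟨b, rfl⟩
    exact Omega.ofHor_mem (inclB_mem_horDeg b)
  · rw [Omega.deg, Submodule.span_le]
    rintro _ ⟨p, q, hpq, φ, hφ, η, hη, rfl⟩
    obtain ⟨rfl, rfl⟩ : p = 0 ∧ q = 0 := by omega
    obtain ⟨b, rfl⟩ := horDeg_zero_le hφ
    rw [PsiExt.deg, pow_zero, Submodule.mem_one] at hη
    obtain ⟨r, rfl⟩ := hη
    refine ⟨r • b, ?_⟩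
    rw [Algebra.algebraMap_eq_smul_one, Omega.tmul_smul]
    exact map_smul (Omega.ofB τ) r b

/-- `∂_D(b) = D(b) + ∑ bₖ π(cₖ)` for `b ∈ ℬ`. -/
theorem diff_ofB (D : Preconnection τ.toFrameStructure) (b : B) :
    diff D (Omega.ofB τ b) = Omega.ofHor τ (D.D (inclB B n b)) +
      Omega.ofCoact (PsiExt.π τ) (coactHor P u (inclB B n b)) := by
  rw [Omega.ofB, AlgHom.comp_apply, diff_ofHor, diffHor_apply, horParity_inclB]

theorem diff_ofB_of_mem_base (D : Preconnection τ.toFrameStructure) {v : B} (hv : v ∈ P.base) :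
    diff D (Omega.ofB τ v) = Omega.ofHor τ (D.D (inclB B n v)) := by
  rw [diff_ofB, mem_baseForms.1 (inclB_mem hv), Omega.ofCoact_tmul, PsiExt.π_one,
    ← Omega.ofHor_mul_ofPsi, map_zero, mul_zero, add_zero]

theorem Omega.ofCoact_mul_left (f : Pol G →ₗ[ℂ] PsiExt τ) (φ : Hor B n)
    (x : Hor B n ⊗[ℂ] Pol G) :
    Omega.ofCoact f ((φ ⊗ₜ 1) * x) = Omega.ofHor τ φ * Omega.ofCoact f x := by
  induction x using TensorProduct.induction_on with
  | zero => simp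
  | add x y hx hy => simp only [map_add, mul_add, hx, hy]
  | tmul ψ a =>
    rw [Algebra.TensorProduct.tmul_mul_tmul, one_mul, Omega.ofCoact_tmul, Omega.ofCoact_tmul,
      Omega.ofHor_mul_tmul]

section Generation

variable {D : Preconnection τ.toFrameStructure} {T : Subalgebra ℂ (Omega τ)}

/-- By completeness of the frame, a differential subalgebra containing `ℬ` contains `hor_P`. -/
theorem ofHor_mem_of_differential (hB : ∀ b, Omega.ofB τ b ∈ T) (hd : ∀ x ∈ T, diff D x ∈ T)
    (φ : Hor B n) : Omega.ofHor τ φ ∈ T := by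
  obtain ⟨X⟩ := τ.integrable
  refine hor_induction ((Subalgebra.toSubmodule T).comap (Omega.ofHor τ).toLinearMap)
    ?_ (fun b φ hφ => ?_) (fun i φ hφ => ?_) φ
  · change Omega.ofHor τ 1 ∈ T
    rw [map_one]
    exact one_mem T
  · change Omega.ofHor τ (inclB B n b * φ) ∈ T
    rw [map_mul]
    exact mul_mem (hB b) hφ
  · change Omega.ofHor τ (theta B i * φ) ∈ T
    obtain ⟨N, b, v, h⟩ := D.theta_mem X i
    rw [map_mul, h, map_sum]
    refine mul_mem (sum_mem fun α _ => ?_) hφ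
    rw [map_mul, ← diff_ofB_of_mem_base D (v α).2]
    exact mul_mem (hB _) (hd _ (hB _))

/-- By freeness of the action, a differential subalgebra containing `ℬ` contains `Ψ_inv`. -/
theorem ofPsi_ι_mem_of_differential (hB : ∀ b, Omega.ofB τ b ∈ T) (hd : ∀ x ∈ T, diff D x ∈ T)
    (ϑ : PsiInv τ) : Omega.ofPsi τ (PsiExt.ι τ ϑ) ∈ T := by
  obtain ⟨a, rfl⟩ := PsiInv.π_surjective τ ϑ
  have hvert : ∀ b, Omega.ofCoact (PsiExt.π τ) (coactHor P u (inclB B n b)) ∈ T := fun b => by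
    rw [eq_sub_of_add_eq' (diff_ofB D b).symm]
    exact sub_mem (hd _ (hB b)) (ofHor_mem_of_differential hB hd _)
  obtain ⟨N, q, b, h⟩ := exists_free (P := P) (u := u) a
  have h' : Omega.ofPsi τ (PsiExt.ι τ (PsiInv.π τ a)) =
      Omega.ofCoact (PsiExt.π τ) ((1 : Hor B n) ⊗ₜ[ℂ] a) := rfl
  rw [h', ← h, map_sum]
  refine sum_mem fun k _ => ?_
  rw [Omega.ofCoact_mul_left]
  exact mul_mem (hB _) (hvert _)

/-- A differential subalgebra of `(vh_P, ∂_D)` which contains `ℬ` is the whole algebra. -/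
theorem eq_top_of_differential (hB : ∀ b, Omega.ofB τ b ∈ T) (hd : ∀ x ∈ T, diff D x ∈ T) :
    T = ⊤ :=
  Algebra.eq_top_iff.2 fun x => Omega.induction_mul x (ofHor_mem_of_differential hB hd)
    (ofPsi_ι_mem_of_differential hB hd) (fun _ _ => mul_mem) (fun _ _ => add_mem)

end Generation

end FramedBundle

theorem mainTheorem5 {m n : ℕ} (G : Subgroup (GL (Fin m) ℂ)) [CompactSpace G] {B : Type*} [Ring B]
    [Algebra ℂ B] [StarRing B] [StarModule ℂ B] (P : FramedBundle.QuantumPrincipalBundle G B)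
    (u : FramedBundle.RealUnitaryRep G n) (τ : FramedBundle.IntegrableFrameStructure P u)
    (D : FramedBundle.Preconnection τ.toFrameStructure) :
    Function.Injective (FramedBundle.Omega.ofB τ) ∧
    (∀ b, FramedBundle.Omega.ofB τ (star b) =
      (FramedBundle.omegaP τ D).star (FramedBundle.Omega.ofB τ b)) ∧
    Subalgebra.toSubmodule (FramedBundle.Omega.ofB τ).range = (FramedBundle.omegaP τ D).deg 0 ∧
    (FramedBundle.omegaP τ D).differentialClosure (Set.range (FramedBundle.Omega.ofB τ)) = ⊤ := by
  refine ⟨FramedBundle.Omega.ofB_injective, fun b => ?_,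
    FramedBundle.Omega.toSubmodule_range_ofB, ?_⟩
  · change _ = FramedBundle.Omega.star τ (FramedBundle.Omega.ofHor τ (FramedBundle.inclB B n b))
    rw [FramedBundle.Omega.star_ofHor, FramedBundle.horStar_inclB]
    rfl
  · rw [FramedBundle.GradedDifferentialStarStructure.differentialClosure, sInf_eq_top]
    rintro T ⟨hB, hd⟩
    exact FramedBundle.eq_top_of_differential (D := D) (fun b => hB ⟨b, rfl⟩) hd
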